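/- Let $Sp(2)$ be the group of $\mathbb H$-linear unitary transformations of $\mathbb C^4\simeq\mathbb H^2$ (the unitary matrices commuting with the quaternionic structure $v\mapsto\Omega\bar v$, $\Omega=\mathrm{diag}\left(\left(\begin{smallmatrix}0&-1\\1&0\end{smallmatrix}\right),\left(\begin{smallmatrix}0&-1\\1&0\end{smallmatrix}\right)\right)$), acting on the complex projective space $\mathbb CP^3$ of complex lines of $\mathbb C^4$. This action is transitive and the isotropy subgroup of $[1:0:0:0]$ is the group $U(1)Sp(1)$ of quaternionic diagonal matrices $\mathrm{diag}(u,q)$, $u\in U(1)\subset Sp(1)$, $q\in Sp(1)$, so that $\mathbb CP^3\simeq Sp(2)/U(1)Sp(1)$. An almost Hermitian structure $(g,J)$ is a smooth Riemannian metric $g$ with a smooth almost complex structure $J$ such that $g(JX,JY)=g(X,Y)$; it is (strictly) nearly Kähler if $(\nabla_XJ)X=0$ for all $X$, where $\nabla$ is the Levi-Civita connection of $g$, and $\nabla J\neq0$ (it is not Kähler). Let $Z$ be the twistor space of the oriented round unit sphere $S^4\subset\mathbb R^5$: the set of pairs $(x,j)$ with $x\in S^4$ and $j$ an orthogonal complex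 structure of $T_xS^4$ compatible with the orientation. Its tangent space at $(x,j)$ is the sum of the horizontal space $H\simeq T_xS^4$ of the Levi-Civita connection of $S^4$ and of the vertical space $V$ of the skew-symmetric endomorphisms $A$ of $T_xS^4$ with $Aj=-jA$. Let $J_-$ be the almost complex structure equal to $j$ on $H$ and to $A\mapsto -jA$ on $V$. For $t>0$, let $g_t$ be the metric for which $H$ and $V$ are orthogonal, which is the round metric on $H\simeq T_xS^4$ and $\frac t2\cdot\frac14\mathrm{tr}(A^{T}B)$ on $V$. Let $\pi:\mathbb CP^3\to\mathbb HP^1=S^4$ be the fibration $\mathbb Cv\mapsto\mathbb Cv\oplus\mathbb C\Omega\bar v$, that is, the map to $S^4\subset\mathbb C\oplus\mathbb C\oplus\mathbb R$, $$[v_0:v_1:v_2:v_3]\mapsto\frac{\left(2(v_0\bar v_2+\bar v_1v_3),\;2(v_0\bar v_3-\bar v_1v_2),\;|v_0|^2+|v_1|^2-|v_2|^2-|v_3|^2\right)}{|v_0|^2+|v_1|^2+|v_2|^2+|v_3|^2}.$$ **Proposition.** There is a smooth map $p\mapsto j_p$ such that $p\mapsto(\pi(p),j_p)$ is a bijection of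 $\mathbb CP^3$ onto $Z$, where $j_p$ is the complex structure induced on $T_{\pi(p)}S^4$ by multiplication by $i$ on $T_p\mathbb CP^3$, i.e. $j_p\circ d\pi_p=d\pi_p\circ i$. The structure $(g_1,J_-)$, transported from $Z$ to $\mathbb CP^3$ by this map, is a smooth $Sp(2)$-invariant (strictly) nearly Kähler structure on $\mathbb CP^3$. It is the only one up to homothety and sign: for every $Sp(2)$-invariant (strictly) nearly Kähler structure $(g,J)$ on $\mathbb CP^3$ there are a constant $c>0$ and a sign $\varepsilon=\pm1$ such that $g=c\,g_1$ and $J=\varepsilon J_-$. -/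

import Mathlib

open scoped Manifold ContDiff Matrix ComplexConjugate LinearAlgebra.Projectivization
open Bundle

noncomputable section

/-! ## Almost Hermitian geometry on a smooth manifold -/

section AlmostHermitian

variable (E : Type*) [NormedAddCommGroup E] [NormedSpace ℝ E]
  (M : Type*) [TopologicalSpace M] [ChartedSpace E M] [IsManifold 𝓘(ℝ, E) ∞ M]

/-- A smooth almost Hermitian structure `(g, J)` on the manifold `M`: a smooth Riemannian metric
and a smooth almost complex structure which is orthogonal for the metric at every point. -/
structure AlmostHermitian where
  /-- The Riemannian metric. -/
  g : ContMDiffRiemannianMetric 𝓘(ℝ, E) ∞ E (fun x : M => TangentSpace 𝓘(ℝ, E) x)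
  /-- The almost complex structure. -/
  J : ∀ x : M, TangentSpace 𝓘(ℝ, E) x →L[ℝ] TangentSpace 𝓘(ℝ, E) x
  smooth_J : ContMDiff 𝓘(ℝ, E) (𝓘(ℝ, E).prod 𝓘(ℝ, E →L[ℝ] E)) ∞
    (fun x => TotalSpace.mk' (E →L[ℝ] E)
      (E := fun x : M => TangentSpace 𝓘(ℝ, E) x →L[ℝ] TangentSpace 𝓘(ℝ, E) x) x (J x))
  J_sq : ∀ (x : M) (u : TangentSpace 𝓘(ℝ, E) x), J x (J x u) = -u
  compat : ∀ (x : M) (u v : TangentSpace 𝓘(ℝ, E) x), g.inner x (J x u) (J x v) = g.inner x u v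

variable {E M}

/-- The vector field (or family of tangent vectors) `X` is differentiable at the point `x`. -/
def DiffFieldAt (X : ∀ x : M, TangentSpace 𝓘(ℝ, E) x) (x : M) : Prop :=
  MDifferentiableAt 𝓘(ℝ, E) (𝓘(ℝ, E).prod 𝓘(ℝ, E))
    (fun y => (TotalSpace.mk' E y (X y) : TangentBundle 𝓘(ℝ, E) M)) x

/-- `D` is the Levi-Civita connection of `g`: it is torsion-free and
`u · g(Y, Z) = g(D_u Y, Z) + g(Y, D_u Z)`.
With Mathlib's argument order, `D Y x u` is `(D_u Y)(x)`. -/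
structure IsLeviCivita [CompleteSpace E] [FiniteDimensional ℝ E]
    (g : ContMDiffRiemannianMetric 𝓘(ℝ, E) ∞ E (fun x : M => TangentSpace 𝓘(ℝ, E) x))
    (D : CovariantDerivative 𝓘(ℝ, E) E (fun x : M => TangentSpace 𝓘(ℝ, E) x)) : Prop where
  torsion_free : D.torsion = 0
  metric : ∀ (Y Z : ∀ x : M, TangentSpace 𝓘(ℝ, E) x) (x : M) (u : TangentSpace 𝓘(ℝ, E) x),
    DiffFieldAt Y x → DiffFieldAt Z x →
      mvfderiv 𝓘(ℝ, E) (fun y => g.inner y (Y y) (Z y)) x u =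
        g.inner x (D Y x u) (Z x) + g.inner x (Y x) (D Z x u)

/-- `((D_u J) Y)(x) = (D_u (J Y))(x) - J (D_u Y)(x)`. -/
def covDerivJ
    (D : CovariantDerivative 𝓘(ℝ, E) E (fun x : M => TangentSpace 𝓘(ℝ, E) x))
    (J : ∀ x : M, TangentSpace 𝓘(ℝ, E) x →L[ℝ] TangentSpace 𝓘(ℝ, E) x)
    (Y : ∀ x : M, TangentSpace 𝓘(ℝ, E) x) (x : M) (u : TangentSpace 𝓘(ℝ, E) x) :
    TangentSpace 𝓘(ℝ, E) x :=
  D (fun y => J y (Y y)) x u - J x (D Y x u)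

/-- `(M, g, J)` is (strictly) nearly Kähler: for the Levi-Civita connection `D` of `g` one has
`(D_X J) X = 0` for all `X`, and `D J` is not identically zero (so `(g, J)` is not Kähler). -/
def AlmostHermitian.IsStrictlyNearlyKahler [CompleteSpace E] [FiniteDimensional ℝ E]
    (S : AlmostHermitian E M) : Prop :=
  ∃ D : CovariantDerivative 𝓘(ℝ, E) E (fun x : M => TangentSpace 𝓘(ℝ, E) x),
    IsLeviCivita S.g D ∧
    (∀ (X : ∀ x : M, TangentSpace 𝓘(ℝ, E) x) (x : M), DiffFieldAt X x →
      covDerivJ D S.J X x (X x) = 0) ∧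
    ∃ (Y : ∀ x : M, TangentSpace 𝓘(ℝ, E) x) (x : M) (u : TangentSpace 𝓘(ℝ, E) x),
      DiffFieldAt Y x ∧ covDerivJ D S.J Y x u ≠ 0

/-- The almost Hermitian structure is invariant under an action of the group `G`: each `a : G`
acts by isometries of `g` whose differentials commute with `J`. -/
def AlmostHermitian.IsInvariant (G : Type*) [Group G] [MulAction G M]
    (S : AlmostHermitian E M) : Prop :=
  ∀ (a : G) (x : M) (u v : TangentSpace 𝓘(ℝ, E) x),
    S.g.inner (a • x) (mfderiv 𝓘(ℝ, E) 𝓘(ℝ, E) (fun y : M => a • y) x u)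
        (mfderiv 𝓘(ℝ, E) 𝓘(ℝ, E) (fun y : M => a • y) x v) = S.g.inner x u v ∧
    mfderiv 𝓘(ℝ, E) 𝓘(ℝ, E) (fun y : M => a • y) x (S.J x u) =
      S.J (a • x) (mfderiv 𝓘(ℝ, E) 𝓘(ℝ, E) (fun y : M => a • y) x u)

end AlmostHermitian

/-! ## The complex projective space as a smooth manifold -/

/-- Complex projective 3-space: the complex lines of `ℂ⁴`. -/
def CP3 : Type := ℙ ℂ (Fin 4 → ℂ)

namespace CP3

/-- The point `[v]` of homogeneous coordinates `v ≠ 0`. -/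
def mk (v : Fin 4 → ℂ) (hv : v ≠ 0) : CP3 := Projectivization.mk ℂ v hv

/-- Some homogeneous coordinates of a point. -/
def rep (p : CP3) : Fin 4 → ℂ := Projectivization.rep p

lemma rep_nonzero (p : CP3) : p.rep ≠ 0 := Projectivization.rep_nonzero p

lemma mk_rep (p : CP3) : mk p.rep p.rep_nonzero = p := Projectivization.mk_rep p

lemma exists_rep_mk (v : Fin 4 → ℂ) (hv : v ≠ 0) :
    ∃ c : ℂ, c ≠ 0 ∧ (mk v hv).rep = c • v := by
  obtain ⟨a, ha⟩ := Projectivization.exists_smul_eq_mk_rep ℂ v hv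
  exact ⟨a, a.ne_zero, ha.symm⟩

lemma mk_eq_mk {v w : Fin 4 → ℂ} (hv : v ≠ 0) (hw : w ≠ 0) {c : ℂ} (h : c • w = v) :
    mk v hv = mk w hw :=
  (Projectivization.mk_eq_mk_iff' ℂ v w hv hw).2 ⟨c, h⟩

lemma insertNth_ne_zero (i : Fin 4) (z : Fin 3 → ℂ) :
    (i.insertNth (1 : ℂ) z : Fin 4 → ℂ) ≠ 0 := by
  intro h
  have := congrFun h i
  simp at this

lemma exists_rep_ne (p : CP3) : ∃ i, p.rep i ≠ 0 := by
  by_contra! h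
  exact p.rep_nonzero (funext h)

/-- The affine chart `[v] ↦ (v_k / v_i)_{k ≠ i}` on the set `v_i ≠ 0`. -/
def affineChart (i : Fin 4) : PartialEquiv CP3 (Fin 3 → ℂ) where
  toFun p k := p.rep (i.succAbove k) / p.rep i
  invFun z := mk (i.insertNth 1 z) (insertNth_ne_zero i z)
  source := {p | p.rep i ≠ 0}
  target := Set.univ
  map_source' _ _ := Set.mem_univ _
  map_target' z _ := by
    obtain ⟨c, hc, h⟩ := exists_rep_mk _ (insertNth_ne_zero i z)
    simp [h, hc]
  left_inv' p hp := by
    have hp' : p.rep i ≠ 0 := hp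
    conv_rhs => rw [← p.mk_rep]
    refine mk_eq_mk _ _ (c := (p.rep i)⁻¹) ?_
    funext k
    refine Fin.succAboveCases i ?_ (fun k => ?_) k
    · simp [hp']
    · simp [div_eq_inv_mul]
  right_inv' z _ := by
    obtain ⟨c, hc, h⟩ := exists_rep_mk _ (insertNth_ne_zero i z)
    funext k
    simp [h, hc]

lemma affineChart_mk_apply (i : Fin 4) (v : Fin 4 → ℂ) (hv : v ≠ 0) (k : Fin 3) :
    affineChart i (mk v hv) k = v (i.succAbove k) / v i := by
  obtain ⟨c, hc, h⟩ := exists_rep_mk v hv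
  change (mk v hv).rep _ / (mk v hv).rep _ = _
  simp [h, mul_div_mul_left _ _ hc]

lemma mk_mem_affineChart_source (i : Fin 4) (v : Fin 4 → ℂ) (hv : v ≠ 0) :
    mk v hv ∈ (affineChart i).source ↔ v i ≠ 0 := by
  obtain ⟨c, hc, h⟩ := exists_rep_mk v hv
  change (mk v hv).rep _ ≠ 0 ↔ _
  simp [h, hc]

lemma transition_source (i j : Fin 4) :
    ((affineChart i).symm.trans (affineChart j)).source =
      {z | (i.insertNth (1 : ℂ) z : Fin 4 → ℂ) j ≠ 0} := by
  ext z
  simp only [PartialEquiv.trans_source, Set.mem_inter_iff, Set.mem_preimage]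
  constructor
  · rintro ⟨-, h⟩
    exact (mk_mem_affineChart_source j _ (insertNth_ne_zero i z)).1 h
  · intro h
    exact ⟨Set.mem_univ _, (mk_mem_affineChart_source j _ (insertNth_ne_zero i z)).2 h⟩

lemma contDiff_insertNth (i j : Fin 4) :
    ContDiff ℝ ∞ (fun z : Fin 3 → ℂ => (i.insertNth (1 : ℂ) z : Fin 4 → ℂ) j) := by
  refine Fin.succAboveCases i ?_ (fun k => ?_) j
  · simpa using contDiff_const
  · simpa using contDiff_apply ℝ ℂ k

lemma contDiffOn_transition (i j : Fin 4) :
    ContDiffOn ℝ ∞ ((affineChart i).symm.trans (affineChart j))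
      ((affineChart i).symm.trans (affineChart j)).source := by
  rw [transition_source]
  rw [contDiffOn_pi]
  intro k
  have h : ContDiffOn ℝ ∞ (fun z : Fin 3 → ℂ =>
      (i.insertNth (1 : ℂ) z : Fin 4 → ℂ) (j.succAbove k) /
        (i.insertNth (1 : ℂ) z : Fin 4 → ℂ) j)
      {z | (i.insertNth (1 : ℂ) z : Fin 4 → ℂ) j ≠ 0} :=
    ContDiffOn.mul (contDiff_insertNth i _).contDiffOn
      (ContDiffOn.inv (contDiff_insertNth i j).contDiffOn (fun _ hz => hz))
  refine h.congr (fun z _ => ?_)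
  exact affineChart_mk_apply j _ (insertNth_ne_zero i z) k

/-- The four affine charts, with their (smooth) transition maps. -/
def chartedSpaceCore : ChartedSpaceCore (Fin 3 → ℂ) CP3 where
  atlas := Set.range affineChart
  chartAt p := affineChart (Classical.choose p.exists_rep_ne)
  mem_chart_source p := Classical.choose_spec p.exists_rep_ne
  chart_mem_atlas _ := ⟨_, rfl⟩
  open_source := by
    rintro _ _ ⟨i, rfl⟩ ⟨j, rfl⟩
    rw [transition_source]
    exact isOpen_ne_fun (contDiff_insertNth i j).continuous continuous_const
  continuousOn_toFun := by
    rintro _ _ ⟨i, rfl⟩ ⟨j, rfl⟩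
    exact (contDiffOn_transition i j).continuousOn

/-- The usual topology, for which the affine charts are homeomorphisms onto `ℂ³`. -/
instance : TopologicalSpace CP3 := chartedSpaceCore.toTopologicalSpace

instance : ChartedSpace (Fin 3 → ℂ) CP3 := chartedSpaceCore.toChartedSpace

/-- The underlying real manifold, of real dimension 6. -/
instance : IsManifold 𝓘(ℝ, Fin 3 → ℂ) ∞ CP3 := by
  apply isManifold_of_contDiffOn
  intro e e' he he'
  obtain ⟨_, ⟨f, rfl⟩, ⟨_, ⟨⟨i, rfl⟩, rfl⟩, h⟩⟩ := he
  obtain ⟨_, ⟨f', rfl⟩, ⟨_, ⟨⟨j, rfl⟩, rfl⟩, h'⟩⟩ := he'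
  obtain rfl : e = _ := h
  obtain rfl : e' = _ := h'
  have key := contDiffOn_transition i j
  rw [modelWithCornersSelf_coe, modelWithCornersSelf_coe_symm, Set.range_id, Set.inter_univ,
    Function.id_comp, Function.comp_id, Set.preimage_id]
  exact key

/-- The standard (integrable) complex structure of `ℂP³`: multiplication by `i` in the
holomorphic affine charts. -/
def mulI (p : CP3) :
    TangentSpace 𝓘(ℝ, Fin 3 → ℂ) p →L[ℝ] TangentSpace 𝓘(ℝ, Fin 3 → ℂ) p :=
  (Complex.I • ContinuousLinearMap.id ℝ (Fin 3 → ℂ) : (Fin 3 → ℂ) →L[ℝ] (Fin 3 → ℂ))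

end CP3

/-! ## The homogeneous space `Sp(2) / U(1) Sp(1)` -/

/-- The matrix of the quaternionic structure of `ℂ⁴ = ℍ²`: the antilinear map `v ↦ Ω v̄`
squares to `-1`. -/
def quatΩ : Matrix (Fin 4) (Fin 4) ℂ :=
  !![0, -1, 0, 0;
     1, 0, 0, 0;
     0, 0, 0, -1;
     0, 0, 1, 0]

/-- The compact symplectic group `Sp(2)`: the unitary transformations of `ℂ⁴ = ℍ²` which are
`ℍ`-linear, that is, which commute with `v ↦ Ω v̄`. -/
def Sp2 : Subgroup (Matrix.unitaryGroup (Fin 4) ℂ) where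
  carrier := {A | (A : Matrix (Fin 4) (Fin 4) ℂ) * quatΩ =
    quatΩ * (A : Matrix (Fin 4) (Fin 4) ℂ).map conj}
  one_mem' := by simp
  mul_mem' {A B} hA hB := by
    simp only [Set.mem_ofPred_eq, Matrix.UnitaryGroup.mul_val, Matrix.map_mul] at hA hB ⊢
    rw [Matrix.mul_assoc, hB, ← Matrix.mul_assoc, hA, Matrix.mul_assoc]
  inv_mem' {A} hA := by
    simp only [Set.mem_ofPred_eq, Matrix.UnitaryGroup.inv_val] at hA ⊢
    have h1 : star (A : Matrix (Fin 4) (Fin 4) ℂ) * A = 1 := Matrix.UnitaryGroup.star_mul_self A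
    have h2 : (A : Matrix (Fin 4) (Fin 4) ℂ) * star (A : Matrix (Fin 4) (Fin 4) ℂ) = 1 :=
      mul_eq_one_comm.1 h1
    have h3 := congrArg (fun X : Matrix (Fin 4) (Fin 4) ℂ => X.map conj) h2
    simp only [Matrix.map_mul] at h3
    calc star (A : Matrix (Fin 4) (Fin 4) ℂ) * quatΩ
        = star (A : Matrix (Fin 4) (Fin 4) ℂ) * quatΩ *
          ((A : Matrix (Fin 4) (Fin 4) ℂ).map conj *
            (star (A : Matrix (Fin 4) (Fin 4) ℂ)).map conj) := by rw [h3]; simp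
      _ = star (A : Matrix (Fin 4) (Fin 4) ℂ) *
          (quatΩ * (A : Matrix (Fin 4) (Fin 4) ℂ).map conj) *
            (star (A : Matrix (Fin 4) (Fin 4) ℂ)).map conj := by simp only [Matrix.mul_assoc]
      _ = quatΩ * (star (A : Matrix (Fin 4) (Fin 4) ℂ)).map conj := by
          rw [← hA, ← Matrix.mul_assoc, h1, Matrix.one_mul]

/-- The complex matrix of an element of `Sp(2)`. -/
def sp2Matrix (A : Sp2) : Matrix (Fin 4) (Fin 4) ℂ := (A : Matrix.unitaryGroup (Fin 4) ℂ).1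

lemma sp2Matrix_mul (A B : Sp2) : sp2Matrix (A * B) = sp2Matrix A * sp2Matrix B := rfl

lemma sp2Matrix_one : sp2Matrix 1 = 1 := rfl

lemma sp2_mulVec_injective (A : Sp2) : Function.Injective (Matrix.mulVecLin (sp2Matrix A)) := by
  intro v w h
  have h1 : star (sp2Matrix A) * (sp2Matrix A) = 1 := Matrix.UnitaryGroup.star_mul_self A.1
  have := congrArg (fun u => star (sp2Matrix A) *ᵥ u) h
  simpa [h1] using this

/-- The action of `Sp(2)` on complex lines, `A • [v] = [A v]`. -/
instance : MulAction Sp2 CP3 where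
  smul A p := Projectivization.map (Matrix.mulVecLin (sp2Matrix A)) (sp2_mulVec_injective A) p
  one_smul (p : ℙ ℂ (Fin 4 → ℂ)) := by
    change Projectivization.map (Matrix.mulVecLin (sp2Matrix 1)) _ p = p
    induction p using Projectivization.ind with
    | h v hv => simp [Projectivization.map_mk, sp2Matrix_one]
  mul_smul A B (p : ℙ ℂ (Fin 4 → ℂ)) := by
    change Projectivization.map (Matrix.mulVecLin (sp2Matrix (A * B))) _ p =
      Projectivization.map (Matrix.mulVecLin (sp2Matrix A)) (sp2_mulVec_injective A)
        (Projectivization.map (Matrix.mulVecLin (sp2Matrix B)) (sp2_mulVec_injective B) p)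
    induction p using Projectivization.ind with
    | h v hv => simp [Projectivization.map_mk, sp2Matrix_mul]

lemma sp2_smul_mk (A : Sp2) (v : Fin 4 → ℂ) (hv : v ≠ 0) (hw : sp2Matrix A *ᵥ v ≠ 0) :
    A • CP3.mk v hv = CP3.mk (sp2Matrix A *ᵥ v) hw := rfl

/-- The base point `[1 : 0 : 0 : 0]`. -/
def CP3.basePoint : CP3 := CP3.mk (Pi.single 0 1) (by simp)

/-- The embedding of `U(1) × Sp(1)` (with `Sp(1) = SU(2)`) in `Sp(2)` as the quaternionic diagonal
matrices `diag(u, q)`, `u ∈ U(1) ⊂ Sp(1)`, `q ∈ Sp(1)`, written as complex matrices. -/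
def isotropyMatrix (a : Circle × Matrix.specialUnitaryGroup (Fin 2) ℂ) :
    Matrix (Fin 4) (Fin 4) ℂ :=
  !![(a.1 : ℂ), 0, 0, 0;
     0, conj (a.1 : ℂ), 0, 0;
     0, 0, a.2.1 0 0, a.2.1 0 1;
     0, 0, a.2.1 1 0, a.2.1 1 1]

/-! ## The twistor space of the round sphere `S⁴` and its fibration `ℂP³ → S⁴` -/

/-- The twistor space of the oriented round unit sphere `S⁴ ⊂ ℝ⁵`: the pairs `(x, j)` where
`x ∈ S⁴` and `j` is an orthogonal complex structure on `T_x S⁴ = x^⊥`, compatible with the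
orientation. The endomorphism `j` of `x^⊥` is extended by `j x = 0` to a matrix of size 5. -/
def twistorSpaceS4 : Set ((Fin 5 → ℝ) × Matrix (Fin 5) (Fin 5) ℝ) :=
  {p | p.1 ⬝ᵥ p.1 = 1 ∧ p.2ᵀ = -p.2 ∧ p.2 *ᵥ p.1 = 0 ∧
    p.2 * p.2 = -(1 - Matrix.vecMulVec p.1 p.1) ∧
    ∀ u v : Fin 5 → ℝ,
      0 ≤ Matrix.det (Matrix.of ![p.1, u, p.2 *ᵥ u, v, p.2 *ᵥ v])}

/-- The vertical part, in `End (x^⊥)`, of a vector `(x', j')` tangent to the twistor space at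
`(x, j)`. It is the covariant derivative of `j` along `x'` for the Levi-Civita connection of `S⁴`,
so that `(x', j')` is horizontal exactly when it vanishes. -/
def verticalPart (x : Fin 5 → ℝ) (j' : Matrix (Fin 5) (Fin 5) ℝ) : Matrix (Fin 5) (Fin 5) ℝ :=
  (1 - Matrix.vecMulVec x x) * j' * (1 - Matrix.vecMulVec x x)

/-- The twistor fibration `ℂP³ → S⁴ ⊂ ℂ ⊕ ℂ ⊕ ℝ = ℝ⁵`, the quaternionic Hopf map: it sends the
complex line `ℂ v` to the quaternionic line `ℂ v ⊕ ℂ Ω v̄`, a point of `ℍP¹ = S⁴`. -/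
def hopf (p : CP3) : Fin 5 → ℝ :=
  let v := p.rep
  let a : ℂ := v 0 * conj (v 2) + conj (v 1) * v 3
  let b : ℂ := v 0 * conj (v 3) - conj (v 1) * v 2
  (∑ k, Complex.normSq (v k))⁻¹ •
    ![2 * a.re, 2 * a.im, 2 * b.re, 2 * b.im,
      Complex.normSq (v 0) + Complex.normSq (v 1) - Complex.normSq (v 2) - Complex.normSq (v 3)]

/-- The differential of the twistor fibration. -/
def dHopf (p : CP3) (u : TangentSpace 𝓘(ℝ, Fin 3 → ℂ) p) : Fin 5 → ℝ :=
  mvfderiv 𝓘(ℝ, Fin 3 → ℂ) hopf p u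

/-- The entrywise differential of a matrix-valued function on `ℂP³`. -/
def dMatrix (j : CP3 → Matrix (Fin 5) (Fin 5) ℝ) (p : CP3)
    (u : TangentSpace 𝓘(ℝ, Fin 3 → ℂ) p) : Matrix (Fin 5) (Fin 5) ℝ :=
  Matrix.of fun a b => mvfderiv 𝓘(ℝ, Fin 3 → ℂ) (fun q => j q a b) p u

/-- `p ↦ (hopf p, j p)` is the identification of `ℂP³` with the twistor space of `S⁴`: it is a
smooth bijection, and `j p` is the complex structure induced on `T_{hopf p} S⁴` by the
multiplication by `i` on `T_p ℂP³`. -/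
structure IsTwistorIdentification (j : CP3 → Matrix (Fin 5) (Fin 5) ℝ) : Prop where
  smooth_hopf : ContMDiff 𝓘(ℝ, Fin 3 → ℂ) 𝓘(ℝ, Fin 5 → ℝ) ∞ hopf
  smooth : ∀ a b, ContMDiff 𝓘(ℝ, Fin 3 → ℂ) 𝓘(ℝ, ℝ) ∞ (fun p => j p a b)
  bijOn : Set.BijOn (fun p => (hopf p, j p)) Set.univ twistorSpaceS4
  induced : ∀ (p : CP3) (u : TangentSpace 𝓘(ℝ, Fin 3 → ℂ) p),
    j p *ᵥ dHopf p u = dHopf p (CP3.mulI p u)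

/-- The vertical component of a tangent vector of `ℂP³ = {(hopf p, j p)}`. -/
def vert (j : CP3 → Matrix (Fin 5) (Fin 5) ℝ) (p : CP3)
    (u : TangentSpace 𝓘(ℝ, Fin 3 → ℂ) p) : Matrix (Fin 5) (Fin 5) ℝ :=
  verticalPart (hopf p) (dMatrix j p u)

/-- `g` is the twistor metric `g_t`: the sum of the pull-back of the round metric of `S⁴` and of
`t / 2` times the metric of the fibres, these being the unit 2-spheres of complex structures
(`|A|² = tr(Aᵀ A) / 4`), with the vertical and horizontal spaces orthogonal. In this normalization
`(g_2, J_+)` is Kähler. -/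
def IsTwistorMetric (j : CP3 → Matrix (Fin 5) (Fin 5) ℝ) (t : ℝ)
    (g : ContMDiffRiemannianMetric 𝓘(ℝ, Fin 3 → ℂ) ∞ (Fin 3 → ℂ)
      (fun p : CP3 => TangentSpace 𝓘(ℝ, Fin 3 → ℂ) p)) : Prop :=
  ∀ (p : CP3) (u v : TangentSpace 𝓘(ℝ, Fin 3 → ℂ) p),
    g.inner p u v = dHopf p u ⬝ᵥ dHopf p v +
      t / 2 * (((vert j p u)ᵀ * vert j p v).trace / 4)

/-- `J` is the non-integrable almost complex structure `J_-` of the twistor space: on the horizontal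
space at `p` it is the lift of the complex structure `j p` of `T S⁴`, and on the vertical space it is
the opposite `A ↦ -(j p) A` of the natural complex structure of the fibre. -/
def IsTwistorJMinus (j : CP3 → Matrix (Fin 5) (Fin 5) ℝ)
    (J : ∀ p : CP3, TangentSpace 𝓘(ℝ, Fin 3 → ℂ) p →L[ℝ] TangentSpace 𝓘(ℝ, Fin 3 → ℂ) p) :
    Prop :=
  ∀ (p : CP3) (u : TangentSpace 𝓘(ℝ, Fin 3 → ℂ) p),
    dHopf p (J p u) = j p *ᵥ dHopf p u ∧ vert j p (J p u) = -(j p * vert j p u)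

end

/-! Five hermitian Clifford matrices `gam k` on `ℂ⁴` give the Hopf map as `x_k = ⟨v, γ_k v⟩ / |v|²`
and the twistor structure (`twistorJ`) as `j_kl = -Im ⟨v, γ_k γ_l v⟩ / |v|²`. Conjugation by `Sp(2)`
rotates the real span of the `γ_k` (`exists_rotation`), so `x` and `j` are equivariant. As `Sp(2)`
is transitive on `ℂP³`, every invariant pointwise identity reduces to a computation at `[1:0:0:0]`
(`tangent_induction`).

Bijectivity onto `Z`: the matrices `1`, `γ_k`, `γ_k γ_l` span all matrices of size 4, so `(x, j)`
determines the projector `v v* / |v|²` and therefore the line. For surjectivity a rotation brings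
`x` to the base point; there the structures compatible with the orientation form a 2-sphere, which
is parametrized by stereographic projection.

The pair `(N, j)` with `N = x xᵀ` (`twistorN`) embeds `ℂP³` in `ℝ²⁵ × ℝ²⁵`. The isotropy
representation is `ℂ ⊕ ℂ²`, with circle weights 2 and 1. Hence an invariant metric has two
parameters and has the form `α/2 |dN|² + β |dj|²` (`twistorForm`), and an invariant almost complex
structure is, up to a sign `σ`, multiplication by `i` (`ε = 1`) or `J_-` (`ε = -1`).

For a metric induced by functions, the Levi-Civita connection is the projection of the flat
derivative (`isLeviCivita_inducedConnection`, `IsLeviCivita.inner_eq`). In the ambient space both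
almost complex structures are restrictions of linear operators which are polynomial in `j` and `N`
and skew for the trace form. Therefore the second derivatives of the embedding cancel in `D_u J`,
and only the derivatives of these coefficients remain (`inner_covDerivJ`, `nkTensor`).

At the base point this tensor is a combination of one trilinear form `⟪x₃, V₁ x₂⟫` with permuted
arguments, and `g((D_u J) u, w)` is a multiple of `α - 2 (2 - ε) β`. The nearly Kähler condition
thus reads `α = 2 (2 - ε) β`. For `ε = 1` it gives `α = 2 β` and `D J = 0`, the excluded Kähler
case. For `ε = -1` it gives `α = 6 β` with `D J ≠ 0`: the metric is `8 β` times `g₁`, which has `(α,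
β) = (3/4, 1/8)`. -/

noncomputable section

/-! ### Vector fields and Lie brackets in a chart -/

section Geometry

open VectorField

variable {E : Type*} [NormedAddCommGroup E] [NormedSpace ℝ E]
  {M : Type*} [TopologicalSpace M] [ChartedSpace E M] [IsManifold 𝓘(ℝ, E) ∞ M]

lemma one_add_one_le_infty : (1 + 1 : ℕ∞ω) ≤ ∞ := by
  exact WithTop.coe_le_coe.2 (le_top : (1 + 1 : ℕ∞) ≤ ⊤)

/-- The derivative `Y f` of the function `f` along the vector field `Y`. -/
def fieldDeriv (f : M → ℝ) (Y : ∀ x : M, TangentSpace 𝓘(ℝ, E) x) (x : M) : ℝ :=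
  mvfderiv 𝓘(ℝ, E) f x (Y x)

/-- The expression of a vector field in the preferred chart at `x`. -/
def chartField (x : M) (Y : ∀ x : M, TangentSpace 𝓘(ℝ, E) x) : E → E :=
  mpullbackWithin 𝓘(ℝ, E) 𝓘(ℝ, E) (extChartAt 𝓘(ℝ, E) x).symm Y (Set.range 𝓘(ℝ, E))

/-- The preferred chart at `x` identifies the tangent space at `x` with the model space by the
identity. -/
lemma chartField_self (x : M) (Y : ∀ x : M, TangentSpace 𝓘(ℝ, E) x) :
    chartField x Y (extChartAt 𝓘(ℝ, E) x x) = Y x := by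
  have h := mfderivWithin_range_extChartAt_symm (I := 𝓘(ℝ, E)) (x := x)
  have h2 := extChartAt_to_inv (I := 𝓘(ℝ, E)) x
  unfold chartField
  rw [mpullbackWithin_apply, h]
  have : ∀ y : M, y = x → (Y y : E) = Y x := by rintro y rfl; rfl
  have e : (ContinuousLinearMap.id ℝ E).inverse ((Y ((extChartAt 𝓘(ℝ, E) x).symm
      (extChartAt 𝓘(ℝ, E) x x)) : E)) = Y x := by
    rw [ContinuousLinearMap.inverse_id]
    exact this _ h2
  exact e

lemma differentiableAt_chartField [CompleteSpace E] {x : M}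
    {Y : ∀ x : M, TangentSpace 𝓘(ℝ, E) x} (hY : DiffFieldAt Y x) :
    DifferentiableAt ℝ (chartField x Y) (extChartAt 𝓘(ℝ, E) x x) := by
  have : IsManifold 𝓘(ℝ, E) 2 M := inferInstance
  have h := MDifferentiableWithinAt.differentiableWithinAt_mpullbackWithin_vectorField
    (I := 𝓘(ℝ, E)) (s := Set.univ) (V := Y) (x := x) (mdifferentiableWithinAt_univ.2 hY)
  have hs : (extChartAt 𝓘(ℝ, E) x).symm ⁻¹' Set.univ ∩ Set.range 𝓘(ℝ, E) = Set.univ := by simp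
  rw [hs] at h
  exact differentiableWithinAt_univ.1 h

/-- The expression of a function in the preferred chart at `x`. -/
def chartFun (x : M) (f : M → ℝ) : E → ℝ := f ∘ (extChartAt 𝓘(ℝ, E) x).symm

lemma contDiffAt_chartFun {f : M → ℝ} (hf : ContMDiff 𝓘(ℝ, E) 𝓘(ℝ, ℝ) ∞ f) (x : M) {z : E}
    (hz : z ∈ (extChartAt 𝓘(ℝ, E) x).target) : ContDiffAt ℝ ∞ (chartFun x f) z := by
  have h := (contMDiffOn_extChartAt_symm (I := 𝓘(ℝ, E)) (n := ∞) x).contMDiffAt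
    ((isOpen_extChartAt_target x).mem_nhds hz)
  exact ((hf _).comp z h).contDiffAt

lemma fieldDeriv_symm {f : M → ℝ} (hf : ContMDiff 𝓘(ℝ, E) 𝓘(ℝ, ℝ) ∞ f) (x : M)
    (Y : ∀ x : M, TangentSpace 𝓘(ℝ, E) x) {z : E} (hz : z ∈ (extChartAt 𝓘(ℝ, E) x).target) :
    fieldDeriv f Y ((extChartAt 𝓘(ℝ, E) x).symm z) =
      fderiv ℝ (chartFun x f) z (chartField x Y z) := by
  have : IsManifold 𝓘(ℝ, E) 1 M := inferInstance
  have h := (contMDiffOn_extChartAt_symm (I := 𝓘(ℝ, E)) (n := ∞) x).contMDiffAt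
    ((isOpen_extChartAt_target x).mem_nhds hz)
  have h1 := h.mdifferentiableAt (by simp)
  have hinv := isInvertible_mfderivWithin_extChartAt_symm (I := 𝓘(ℝ, E)) hz
  have hc := mvfderiv_comp z ((hf _).mdifferentiableAt (by simp)) h1
  have h3 : fderiv ℝ (chartFun x f) z = mvfderiv 𝓘(ℝ, E) (f ∘ (extChartAt 𝓘(ℝ, E) x).symm) z := by
    unfold mvfderiv
    rw [mfderiv_eq_fderiv]; rfl
  rw [h3]
  refine Eq.trans ?_ (DFunLike.congr_fun hc (chartField x Y z)).symm
  refine congrArg (mvfderiv 𝓘(ℝ, E) f ((extChartAt 𝓘(ℝ, E) x).symm z)) ?_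
  have h4 : mfderivWithin 𝓘(ℝ, E) 𝓘(ℝ, E) (extChartAt 𝓘(ℝ, E) x).symm (Set.range 𝓘(ℝ, E)) z
      = mfderiv 𝓘(ℝ, E) 𝓘(ℝ, E) (extChartAt 𝓘(ℝ, E) x).symm z := by
    rw [modelWithCornersSelf_coe, Set.range_id, mfderivWithin_univ]
  rw [← h4]
  exact (hinv.self_apply_inverse (Y _)).symm

lemma mvfderiv_eq_fderiv_chartFun {f : M → ℝ} (hf : ContMDiff 𝓘(ℝ, E) 𝓘(ℝ, ℝ) ∞ f) (x : M) :
    mvfderiv 𝓘(ℝ, E) f x = fderiv ℝ (chartFun x f) (extChartAt 𝓘(ℝ, E) x x) := by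
  rw [((hf x).mdifferentiableAt (by simp)).mvfderiv]
  rw [modelWithCornersSelf_coe, Set.range_id, fderivWithin_univ]
  rfl

lemma fieldDeriv_eventuallyEq {f : M → ℝ} (hf : ContMDiff 𝓘(ℝ, E) 𝓘(ℝ, ℝ) ∞ f) (x : M)
    (Y : ∀ x : M, TangentSpace 𝓘(ℝ, E) x) :
    fieldDeriv f Y =ᶠ[nhds x]
      (fun z => fderiv ℝ (chartFun x f) z (chartField x Y z)) ∘ extChartAt 𝓘(ℝ, E) x := by
  filter_upwards [extChartAt_source_mem_nhds (I := 𝓘(ℝ, E)) x] with y hy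
  have := fieldDeriv_symm hf x Y ((extChartAt 𝓘(ℝ, E) x).map_source hy)
  rw [(extChartAt 𝓘(ℝ, E) x).left_inv hy] at this
  exact this

lemma differentiableAt_chart_fieldDeriv [CompleteSpace E] {f : M → ℝ}
    (hf : ContMDiff 𝓘(ℝ, E) 𝓘(ℝ, ℝ) ∞ f) {x : M}
    {Y : ∀ x : M, TangentSpace 𝓘(ℝ, E) x} (hY : DiffFieldAt Y x) :
    DifferentiableAt ℝ (fun z => fderiv ℝ (chartFun x f) z (chartField x Y z))
      (extChartAt 𝓘(ℝ, E) x x) := by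
  have h := contDiffAt_chartFun hf x (mem_extChartAt_target (I := 𝓘(ℝ, E)) x)
  have h1 : DifferentiableAt ℝ (fderiv ℝ (chartFun x f)) (extChartAt 𝓘(ℝ, E) x x) :=
    (h.fderiv_right (m := 1) one_add_one_le_infty).differentiableAt (by simp)
  exact h1.clm_apply (differentiableAt_chartField hY)

lemma mdifferentiableAt_fieldDeriv [CompleteSpace E] {f : M → ℝ}
    (hf : ContMDiff 𝓘(ℝ, E) 𝓘(ℝ, ℝ) ∞ f) {x : M}
    {Y : ∀ x : M, TangentSpace 𝓘(ℝ, E) x} (hY : DiffFieldAt Y x) :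
    MDifferentiableAt 𝓘(ℝ, E) 𝓘(ℝ, ℝ) (fieldDeriv f Y) x := by
  refine MDifferentiableAt.congr_of_eventuallyEq ?_ (fieldDeriv_eventuallyEq hf x Y)
  have h := mdifferentiableAt_extChartAt (I := 𝓘(ℝ, E)) (mem_chart_source E x)
  exact (differentiableAt_chart_fieldDeriv hf hY).mdifferentiableAt.comp x h

/-- Second derivatives along fields become ordinary derivatives on the model space, where the
symmetry of second derivatives is at hand. -/
lemma mvfderiv_fieldDeriv [CompleteSpace E] {f : M → ℝ}
    (hf : ContMDiff 𝓘(ℝ, E) 𝓘(ℝ, ℝ) ∞ f) {x : M}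
    {Y : ∀ x : M, TangentSpace 𝓘(ℝ, E) x} (hY : DiffFieldAt Y x) (u : TangentSpace 𝓘(ℝ, E) x) :
    mvfderiv 𝓘(ℝ, E) (fieldDeriv f Y) x u =
      fderiv ℝ (fun z => fderiv ℝ (chartFun x f) z (chartField x Y z))
        (extChartAt 𝓘(ℝ, E) x x) u := by
  have : IsManifold 𝓘(ℝ, E) 1 M := inferInstance
  have h := mdifferentiableAt_extChartAt (I := 𝓘(ℝ, E)) (mem_chart_source E x)
  have hd := (differentiableAt_chart_fieldDeriv hf hY)
  have h1 : mvfderiv 𝓘(ℝ, E) (fieldDeriv f Y) x =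
      mvfderiv 𝓘(ℝ, E) ((fun z => fderiv ℝ (chartFun x f) z (chartField x Y z)) ∘
        extChartAt 𝓘(ℝ, E) x) x := by
    unfold mvfderiv
    rw [(fieldDeriv_eventuallyEq hf x Y).mfderiv_eq, (fieldDeriv_eventuallyEq hf x Y).self_of_nhds]
  rw [h1, mvfderiv_comp x hd.mdifferentiableAt h, ContinuousLinearMap.comp_apply,
    mfderiv_extChartAt_self]
  unfold mvfderiv
  rw [mfderiv_eq_fderiv]; rfl

/-- The derivation along the Lie bracket is the commutator of the derivations. -/
lemma mvfderiv_mlieBracket [CompleteSpace E] {f : M → ℝ}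
    (hf : ContMDiff 𝓘(ℝ, E) 𝓘(ℝ, ℝ) ∞ f) {x : M}
    {X Y : ∀ x : M, TangentSpace 𝓘(ℝ, E) x} (hX : DiffFieldAt X x) (hY : DiffFieldAt Y x) :
    mvfderiv 𝓘(ℝ, E) f x (mlieBracket 𝓘(ℝ, E) X Y x) =
      mvfderiv 𝓘(ℝ, E) (fieldDeriv f Y) x (X x) - mvfderiv 𝓘(ℝ, E) (fieldDeriv f X) x (Y x) := by
  have : IsManifold 𝓘(ℝ, E) 1 M := inferInstance
  -- In the chart the identity is the symmetry of the second derivative of `f`; everything else is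
  -- transport from the chart to the manifold.
  have key := fderiv_apply_lieBracket (𝕜 := ℝ) (n := ∞)
    (contDiffAt_chartFun hf x (mem_extChartAt_target (I := 𝓘(ℝ, E)) x))
    (by simpa [one_add_one_eq_two] using one_add_one_le_infty)
    (differentiableAt_chartField hY) (differentiableAt_chartField hX)
  rw [mvfderiv_fieldDeriv hf hY, mvfderiv_fieldDeriv hf hX]
  rw [chartField_self, chartField_self] at key
  rw [← key]
  have h1 : mlieBracket 𝓘(ℝ, E) X Y x =
      lieBracket ℝ (chartField x X) (chartField x Y) (extChartAt 𝓘(ℝ, E) x x) := by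
    rw [← mlieBracketWithin_univ, mlieBracketWithin_apply, mfderiv_extChartAt_self]
    have : (Set.univ : Set E) = (extChartAt 𝓘(ℝ, E) x).symm ⁻¹' Set.univ ∩ Set.range 𝓘(ℝ, E) := by
      simp
    rw [← this]
    have e : ∀ w : E, (ContinuousLinearMap.id ℝ E).inverse w = w := by
      intro w; rw [ContinuousLinearMap.inverse_id]; rfl
    exact (e _).trans (congrFun (lieBracketWithin_univ (V := chartField x X)
      (W := chartField x Y)) _)
  rw [h1]
  exact DFunLike.congr_fun (mvfderiv_eq_fderiv_chartFun hf x) _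

/-! ### The Levi-Civita connection of a metric induced by functions -/

section Induced

variable {ι : Type*} [Fintype ι] {c : ι → ℝ} {F : ι → M → ℝ}

/-- The metric `g` is `∑ cᵢ dFᵢ ⊗ dFᵢ`. -/
def IsInducedMetric (c : ι → ℝ) (F : ι → M → ℝ)
    (g : ContMDiffRiemannianMetric 𝓘(ℝ, E) ∞ E (fun x : M => TangentSpace 𝓘(ℝ, E) x)) : Prop :=
  ∀ (x : M) (u v : TangentSpace 𝓘(ℝ, E) x), g.inner x u v =
    ∑ i, c i * mvfderiv 𝓘(ℝ, E) (F i) x u * mvfderiv 𝓘(ℝ, E) (F i) x v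

/-- The second derivative `∑ cᵢ u(Y Fᵢ) dFᵢ(w)`. -/
def secondForm (c : ι → ℝ) (F : ι → M → ℝ) (Y : ∀ x : M, TangentSpace 𝓘(ℝ, E) x) (x : M)
    (u w : TangentSpace 𝓘(ℝ, E) x) : ℝ :=
  ∑ i, c i * mvfderiv 𝓘(ℝ, E) (fieldDeriv (F i) Y) x u * mvfderiv 𝓘(ℝ, E) (F i) x w

lemma mvfderiv_sum {κ : Type*} {x : M} (s : Finset κ) {f : κ → M → ℝ}
    (hf : ∀ i, MDifferentiableAt 𝓘(ℝ, E) 𝓘(ℝ, ℝ) (f i) x) (u : TangentSpace 𝓘(ℝ, E) x) :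
    mvfderiv 𝓘(ℝ, E) (fun y => ∑ i ∈ s, f i y) x u = ∑ i ∈ s, mvfderiv 𝓘(ℝ, E) (f i) x u := by
  classical
  have hd : ∀ t : Finset κ, MDifferentiableAt 𝓘(ℝ, E) 𝓘(ℝ, ℝ) (fun y => ∑ i ∈ t, f i y) x := by
    intro t
    induction t using Finset.induction_on with
    | empty => simpa using mdifferentiableAt_const
    | insert a t ha ih =>
      simp only [Finset.sum_insert ha]
      exact (hf a).add ih
  induction s using Finset.induction_on with
  | empty =>
    simp only [Finset.sum_empty]
    rw [mvfderiv_const]; rfl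
  | insert a s ha ih =>
    simp only [Finset.sum_insert ha]
    rw [mvfderiv_fun_add (hf a) (hd s), ← ih]
    rfl

lemma mvfderiv_fun_mul_apply {x : M} {f g : M → ℝ} (hf : MDifferentiableAt 𝓘(ℝ, E) 𝓘(ℝ, ℝ) f x)
    (hg : MDifferentiableAt 𝓘(ℝ, E) 𝓘(ℝ, ℝ) g x) (u : TangentSpace 𝓘(ℝ, E) x) :
    mvfderiv 𝓘(ℝ, E) (fun y => f y * g y) x u =
      f x * mvfderiv 𝓘(ℝ, E) g x u + g x * mvfderiv 𝓘(ℝ, E) f x u := by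
  rw [mvfderiv_fun_mul hf hg]
  rfl

lemma mvfderiv_const_mul_apply {x : M} {f : M → ℝ} (a : ℝ)
    (hf : MDifferentiableAt 𝓘(ℝ, E) 𝓘(ℝ, ℝ) f x) (u : TangentSpace 𝓘(ℝ, E) x) :
    mvfderiv 𝓘(ℝ, E) (fun y => a * f y) x u = a * mvfderiv 𝓘(ℝ, E) f x u := by
  have h := mvfderiv_fun_mul_apply (f := fun _ => a) mdifferentiableAt_const hf u
  rw [mvfderiv_const] at h
  simpa using h

/-- Since `g(Y, Z) = ∑ cᵢ (Y Fᵢ)(Z Fᵢ)`, this is the product rule; it becomes metric compatibility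
once the second form is projected. -/
lemma IsInducedMetric.mvfderiv_inner [CompleteSpace E] {g : ContMDiffRiemannianMetric 𝓘(ℝ, E) ∞ E
      (fun x : M => TangentSpace 𝓘(ℝ, E) x)}
    (hg : IsInducedMetric c F g) (hF : ∀ i, ContMDiff 𝓘(ℝ, E) 𝓘(ℝ, ℝ) ∞ (F i)) {x : M}
    {Y Z : ∀ x : M, TangentSpace 𝓘(ℝ, E) x} (hY : DiffFieldAt Y x) (hZ : DiffFieldAt Z x)
    (u : TangentSpace 𝓘(ℝ, E) x) :
    mvfderiv 𝓘(ℝ, E) (fun y => g.inner y (Y y) (Z y)) x u =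
      secondForm c F Y x u (Z x) + secondForm c F Z x u (Y x) := by
  have h : (fun y => g.inner y (Y y) (Z y)) =
      fun y => ∑ i, c i * (fieldDeriv (F i) Y y * fieldDeriv (F i) Z y) := by
    ext y; rw [hg]; simp only [fieldDeriv, mul_assoc]
  have hd := fun i => mdifferentiableAt_fieldDeriv (hF i) hY
  have hd' := fun i => mdifferentiableAt_fieldDeriv (hF i) hZ
  have hm := fun i => MDifferentiableAt.mul (hd i) (hd' i)
  have hm' : ∀ i, MDifferentiableAt 𝓘(ℝ, E) 𝓘(ℝ, ℝ)
      (fun y => c i * (fieldDeriv (F i) Y y * fieldDeriv (F i) Z y)) x :=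
    fun i => (mdifferentiableAt_const (c := c i)).mul (hm i)
  rw [h, mvfderiv_sum _ hm']
  unfold secondForm
  rw [← Finset.sum_add_distrib]
  refine Finset.sum_congr rfl fun i _ => ?_
  have e1 := mvfderiv_const_mul_apply (c i) (hm i) u
  have e2 := mvfderiv_fun_mul_apply (hd i) (hd' i) u
  refine e1.trans ((congrArg (c i * ·) e2).trans ?_)
  simp only [fieldDeriv]
  ring

/-- Positivity makes `B` injective, and `E` and its dual have the same dimension. -/
lemma isInvertible_of_pos {E : Type*} [NormedAddCommGroup E] [NormedSpace ℝ E]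
    [FiniteDimensional ℝ E] (B : E →L[ℝ] E →L[ℝ] ℝ) (hB : ∀ v, v ≠ 0 → 0 < B v v) :
    B.IsInvertible := by
  have hinj : Function.Injective B.toLinearMap := by
    rw [← LinearMap.ker_eq_bot, LinearMap.ker_eq_bot']
    intro v hv
    by_contra h
    have := hB v h
    have h2 : B v = 0 := hv
    rw [h2] at this
    simp at this
  have hf : Module.finrank ℝ E = Module.finrank ℝ (E →L[ℝ] ℝ) := by
    rw [← LinearEquiv.finrank_eq (LinearMap.toContinuousLinearMap (𝕜 := ℝ) (E := E) (F' := ℝ))]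
    exact (Subspace.dual_finrank_eq).symm
  refine ⟨(LinearMap.linearEquivOfInjective B.toLinearMap hinj hf).toContinuousLinearEquiv, ?_⟩
  ext v w
  rfl

lemma inner_isInvertible [FiniteDimensional ℝ E]
    (g : ContMDiffRiemannianMetric 𝓘(ℝ, E) ∞ E (fun x : M => TangentSpace 𝓘(ℝ, E) x)) (x : M) :
    (g.inner x).IsInvertible :=
  isInvertible_of_pos (E := E) (g.inner x) (g.pos x)

/-- The vector dual to a covector for the metric `g`. -/
def sharp (g : ContMDiffRiemannianMetric 𝓘(ℝ, E) ∞ E (fun x : M => TangentSpace 𝓘(ℝ, E) x))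
    (x : M) : (TangentSpace 𝓘(ℝ, E) x →L[ℝ] ℝ) →L[ℝ] TangentSpace 𝓘(ℝ, E) x :=
  (g.inner x).inverse

lemma inner_sharp [FiniteDimensional ℝ E]
    (g : ContMDiffRiemannianMetric 𝓘(ℝ, E) ∞ E (fun x : M => TangentSpace 𝓘(ℝ, E) x)) (x : M)
    (φ : TangentSpace 𝓘(ℝ, E) x →L[ℝ] ℝ) (w : TangentSpace 𝓘(ℝ, E) x) :
    g.inner x (sharp g x φ) w = φ w :=
  DFunLike.congr_fun ((inner_isInvertible g x).self_apply_inverse φ) w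

lemma metric_add_left
    (g : ContMDiffRiemannianMetric 𝓘(ℝ, E) ∞ E (fun x : M => TangentSpace 𝓘(ℝ, E) x)) {x : M}
    (u v w : TangentSpace 𝓘(ℝ, E) x) :
    g.inner x (u + v) w = g.inner x u w + g.inner x v w := by
  rw [map_add]; rfl

lemma metric_smul_left
    (g : ContMDiffRiemannianMetric 𝓘(ℝ, E) ∞ E (fun x : M => TangentSpace 𝓘(ℝ, E) x)) {x : M}
    (a : ℝ) (u w : TangentSpace 𝓘(ℝ, E) x) :
    g.inner x (a • u) w = a * g.inner x u w := by
  rw [map_smul]; rfl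

lemma metric_sub_left
    (g : ContMDiffRiemannianMetric 𝓘(ℝ, E) ∞ E (fun x : M => TangentSpace 𝓘(ℝ, E) x)) {x : M}
    (u v w : TangentSpace 𝓘(ℝ, E) x) :
    g.inner x (u - v) w = g.inner x u w - g.inner x v w := by
  rw [map_sub]; rfl

lemma ext_inner
    (g : ContMDiffRiemannianMetric 𝓘(ℝ, E) ∞ E (fun x : M => TangentSpace 𝓘(ℝ, E) x)) {x : M}
    {u v : TangentSpace 𝓘(ℝ, E) x} (h : ∀ w, g.inner x u w = g.inner x v w) : u = v := by
  by_contra hne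
  have h1 := g.pos x (u - v) (sub_ne_zero.2 hne)
  have h2 : g.inner x (u - v) (u - v) = 0 := by
    rw [metric_sub_left, h, sub_self]
  exact h1.ne' h2

/-- The projection to the manifold of the flat derivative of a vector field. -/
def flatDerivative
    (g : ContMDiffRiemannianMetric 𝓘(ℝ, E) ∞ E (fun x : M => TangentSpace 𝓘(ℝ, E) x))
    (c : ι → ℝ) (F : ι → M → ℝ) (Y : ∀ x : M, TangentSpace 𝓘(ℝ, E) x) (x : M) :
    TangentSpace 𝓘(ℝ, E) x →L[ℝ] TangentSpace 𝓘(ℝ, E) x :=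
  (sharp g x).comp
    (∑ i, c i • (mvfderiv 𝓘(ℝ, E) (fieldDeriv (F i) Y) x).smulRight (mvfderiv 𝓘(ℝ, E) (F i) x))

lemma inner_flatDerivative [FiniteDimensional ℝ E]
    (g : ContMDiffRiemannianMetric 𝓘(ℝ, E) ∞ E (fun x : M => TangentSpace 𝓘(ℝ, E) x))
    (Y : ∀ x : M, TangentSpace 𝓘(ℝ, E) x) (x : M) (u w : TangentSpace 𝓘(ℝ, E) x) :
    g.inner x (flatDerivative g c F Y x u) w = secondForm c F Y x u w := by
  refine (inner_sharp g x _ w).trans ?_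
  simp [secondForm, mul_assoc]

/-- The Levi-Civita connection of an induced metric. -/
def inducedConnection [FiniteDimensional ℝ E] [CompleteSpace E]
    (g : ContMDiffRiemannianMetric 𝓘(ℝ, E) ∞ E (fun x : M => TangentSpace 𝓘(ℝ, E) x))
    (hg : IsInducedMetric c F g) (hF : ∀ i, ContMDiff 𝓘(ℝ, E) 𝓘(ℝ, ℝ) ∞ (F i)) :
    CovariantDerivative 𝓘(ℝ, E) E (fun x : M => TangentSpace 𝓘(ℝ, E) x) where
  toFun := flatDerivative g c F
  isCovariantDerivativeOnUniv := by
    constructor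
    · intro Y Z x hY hZ _
      ext1 u
      refine ext_inner g fun w => Eq.trans ?_ (metric_add_left g (flatDerivative g c F Y x u)
        (flatDerivative g c F Z x u) w).symm
      rw [inner_flatDerivative, inner_flatDerivative, inner_flatDerivative]
      unfold secondForm
      rw [← Finset.sum_add_distrib]
      refine Finset.sum_congr rfl fun i _ => ?_
      have h1 : fieldDeriv (F i) (Y + Z) = fieldDeriv (F i) Y + fieldDeriv (F i) Z := by
        ext y; simp [fieldDeriv]
      rw [h1, mvfderiv_add (mdifferentiableAt_fieldDeriv (hF i) hY)
          (mdifferentiableAt_fieldDeriv (hF i) hZ), add_apply]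
      ring
    · intro Y f x hY hf _
      ext1 u
      refine ext_inner g fun w => Eq.trans ?_ (metric_add_left g (f x • flatDerivative g c F Y x u)
        (mvfderiv 𝓘(ℝ, E) f x u • Y x) w).symm
      rw [metric_smul_left, metric_smul_left, inner_flatDerivative, inner_flatDerivative, hg]
      unfold secondForm
      rw [Finset.mul_sum, Finset.mul_sum, ← Finset.sum_add_distrib]
      refine Finset.sum_congr rfl fun i _ => ?_
      have h1 : fieldDeriv (F i) (f • Y) = fun y => f y * fieldDeriv (F i) Y y := by
        ext y; simp [fieldDeriv]
      rw [h1, mvfderiv_fun_mul_apply hf (mdifferentiableAt_fieldDeriv (hF i) hY)]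
      simp only [fieldDeriv]
      ring

lemma inner_inducedConnection [FiniteDimensional ℝ E] [CompleteSpace E]
    (g : ContMDiffRiemannianMetric 𝓘(ℝ, E) ∞ E (fun x : M => TangentSpace 𝓘(ℝ, E) x))
    (hg : IsInducedMetric c F g) (hF : ∀ i, ContMDiff 𝓘(ℝ, E) 𝓘(ℝ, ℝ) ∞ (F i))
    (Y : ∀ x : M, TangentSpace 𝓘(ℝ, E) x) (x : M) (u w : TangentSpace 𝓘(ℝ, E) x) :
    g.inner x (inducedConnection g hg hF Y x u) w = secondForm c F Y x u w :=
  inner_flatDerivative g Y x u w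

/-- This is the vanishing of the torsion: `[X, Y] Fᵢ = X (Y Fᵢ) - Y (X Fᵢ)` for each coordinate
`Fᵢ`. -/
lemma secondForm_mlieBracket [CompleteSpace E]
    {g : ContMDiffRiemannianMetric 𝓘(ℝ, E) ∞ E (fun x : M => TangentSpace 𝓘(ℝ, E) x)}
    (hg : IsInducedMetric c F g) (hF : ∀ i, ContMDiff 𝓘(ℝ, E) 𝓘(ℝ, ℝ) ∞ (F i)) {x : M}
    {X Y : ∀ x : M, TangentSpace 𝓘(ℝ, E) x} (hX : DiffFieldAt X x) (hY : DiffFieldAt Y x)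
    (w : TangentSpace 𝓘(ℝ, E) x) :
    g.inner x (mlieBracket 𝓘(ℝ, E) X Y x) w =
      secondForm c F Y x (X x) w - secondForm c F X x (Y x) w := by
  rw [hg]
  unfold secondForm
  rw [← Finset.sum_sub_distrib]
  refine Finset.sum_congr rfl fun i _ => ?_
  rw [mvfderiv_mlieBracket (hF i) hX hY]
  ring

/-- Only the positivity of `g` enters, never that of the weights `c`; this allows a negative
coefficient in the invariant metrics considered below. -/
theorem isLeviCivita_inducedConnection [FiniteDimensional ℝ E] [CompleteSpace E]
    (g : ContMDiffRiemannianMetric 𝓘(ℝ, E) ∞ E (fun x : M => TangentSpace 𝓘(ℝ, E) x))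
    (hg : IsInducedMetric c F g) (hF : ∀ i, ContMDiff 𝓘(ℝ, E) 𝓘(ℝ, ℝ) ∞ (F i)) :
    IsLeviCivita g (inducedConnection g hg hF) where
  torsion_free := by
    rw [CovariantDerivative.torsion_eq_zero_iff]
    intro X Y x hX hY
    refine ext_inner g fun w => ?_
    rw [metric_sub_left, inner_inducedConnection, inner_inducedConnection,
      secondForm_mlieBracket hg hF hX hY]
  metric Y Z x u hY hZ := by
    rw [hg.mvfderiv_inner hF hY hZ, inner_inducedConnection, g.symm x (Y x),
      inner_inducedConnection]

/-- Koszul's formula for an induced metric. -/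
theorem IsLeviCivita.inner_eq [FiniteDimensional ℝ E] [CompleteSpace E]
    {g : ContMDiffRiemannianMetric 𝓘(ℝ, E) ∞ E (fun x : M => TangentSpace 𝓘(ℝ, E) x)}
    (hg : IsInducedMetric c F g) (hF : ∀ i, ContMDiff 𝓘(ℝ, E) 𝓘(ℝ, ℝ) ∞ (F i))
    {D : CovariantDerivative 𝓘(ℝ, E) E (fun x : M => TangentSpace 𝓘(ℝ, E) x)}
    (hD : IsLeviCivita g D) {Y : ∀ x : M, TangentSpace 𝓘(ℝ, E) x} {x : M} (hY : DiffFieldAt Y x)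
    (u w : TangentSpace 𝓘(ℝ, E) x) :
    g.inner x (D Y x u) w = secondForm c F Y x u w := by
  have hext : ∀ v : TangentSpace 𝓘(ℝ, E) x, DiffFieldAt (FiberBundle.extend E v) x := fun v =>
    FiberBundle.mdifferentiableAt_extend ..
  have hself : ∀ v : TangentSpace 𝓘(ℝ, E) x, FiberBundle.extend E v x = v := fun v =>
    FiberBundle.extend_apply_self E v
  have sym : ∀ {X Y : ∀ x : M, TangentSpace 𝓘(ℝ, E) x}, DiffFieldAt X x → DiffFieldAt Y x → ∀ w,
      g.inner x (D Y x (X x)) w - secondForm c F Y x (X x) w =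
      g.inner x (D X x (Y x)) w - secondForm c F X x (Y x) w := by
    intro X Y hX hY w
    have h1 := (CovariantDerivative.torsion_eq_zero_iff D).1 hD.torsion_free hX hY
    have h2 := secondForm_mlieBracket hg hF hX hY w
    rw [← h1, metric_sub_left] at h2
    linarith
  have skew : ∀ {Y Z : ∀ x : M, TangentSpace 𝓘(ℝ, E) x}, DiffFieldAt Y x → DiffFieldAt Z x → ∀ u,
      g.inner x (D Y x u) (Z x) - secondForm c F Y x u (Z x) =
      -(g.inner x (D Z x u) (Y x) - secondForm c F Z x u (Y x)) := by
    intro Y Z hY hZ u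
    have h1 := hD.metric Y Z x u hY hZ
    rw [hg.mvfderiv_inner hF hY hZ, g.symm x (Y x)] at h1
    linarith
  -- The difference `T(u, Y, w)` of the two sides is symmetric in its first two arguments and skew
  -- in the last two. Alternating the two exchanges six times returns to `T(u, Y, w)` with the
  -- opposite sign.
  have a1 := skew hY (hext w) u
  have a2 := sym (hext u) (hext w) (Y x)
  have a3 := skew (hext u) hY w
  have a4 := sym (hext w) hY u
  have a5 := skew (hext w) (hext u) (Y x)
  have a6 := sym hY (hext u) w
  simp only [hself] at a1 a2 a3 a4 a5 a6
  linarith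

end Induced

end Geometry

/-! ### Smoothness of tensors built from differentials of functions -/

section SmoothSections

variable {E : Type*} [NormedAddCommGroup E] [NormedSpace ℝ E]
  {M : Type*} [TopologicalSpace M] [ChartedSpace E M] [IsManifold 𝓘(ℝ, E) ∞ M]

/-- The coordinate vector fields of the preferred chart at `x₀`. -/
def chartFrame (x₀ x : M) (v : E) : TangentSpace 𝓘(ℝ, E) x :=
  (trivializationAt E (fun x : M => TangentSpace 𝓘(ℝ, E) x) x₀).symm x v

lemma mvfderiv_chartFrame {f : M → ℝ} (hf : ContMDiff 𝓘(ℝ, E) 𝓘(ℝ, ℝ) ∞ f) {x₀ x : M}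
    (hx : x ∈ (chartAt E x₀).source) (v : E) :
    mvfderiv 𝓘(ℝ, E) f x (chartFrame x₀ x v) =
      fderiv ℝ (chartFun x₀ f) (extChartAt 𝓘(ℝ, E) x₀ x) v := by
  have hx' : x ∈ (extChartAt 𝓘(ℝ, E) x₀).source := by rwa [extChartAt_source]
  have h1 := fieldDeriv_symm hf x₀ (fun y => chartFrame x₀ y v)
    ((extChartAt 𝓘(ℝ, E) x₀).map_source hx')
  rw [(extChartAt 𝓘(ℝ, E) x₀).left_inv hx'] at h1
  refine h1.trans ?_
  congr 1
  have hz := (extChartAt 𝓘(ℝ, E) x₀).map_source hx'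
  have h2 := TangentBundle.symmL_trivializationAt (I := 𝓘(ℝ, E)) (x₀ := x₀) (x := x) hx
  have hinv := isInvertible_mfderivWithin_extChartAt_symm (I := 𝓘(ℝ, E)) hz
  -- The point obtained by going to the chart and back equals `x` only propositionally, and the type
  -- of the frame depends on it; hence the auxiliary variable `y`.
  have key : ∀ y : M, y = x → (mfderivWithin 𝓘(ℝ, E) 𝓘(ℝ, E) (extChartAt 𝓘(ℝ, E) x₀).symm
      (Set.range 𝓘(ℝ, E)) (extChartAt 𝓘(ℝ, E) x₀ x)).inverse (chartFrame x₀ y v) = v := by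
    rintro y rfl
    have h3 : chartFrame x₀ y v = mfderivWithin 𝓘(ℝ, E) 𝓘(ℝ, E) (extChartAt 𝓘(ℝ, E) x₀).symm
      (Set.range 𝓘(ℝ, E)) (extChartAt 𝓘(ℝ, E) x₀ y) v := by
      refine Eq.trans ?_ (DFunLike.congr_fun h2 v)
      exact (Trivialization.symmL_apply _ (by simpa using hx) v).symm
    refine (congrArg _ h3).trans ?_
    exact hinv.inverse_apply_self v
  exact key _ ((extChartAt 𝓘(ℝ, E) x₀).left_inv hx')

lemma chartFrame_eq_symmL {x₀ x : M} (hx : x ∈ (chartAt E x₀).source) (v : E) :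
    chartFrame x₀ x v =
      (trivializationAt E (fun x : M => TangentSpace 𝓘(ℝ, E) x) x₀).symmL ℝ x v :=
  (Trivialization.symmL_apply _ (by simpa using hx) v).symm

lemma inCoordinates_bilinear (x₀ : M) {x : M} (hx : x ∈ (chartAt E x₀).source)
    (B : TangentSpace 𝓘(ℝ, E) x →L[ℝ] TangentSpace 𝓘(ℝ, E) x →L[ℝ] ℝ) (v w : E) :
    ContinuousLinearMap.inCoordinates E (fun x : M => TangentSpace 𝓘(ℝ, E) x) (E →L[ℝ] ℝ)
      (fun x : M => TangentSpace 𝓘(ℝ, E) x →L[ℝ] ℝ) x₀ x x₀ x B v w =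
      B (chartFrame x₀ x v) (chartFrame x₀ x w) := by
  have h := inCoordinates_apply_eq₂ (𝕜 := ℝ) (F₁ := E) (F₂ := E) (F₃ := ℝ)
    (E₁ := fun x : M => TangentSpace 𝓘(ℝ, E) x) (E₂ := fun x : M => TangentSpace 𝓘(ℝ, E) x)
    (E₃ := fun _ : M => ℝ) (x₀ := x₀) (x := x) (ϕ := B) (v := v) (w := w)
    (by simpa using hx) (by simpa using hx) (by simp)
  refine h.trans ?_
  simp [chartFrame]

/-- In finite dimension an operator is a fixed linear function of its values on a basis. -/
lemma contMDiffAt_clm_of_apply [FiniteDimensional ℝ E] {F : Type*} [NormedAddCommGroup F]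
    [NormedSpace ℝ F] {φ : M → E →L[ℝ] F} {x₀ : M}
    (h : ∀ v, ContMDiffAt 𝓘(ℝ, E) 𝓘(ℝ, F) ∞ (fun x => φ x v) x₀) :
    ContMDiffAt 𝓘(ℝ, E) 𝓘(ℝ, E →L[ℝ] F) ∞ φ x₀ := by
  let b := Module.finBasis ℝ E
  let Φ : (Fin (Module.finrank ℝ E) → F) →L[ℝ] (E →L[ℝ] F) :=
    ∑ i, ((ContinuousLinearMap.smulRightL ℝ E F (LinearMap.toContinuousLinearMap (b.coord i))).comp
      (ContinuousLinearMap.proj i))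
  have hΦ : φ = fun x => Φ (fun i => φ x (b i)) := by
    ext x v
    have h1 := congrArg (φ x) (b.sum_repr v)
    rw [map_sum] at h1
    rw [← h1]
    simp [Φ]
  rw [hΦ]
  exact Φ.contDiff.contMDiff.contMDiffAt.comp x₀ (contMDiffAt_pi_space.2 fun i => h (b i))

variable {ι κ : Type*} [Fintype ι] [Fintype κ]

/-- A bilinear form which is a combination of products of differentials is smooth. -/
theorem contMDiff_bilinear [FiniteDimensional ℝ E] {a : ι → κ → M → ℝ} {F : ι → M → ℝ}
    {G : κ → M → ℝ}
    (ha : ∀ i k, ContMDiff 𝓘(ℝ, E) 𝓘(ℝ, ℝ) ∞ (a i k))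
    (hF : ∀ i, ContMDiff 𝓘(ℝ, E) 𝓘(ℝ, ℝ) ∞ (F i)) (hG : ∀ k, ContMDiff 𝓘(ℝ, E) 𝓘(ℝ, ℝ) ∞ (G k))
    (B : ∀ x : M, TangentSpace 𝓘(ℝ, E) x →L[ℝ] TangentSpace 𝓘(ℝ, E) x →L[ℝ] ℝ)
    (hB : ∀ (x : M) (u v : TangentSpace 𝓘(ℝ, E) x), B x u v =
      ∑ i, ∑ k, a i k x * mvfderiv 𝓘(ℝ, E) (F i) x u * mvfderiv 𝓘(ℝ, E) (G k) x v) :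
    ContMDiff 𝓘(ℝ, E) (𝓘(ℝ, E).prod 𝓘(ℝ, E →L[ℝ] E →L[ℝ] ℝ)) ∞
      (fun x => TotalSpace.mk' (E →L[ℝ] E →L[ℝ] ℝ)
        (E := fun x : M => TangentSpace 𝓘(ℝ, E) x →L[ℝ] TangentSpace 𝓘(ℝ, E) x →L[ℝ] ℝ)
        x (B x)) := by
  intro x₀
  rw [contMDiffAt_hom_bundle]
  refine ⟨contMDiffAt_id, ?_⟩
  -- In the chart frame the form becomes, for fixed `v` and `w`, a scalar sum of products of smooth
  -- functions and partial derivatives.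
  refine contMDiffAt_clm_of_apply fun v => contMDiffAt_clm_of_apply fun w => ?_
  have hφ : ContMDiffAt 𝓘(ℝ, E) 𝓘(ℝ, E) ∞ (extChartAt 𝓘(ℝ, E) x₀) x₀ := contMDiffAt_extChartAt
  have hd : ∀ {f : M → ℝ}, ContMDiff 𝓘(ℝ, E) 𝓘(ℝ, ℝ) ∞ f → ∀ v : E,
      ContMDiffAt 𝓘(ℝ, E) 𝓘(ℝ, ℝ) ∞
        (fun x => fderiv ℝ (chartFun x₀ f) (extChartAt 𝓘(ℝ, E) x₀ x) v) x₀ := by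
    intro f hf v
    have h1 := (contDiffAt_chartFun hf x₀ (mem_extChartAt_target (I := 𝓘(ℝ, E)) x₀)).fderiv_right
      (m := ∞) (by simp)
    exact ((h1.clm_apply (contDiffAt_const (c := v))).contMDiffAt).comp x₀ hφ
  have hs : ContMDiffAt 𝓘(ℝ, E) 𝓘(ℝ, ℝ) ∞ (fun x => ∑ i, ∑ k, a i k x *
      fderiv ℝ (chartFun x₀ (F i)) (extChartAt 𝓘(ℝ, E) x₀ x) v *
      fderiv ℝ (chartFun x₀ (G k)) (extChartAt 𝓘(ℝ, E) x₀ x) w) x₀ :=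
    contMDiffAt_finsetSum fun i _ => contMDiffAt_finsetSum fun k _ =>
      (((ha i k) x₀).mul (hd (hF i) v)).mul (hd (hG k) w)
  refine hs.congr_of_eventuallyEq ?_
  filter_upwards [(chartAt E x₀).open_source.mem_nhds (mem_chart_source E x₀)] with x hx
  refine (inCoordinates_bilinear x₀ hx (B x) v w).trans ?_
  rw [hB]
  refine Finset.sum_congr rfl fun i _ => Finset.sum_congr rfl fun k _ => ?_
  rw [mvfderiv_chartFrame (hF i) hx, mvfderiv_chartFrame (hG k) hx]

/-- The endomorphism which represents a smooth bilinear form with respect to a smooth metric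
is smooth. -/
theorem contMDiff_sharp_comp [FiniteDimensional ℝ E] [CompleteSpace E]
    (g : ContMDiffRiemannianMetric 𝓘(ℝ, E) ∞ E (fun x : M => TangentSpace 𝓘(ℝ, E) x))
    (B : ∀ x : M, TangentSpace 𝓘(ℝ, E) x →L[ℝ] TangentSpace 𝓘(ℝ, E) x →L[ℝ] ℝ)
    (hB : ContMDiff 𝓘(ℝ, E) (𝓘(ℝ, E).prod 𝓘(ℝ, E →L[ℝ] E →L[ℝ] ℝ)) ∞
      (fun x => TotalSpace.mk' (E →L[ℝ] E →L[ℝ] ℝ)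
        (E := fun x : M => TangentSpace 𝓘(ℝ, E) x →L[ℝ] TangentSpace 𝓘(ℝ, E) x →L[ℝ] ℝ)
        x (B x))) :
    ContMDiff 𝓘(ℝ, E) (𝓘(ℝ, E).prod 𝓘(ℝ, E →L[ℝ] E)) ∞
      (fun x => TotalSpace.mk' (E →L[ℝ] E)
        (E := fun x : M => TangentSpace 𝓘(ℝ, E) x →L[ℝ] TangentSpace 𝓘(ℝ, E) x)
        x ((sharp g x).comp (B x))) := by
  intro x₀
  have h1 := (contMDiffAt_hom_bundle _).1 (g.contMDiff x₀)
  have h2 := (contMDiffAt_hom_bundle _).1 (hB x₀)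
  rw [contMDiffAt_hom_bundle]
  refine ⟨contMDiffAt_id, ?_⟩
  set G : M → E →L[ℝ] E →L[ℝ] ℝ := fun x => ContinuousLinearMap.inCoordinates E
    (fun x : M => TangentSpace 𝓘(ℝ, E) x) (E →L[ℝ] ℝ)
    (fun x : M => TangentSpace 𝓘(ℝ, E) x →L[ℝ] ℝ) x₀ x x₀ x (g.inner x) with hG
  set K : M → E →L[ℝ] E →L[ℝ] ℝ := fun x => ContinuousLinearMap.inCoordinates E
    (fun x : M => TangentSpace 𝓘(ℝ, E) x) (E →L[ℝ] ℝ)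
    (fun x : M => TangentSpace 𝓘(ℝ, E) x →L[ℝ] ℝ) x₀ x x₀ x (B x) with hK
  have hGs : ContMDiffAt 𝓘(ℝ, E) 𝓘(ℝ, E →L[ℝ] E →L[ℝ] ℝ) ∞ G x₀ := h1.2
  have hKs : ContMDiffAt 𝓘(ℝ, E) 𝓘(ℝ, E →L[ℝ] E →L[ℝ] ℝ) ∞ K x₀ := h2.2
  have hGi : ∀ x ∈ (chartAt E x₀).source, (G x).IsInvertible := by
    intro x hx
    refine isInvertible_of_pos _ fun v hv => ?_
    rw [hG, inCoordinates_bilinear x₀ hx]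
    refine g.pos x _ fun h => hv ?_
    have h3 := Trivialization.continuousLinearMapAt_symmL (R := ℝ)
      (trivializationAt E (fun x : M => TangentSpace 𝓘(ℝ, E) x) x₀) (b := x) (by simpa using hx) v
    rw [← h3, ← chartFrame_eq_symmL hx, h, map_zero]
  have hinv : ContMDiffAt 𝓘(ℝ, E) 𝓘(ℝ, (E →L[ℝ] ℝ) →L[ℝ] E) ∞ (fun x => (G x).inverse) x₀ :=
    ((hGi x₀ (mem_chart_source E x₀)).contDiffAt_map_inverse.contMDiffAt).comp x₀ hGs
  refine (hinv.clm_comp hKs).congr_of_eventuallyEq ?_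
  filter_upwards [(chartAt E x₀).open_source.mem_nhds (mem_chart_source E x₀)] with x hx
  have hS := Trivialization.symmL_continuousLinearMapAt (R := ℝ)
      (trivializationAt E (fun x : M => TangentSpace 𝓘(ℝ, E) x) x₀) (b := x) (by simpa using hx)
  ext1 v
  -- In the trivialization the endomorphism is `G⁻¹ K`. After multiplication by `G`, the claim is
  -- the defining property of `sharp`.
  refine ((hGi x hx).inverse_apply_eq.2 ?_).symm
  ext w
  refine (inCoordinates_bilinear x₀ hx (B x) v w).trans
    (Eq.trans ?_ (inCoordinates_bilinear x₀ hx (g.inner x) _ w).symm)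
  rw [chartFrame_eq_symmL hx (ContinuousLinearMap.inCoordinates E
    (fun x : M => TangentSpace 𝓘(ℝ, E) x) E (fun x : M => TangentSpace 𝓘(ℝ, E) x) x₀ x x₀ x
    ((sharp g x).comp (B x)) v)]
  refine Eq.trans ?_ (congrArg (fun z => g.inner x z (chartFrame x₀ x w)) (hS _)).symm
  rw [chartFrame_eq_symmL hx v]
  exact (inner_sharp g x _ _).symm

end SmoothSections

/-! ### Calculus on `ℂP³` in homogeneous coordinates -/

namespace CP3

/-- The projection of `ℂ⁴ ∖ 0` onto the projective space, extended by the base point at `0`. -/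
def proj (v : Fin 4 → ℂ) : CP3 := if h : v ≠ 0 then mk v h else basePoint

lemma proj_of_ne {v : Fin 4 → ℂ} (hv : v ≠ 0) : proj v = mk v hv := dif_pos hv

lemma proj_rep (p : CP3) : proj p.rep = p := (proj_of_ne p.rep_nonzero).trans p.mk_rep

lemma exists_proj (p : CP3) : ∃ v, v ≠ 0 ∧ proj v = p := ⟨p.rep, p.rep_nonzero, p.proj_rep⟩

lemma proj_smul {c : ℂ} (hc : c ≠ 0) (v : Fin 4 → ℂ) : proj (c • v) = proj v := by
  by_cases hv : v = 0
  · simp [hv]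
  · rw [proj_of_ne hv, proj_of_ne (smul_ne_zero hc hv)]
    exact mk_eq_mk _ _ rfl

lemma basePoint_eq : basePoint = proj (Pi.single 0 1) := (proj_of_ne (by simp)).symm

lemma smul_proj (a : Sp2) {v : Fin 4 → ℂ} (hv : v ≠ 0) : a • proj v = proj (sp2Matrix a *ᵥ v) := by
  have hw : sp2Matrix a *ᵥ v ≠ 0 := fun h =>
    hv (sp2_mulVec_injective a (by simpa using h))
  rw [proj_of_ne hv, proj_of_ne hw, sp2_smul_mk]

lemma mulVec_ne_zero (a : Sp2) {v : Fin 4 → ℂ} (hv : v ≠ 0) : sp2Matrix a *ᵥ v ≠ 0 := fun h =>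
  hv (sp2_mulVec_injective a (by simpa using h))

/-- The index of the preferred affine chart at a point. -/
def chartIdx (p : CP3) : Fin 4 := Classical.choose p.exists_rep_ne

lemma rep_chartIdx (p : CP3) : p.rep (chartIdx p) ≠ 0 := Classical.choose_spec p.exists_rep_ne

lemma proj_chartIdx {v : Fin 4 → ℂ} (hv : v ≠ 0) : v (chartIdx (proj v)) ≠ 0 := by
  have h := rep_chartIdx (proj v)
  obtain ⟨c, hc, h2⟩ := exists_rep_mk v hv
  rw [← proj_of_ne hv] at h2
  rw [h2] at h
  simpa [hc] using h

lemma chartAt_symm_apply (p : CP3) (z : Fin 3 → ℂ) :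
    (chartAt (Fin 3 → ℂ) p).symm z = proj ((chartIdx p).insertNth 1 z) :=
  (proj_of_ne (insertNth_ne_zero (chartIdx p) z)).symm

/-- Affine coordinates of `[v]`. -/
def affineCoord (i : Fin 4) (v : Fin 4 → ℂ) (k : Fin 3) : ℂ := v (i.succAbove k) / v i

lemma affineChart_proj (i : Fin 4) {v : Fin 4 → ℂ} (hv : v ≠ 0) :
    affineChart i (proj v) = affineCoord i v := by
  ext k; rw [proj_of_ne hv, affineChart_mk_apply]; rfl

lemma proj_insertNth_affineCoord {i : Fin 4} {v : Fin 4 → ℂ} (hv : v i ≠ 0) :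
    proj (i.insertNth 1 (affineCoord i v)) = proj v := by
  have : v = v i • (i.insertNth 1 (affineCoord i v) : Fin 4 → ℂ) := by
    funext k
    refine Fin.succAboveCases i ?_ (fun k => ?_) k
    · simp
    · simp [affineCoord, mul_div_cancel₀ _ hv]
  conv_rhs => rw [this, proj_smul hv]

/-- The differential of the affine coordinates. -/
def affineDeriv (i : Fin 4) (v : Fin 4 → ℂ) : (Fin 4 → ℂ) →L[ℝ] (Fin 3 → ℂ) :=
  ContinuousLinearMap.pi fun k =>
    v (i.succAbove k) • -((v i ^ 2)⁻¹ •
        ContinuousLinearMap.proj (R := ℝ) (φ := fun _ : Fin 4 => ℂ) i) +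
      (v i)⁻¹ • ContinuousLinearMap.proj (R := ℝ) (φ := fun _ : Fin 4 => ℂ) (i.succAbove k)

lemma affineDeriv_apply {i : Fin 4} {v : Fin 4 → ℂ} (hv : v i ≠ 0) (w : Fin 4 → ℂ) (k : Fin 3) :
    affineDeriv i v w k =
      (w (i.succAbove k) * v i - v (i.succAbove k) * w i) / v i ^ 2 := by
  simp [affineDeriv]
  field_simp
  ring

lemma contDiffAt_affineCoord {i : Fin 4} {v : Fin 4 → ℂ} (hv : v i ≠ 0) :
    ContDiffAt ℝ ∞ (affineCoord i) v := by
  rw [contDiffAt_pi]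
  intro k
  exact (contDiff_apply ℝ ℂ (i.succAbove k)).contDiffAt.mul
    ((contDiff_apply ℝ ℂ i).contDiffAt.inv hv)

lemma hasFDerivAt_affineCoord {i : Fin 4} {v : Fin 4 → ℂ} (hv : v i ≠ 0) :
    HasFDerivAt (affineCoord i) (affineDeriv i v) v := by
  rw [hasFDerivAt_pi']
  intro k
  have h1 := (ContinuousLinearMap.proj (R := ℝ) (φ := fun _ : Fin 4 => ℂ)
      (i.succAbove k)).hasFDerivAt (x := v)
  have h2 := (ContinuousLinearMap.proj (R := ℝ) (φ := fun _ : Fin 4 => ℂ) i).hasFDerivAt (x := v)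
  have h3 : HasFDerivAt (fun w : Fin 4 → ℂ => (w i)⁻¹)
      (-((v i ^ 2)⁻¹ • ContinuousLinearMap.proj (R := ℝ) (φ := fun _ : Fin 4 => ℂ) i)) v := by
    have h4 := (hasDerivAt_inv hv).comp_hasFDerivAt (𝕜 := ℂ) v
      (ContinuousLinearMap.proj (R := ℂ) (φ := fun _ : Fin 4 => ℂ) i).hasFDerivAt
    refine (h4.restrictScalars ℝ).congr_fderiv ?_
    ext w
    simp
  refine (h1.mul h3).congr_fderiv ?_
  ext w
  simp [affineDeriv]

lemma contMDiffAt_proj {v : Fin 4 → ℂ} (hv : v ≠ 0) :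
    ContMDiffAt 𝓘(ℝ, Fin 4 → ℂ) 𝓘(ℝ, Fin 3 → ℂ) ∞ proj v := by
  have hi := proj_chartIdx hv
  have h1 : ContMDiffAt 𝓘(ℝ, Fin 3 → ℂ) 𝓘(ℝ, Fin 3 → ℂ) ∞ (chartAt (Fin 3 → ℂ) (proj v)).symm
      (affineCoord (chartIdx (proj v)) v) :=
    (contMDiffOn_chart_symm (I := 𝓘(ℝ, Fin 3 → ℂ)) (x := proj v)).contMDiffAt
      (by
        have : (chartAt (Fin 3 → ℂ) (proj v)).target = Set.univ := rfl
        rw [this]; exact Filter.univ_mem)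
  refine (h1.comp v (contDiffAt_affineCoord hi).contMDiffAt).congr_of_eventuallyEq ?_
  have : ∀ᶠ w in nhds v, w (chartIdx (proj v)) ≠ 0 :=
    (continuous_apply (chartIdx (proj v))).continuousAt.eventually_ne hi
  filter_upwards [this] with w hw
  rw [Function.comp_apply, chartAt_symm_apply, proj_insertNth_affineCoord hw]

/-- The differential of the projection `ℂ⁴ ∖ 0 → ℂP³`. -/
def dproj (v : Fin 4 → ℂ) : (Fin 4 → ℂ) →L[ℝ] TangentSpace 𝓘(ℝ, Fin 3 → ℂ) (proj v) :=
  mfderiv 𝓘(ℝ, Fin 4 → ℂ) 𝓘(ℝ, Fin 3 → ℂ) proj v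

lemma hasMFDerivAt_proj {v : Fin 4 → ℂ} (hv : v ≠ 0) :
    HasMFDerivAt 𝓘(ℝ, Fin 4 → ℂ) 𝓘(ℝ, Fin 3 → ℂ) proj v
      (affineDeriv (chartIdx (proj v)) v) := by
  have hi : v (chartIdx (proj v)) ≠ 0 := proj_chartIdx hv
  refine ⟨(contMDiffAt_proj hv).continuousAt, ?_⟩
  refine ((hasFDerivAt_affineCoord hi).congr_of_eventuallyEq ?_).hasFDerivWithinAt
  have : ∀ᶠ w in nhds v, w (chartIdx (proj v)) ≠ 0 :=
    (continuous_apply _).continuousAt.eventually_ne hi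
  filter_upwards [this] with w hw
  exact affineChart_proj _ (fun h => hw (congrFun h _))

lemma dproj_eq {v : Fin 4 → ℂ} (hv : v ≠ 0) :
    dproj v = affineDeriv (chartIdx (proj v)) v := (hasMFDerivAt_proj hv).mfderiv

lemma dproj_surjective {v : Fin 4 → ℂ} (hv : v ≠ 0)
    (u : TangentSpace 𝓘(ℝ, Fin 3 → ℂ) (proj v)) : ∃ w, dproj v w = u := by
  have hi : v (chartIdx (proj v)) ≠ 0 := proj_chartIdx hv
  -- With a vanishing coordinate of index `i`, the differential of `w_k / w_i` at `v` is `w_k /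
  -- v_i`, so multiplying the required coordinates by `v_i` suffices.
  refine ⟨(chartIdx (proj v)).insertNth 0 (fun k => v (chartIdx (proj v)) * (show Fin 3 → ℂ from u) k), ?_⟩
  refine (DFunLike.congr_fun (dproj_eq hv) _).trans (funext fun k => ?_)
  refine (affineDeriv_apply hi _ k).trans ?_
  simp only [Fin.insertNth_apply_succAbove, Fin.insertNth_apply_same, mul_zero, sub_zero]
  field_simp

lemma dproj_self {v : Fin 4 → ℂ} (hv : v ≠ 0) (c : ℂ) : dproj v (c • v) = 0 := by
  have hi : v (chartIdx (proj v)) ≠ 0 := proj_chartIdx hv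
  refine (DFunLike.congr_fun (dproj_eq hv) _).trans (funext fun k => ?_)
  refine (affineDeriv_apply hi _ k).trans ?_
  refine Eq.trans ?_ (zero_div (v (chartIdx (proj v)) ^ 2))
  simp only [Pi.smul_apply, smul_eq_mul]
  ring

/-- The affine coordinates are holomorphic in the homogeneous ones, so their differential is complex
linear. -/
lemma mulI_dproj {v : Fin 4 → ℂ} (hv : v ≠ 0) (w : Fin 4 → ℂ) :
    mulI (proj v) (dproj v w) = dproj v (Complex.I • w) := by
  have hi : v (chartIdx (proj v)) ≠ 0 := proj_chartIdx hv
  have h1 := DFunLike.congr_fun (dproj_eq hv) w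
  refine (congrArg (mulI (proj v)) h1).trans
    (Eq.trans ?_ (DFunLike.congr_fun (dproj_eq hv) (Complex.I • w)).symm)
  refine funext fun k => ?_
  refine Eq.trans ?_ (affineDeriv_apply hi _ k).symm
  refine (congrArg (Complex.I * ·) (affineDeriv_apply hi w k)).trans ?_
  simp
  ring

/-- Homogeneity of `dproj`, for any function of families of tangent vectors. -/
lemma dproj_smul {α κ : Type*} (Φ : ∀ p : CP3, (κ → TangentSpace 𝓘(ℝ, Fin 3 → ℂ) p) → α)
    {c : ℂ} (hc : c ≠ 0) {v : Fin 4 → ℂ} (hv : v ≠ 0) (w : κ → Fin 4 → ℂ) :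
    Φ (proj (c • v)) (fun i => dproj (c • v) (c • w i)) = Φ (proj v) (fun i => dproj v (w i)) := by
  have hcv : c • v ≠ 0 := smul_ne_zero hc hv
  have key : ∀ w, (affineDeriv (chartIdx (proj (c • v))) (c • v) (c • w) : Fin 3 → ℂ) =
      affineDeriv (chartIdx (proj v)) v w := by
    intro w
    have hi : v (chartIdx (proj v)) ≠ 0 := proj_chartIdx hv
    rw [proj_smul hc v]
    ext k
    rw [affineDeriv_apply hi, affineDeriv_apply (by simpa [hc] using hi)]
    simp
    field_simp
  -- The tangent spaces at `proj (c • v)` and `proj v` are fibres over points that are only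
  -- propositionally equal. Passing through an arbitrary `Φ` absorbs the transport between them.
  have gen : ∀ (p q : CP3), p = q → ∀ u : κ → Fin 3 → ℂ, Φ p u = Φ q u := by
    rintro p q rfl u; rfl
  refine (congrArg (Φ (proj (c • v)))
    (funext fun i => DFunLike.congr_fun (dproj_eq hcv) (c • w i))).trans ?_
  refine Eq.trans ?_ (congrArg (Φ (proj v))
    (funext fun i => DFunLike.congr_fun (dproj_eq hv) (w i))).symm
  exact (congrArg (Φ (proj (c • v))) (funext fun i => key (w i))).trans
    (gen _ _ (proj_smul hc v) _)

section

variable {F : Type*} [NormedAddCommGroup F] [NormedSpace ℝ F]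

/-- A map on `ℂP³` is smooth if its lift to `ℂ⁴ ∖ 0` is. -/
lemma contMDiff_of_comp_proj {f : CP3 → F}
    (h : ∀ v, v ≠ 0 → ContDiffAt ℝ ∞ (fun w => f (proj w)) v) :
    ContMDiff 𝓘(ℝ, Fin 3 → ℂ) 𝓘(ℝ, F) ∞ f := by
  intro p
  set i := chartIdx p
  have h1 : ContDiff ℝ ∞ (fun z : Fin 3 → ℂ => (i.insertNth (1 : ℂ) z : Fin 4 → ℂ)) :=
    contDiff_pi.2 fun j => contDiff_insertNth i j
  have h2 : ContMDiffAt 𝓘(ℝ, Fin 3 → ℂ) 𝓘(ℝ, Fin 3 → ℂ) ∞ (chartAt (Fin 3 → ℂ) p) p :=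
    (contMDiffOn_chart (I := 𝓘(ℝ, Fin 3 → ℂ)) (x := p)).contMDiffAt
      ((chartAt (Fin 3 → ℂ) p).open_source.mem_nhds (mem_chart_source _ p))
  have h3 : ContDiffAt ℝ ∞ (fun z : Fin 3 → ℂ => f (proj (i.insertNth (1 : ℂ) z : Fin 4 → ℂ)))
      (chartAt (Fin 3 → ℂ) p p) :=
    (h _ (insertNth_ne_zero i _)).comp (chartAt (Fin 3 → ℂ) p p) h1.contDiffAt
  refine (h3.contMDiffAt.comp p h2).congr_of_eventuallyEq ?_
  filter_upwards [(chartAt (Fin 3 → ℂ) p).open_source.mem_nhds (mem_chart_source _ p)] with q hq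
  rw [Function.comp_apply, ← chartAt_symm_apply, (chartAt (Fin 3 → ℂ) p).left_inv hq]

lemma mvfderiv_dproj {f : CP3 → F} {v : Fin 4 → ℂ} (hv : v ≠ 0)
    (hf : MDifferentiableAt 𝓘(ℝ, Fin 3 → ℂ) 𝓘(ℝ, F) f (proj v)) (w : Fin 4 → ℂ) :
    mvfderiv 𝓘(ℝ, Fin 3 → ℂ) f (proj v) (dproj v w) = fderiv ℝ (fun y => f (proj y)) v w := by
  have h := mfderiv_comp v hf ((contMDiffAt_proj hv).mdifferentiableAt (by simp))
  have h2 := DFunLike.congr_fun h w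
  refine Eq.symm (Eq.trans ?_ h2)
  exact (DFunLike.congr_fun (mfderiv_eq_fderiv (𝕜 := ℝ) (f := fun y => f (proj y)) (x := v)) w).symm

end

lemma contMDiff_smul (a : Sp2) :
    ContMDiff 𝓘(ℝ, Fin 3 → ℂ) 𝓘(ℝ, Fin 3 → ℂ) ∞ (fun p : CP3 => a • p) := by
  intro p
  set i := chartIdx p
  have h1 : ContDiff ℝ ∞ (fun z : Fin 3 → ℂ => (i.insertNth (1 : ℂ) z : Fin 4 → ℂ)) :=
    contDiff_pi.2 fun j => contDiff_insertNth i j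
  have h2 : ContMDiffAt 𝓘(ℝ, Fin 3 → ℂ) 𝓘(ℝ, Fin 3 → ℂ) ∞ (chartAt (Fin 3 → ℂ) p) p :=
    (contMDiffOn_chart (I := 𝓘(ℝ, Fin 3 → ℂ)) (x := p)).contMDiffAt
      ((chartAt (Fin 3 → ℂ) p).open_source.mem_nhds (mem_chart_source _ p))
  have h4 : ContDiff ℝ ∞ (fun v : Fin 4 → ℂ => sp2Matrix a *ᵥ v) :=
    ((Matrix.mulVecLin (sp2Matrix a)).restrictScalars ℝ).toContinuousLinearMap.contDiff
  have h3 : ContMDiffAt 𝓘(ℝ, Fin 3 → ℂ) 𝓘(ℝ, Fin 3 → ℂ) ∞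
      (fun z : Fin 3 → ℂ => proj (sp2Matrix a *ᵥ (i.insertNth (1 : ℂ) z : Fin 4 → ℂ)))
      (chartAt (Fin 3 → ℂ) p p) :=
    (contMDiffAt_proj (mulVec_ne_zero a (insertNth_ne_zero i _))).comp (chartAt (Fin 3 → ℂ) p p)
      (h4.comp h1).contDiffAt.contMDiffAt
  refine (h3.comp p h2).congr_of_eventuallyEq ?_
  filter_upwards [(chartAt (Fin 3 → ℂ) p).open_source.mem_nhds (mem_chart_source _ p)] with q hq
  rw [Function.comp_apply, ← smul_proj a (insertNth_ne_zero i _), ← chartAt_symm_apply,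
    (chartAt (Fin 3 → ℂ) p).left_inv hq]

/-- The differential of the action, for any function of families of tangent vectors. -/
lemma mfderiv_smul_dproj {α κ : Type*} (Φ : ∀ p : CP3, (κ → TangentSpace 𝓘(ℝ, Fin 3 → ℂ) p) → α)
    (a : Sp2) {v : Fin 4 → ℂ} (hv : v ≠ 0) (w : κ → Fin 4 → ℂ) :
    Φ (a • proj v) (fun i => mfderiv 𝓘(ℝ, Fin 3 → ℂ) 𝓘(ℝ, Fin 3 → ℂ) (fun y : CP3 => a • y)
        (proj v) (dproj v (w i))) =
      Φ (proj (sp2Matrix a *ᵥ v))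
        (fun i => dproj (sp2Matrix a *ᵥ v) (sp2Matrix a *ᵥ w i)) := by
  set A : (Fin 4 → ℂ) →L[ℝ] (Fin 4 → ℂ) :=
    ((Matrix.mulVecLin (sp2Matrix a)).restrictScalars ℝ).toContinuousLinearMap
  have hav := mulVec_ne_zero a hv
  have h1 : HasMFDerivAt 𝓘(ℝ, Fin 4 → ℂ) 𝓘(ℝ, Fin 3 → ℂ) (fun y => a • proj y) v
      ((mfderiv 𝓘(ℝ, Fin 3 → ℂ) 𝓘(ℝ, Fin 3 → ℂ) (fun y : CP3 => a • y) (proj v)).comp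
        (dproj v)) :=
    HasMFDerivAt.comp v
      ((contMDiff_smul a (proj v)).mdifferentiableAt (by simp)).hasMFDerivAt
      ((contMDiffAt_proj hv).mdifferentiableAt (by simp)).hasMFDerivAt
  have h2 : HasMFDerivAt 𝓘(ℝ, Fin 4 → ℂ) 𝓘(ℝ, Fin 3 → ℂ) (fun y => proj (sp2Matrix a *ᵥ y)) v
      ((dproj (sp2Matrix a *ᵥ v)).comp A) :=
    HasMFDerivAt.comp v
      ((contMDiffAt_proj hav).mdifferentiableAt (by simp)).hasMFDerivAt
      A.hasFDerivAt.hasMFDerivAt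
  have h3 : (fun y => a • proj y) =ᶠ[nhds v] (fun y => proj (sp2Matrix a *ᵥ y)) := by
    filter_upwards [isOpen_ne.mem_nhds hv] with y hy
    exact smul_proj a hy
  have h4 := hasMFDerivAt_unique h1 (h2.congr_of_eventuallyEq h3)
  have h5 : ∀ (p q : CP3), p = q → ∀ u : κ → Fin 3 → ℂ, Φ p u = Φ q u := by
    rintro p q rfl u; rfl
  exact (congrArg (Φ (a • proj v)) (funext fun i => DFunLike.congr_fun h4 (w i))).trans
    (h5 _ _ (smul_proj a hv) _)

end CP3

/-! ### Clifford matrices and the spin representation of `Sp(2)` -/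

/-- Hermitian matrices generating the Clifford algebra of `ℝ⁵`, acting on `ℂ⁴`. -/
def gam : Fin 5 → Matrix (Fin 4) (Fin 4) ℂ :=
  ![!![0, 0, 1, 0; 0, 0, 0, 1; 1, 0, 0, 0; 0, 1, 0, 0],
    !![0, 0, Complex.I, 0; 0, 0, 0, -Complex.I; -Complex.I, 0, 0, 0; 0, Complex.I, 0, 0],
    !![0, 0, 0, 1; 0, 0, -1, 0; 0, -1, 0, 0; 1, 0, 0, 0],
    !![0, 0, 0, Complex.I; 0, 0, Complex.I, 0; 0, -Complex.I, 0, 0; -Complex.I, 0, 0, 0],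
    !![1, 0, 0, 0; 0, 1, 0, 0; 0, 0, -1, 0; 0, 0, 0, -1]]

lemma gam_conjTranspose (k : Fin 5) : (gam k)ᴴ = gam k := by
  fin_cases k <;> ext a b <;> fin_cases a <;> fin_cases b <;> simp [gam]

lemma gam_zero_mulVec (v : Fin 4 → ℂ) : gam 0 *ᵥ v = ![v 2, v 3, v 0, v 1] := by
  ext a; fin_cases a <;> simp [gam, Matrix.mulVec, dotProduct, Fin.sum_univ_succ]

lemma gam_one_mulVec (v : Fin 4 → ℂ) :
    gam 1 *ᵥ v = ![Complex.I * v 2, -(Complex.I * v 3), -(Complex.I * v 0), Complex.I * v 1] := by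
  ext a; fin_cases a <;> simp [gam, Matrix.mulVec, dotProduct, Fin.sum_univ_succ]

lemma gam_two_mulVec (v : Fin 4 → ℂ) : gam 2 *ᵥ v = ![v 3, -v 2, -v 1, v 0] := by
  ext a; fin_cases a <;> simp [gam, Matrix.mulVec, dotProduct, Fin.sum_univ_succ]

lemma gam_three_mulVec (v : Fin 4 → ℂ) :
    gam 3 *ᵥ v = ![Complex.I * v 3, Complex.I * v 2, -(Complex.I * v 1), -(Complex.I * v 0)] := by
  ext a; fin_cases a <;> simp [gam, Matrix.mulVec, dotProduct, Fin.sum_univ_succ]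

lemma gam_four_mulVec (v : Fin 4 → ℂ) : gam 4 *ᵥ v = ![v 0, v 1, -v 2, -v 3] := by
  ext a; fin_cases a <;> simp [gam, Matrix.mulVec, dotProduct, Fin.sum_univ_succ]

lemma I_mul_I_mul (z : ℂ) : Complex.I * (Complex.I * z) = -z := by
  rw [← mul_assoc, Complex.I_mul_I, neg_one_mul]

lemma gam_clifford (k l : Fin 5) :
    gam k * gam l + gam l * gam k = if k = l then 2 else 0 := by
  refine Matrix.ext_of_mulVec_single fun i => ?_
  generalize (Pi.single i 1 : Fin 4 → ℂ) = v
  rw [Matrix.add_mulVec, ← Matrix.mulVec_mulVec, ← Matrix.mulVec_mulVec]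
  have h2 : (2 : Matrix (Fin 4) (Fin 4) ℂ) *ᵥ v = ![2 * v 0, 2 * v 1, 2 * v 2, 2 * v 3] := by
    ext a; fin_cases a <;> simp [Matrix.ofNat_mulVec]
  fin_cases k <;> fin_cases l <;>
    simp [gam_zero_mulVec, gam_one_mulVec, gam_two_mulVec, gam_three_mulVec, gam_four_mulVec,
      h2, I_mul_I_mul, two_mul, -Matrix.ofNat_mulVec]

lemma gam_quatΩ (k : Fin 5) : gam k * quatΩ = quatΩ * (gam k).map conj := by
  fin_cases k <;> ext a b <;> fin_cases a <;> fin_cases b <;>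
    simp [gam, quatΩ, Matrix.mul_apply, Fin.sum_univ_succ]

lemma trace_gam (k : Fin 5) : (gam k).trace = 0 := by
  fin_cases k <;> simp [gam, Matrix.trace, Fin.sum_univ_succ]

/-- The traceless hermitian matrices commuting with the quaternionic structure are the real
combinations of the matrices `gam k`. -/
lemma exists_eq_sum_gam {X : Matrix (Fin 4) (Fin 4) ℂ} (h1 : Xᴴ = X)
    (h2 : X * quatΩ = quatΩ * X.map conj) (h3 : X.trace = 0) :
    ∃ r : Fin 5 → ℝ, X = ∑ m, (r m : ℂ) • gam m := by
  -- In `∑ r_m γ_m` the entry `(2, 0)` is `r₀ - i r₁`, the entry `(3, 0)` is `r₂ - i r₃`, and the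
  -- entry `(0, 0)` is `r₄`.
  refine ⟨![(X 2 0).re, -(X 2 0).im, (X 3 0).re, -(X 3 0).im, (X 0 0).re], ?_⟩
  have e1 : ∀ a b, conj (X b a) = X a b := fun a b => congrFun (congrFun h1 a) b
  have e2 : ∀ a b, (X * quatΩ) a b = (quatΩ * X.map conj) a b :=
    fun a b => congrFun (congrFun h2 a) b
  have e3 : X 0 0 + (X 1 1 + (X 2 2 + X 3 3)) = 0 := by
    simpa [Matrix.trace, Fin.sum_univ_succ] using h3
  have f00 := e2 0 0
  have f01 := e2 0 1
  have f22 := e2 2 2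
  have f23 := e2 2 3
  have f20 := e2 2 0
  have f21 := e2 2 1
  have g00 := e1 0 0
  have g11 := e1 1 1
  have g22 := e1 2 2
  have g33 := e1 3 3
  have g01 := e1 0 1
  have g23 := e1 2 3
  have g02 := e1 0 2
  have g03 := e1 0 3
  have g12 := e1 1 2
  have g13 := e1 1 3
  simp [quatΩ, Matrix.mul_apply, Fin.sum_univ_succ] at f00 f01 f22 f23 f20 f21
  simp only [Complex.ext_iff, Complex.conj_re, Complex.conj_im, Complex.neg_re, Complex.neg_im,
    Complex.add_re, Complex.add_im, Complex.zero_re, Complex.zero_im] at *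
  ext a b
  rw [Matrix.sum_apply]
  fin_cases a <;> fin_cases b <;>
    (simp [gam, Fin.sum_univ_succ, Complex.ext_iff]; try constructor) <;> linarith

/-- The hermitian form of a matrix. -/
def hform (X : Matrix (Fin 4) (Fin 4) ℂ) (v : Fin 4 → ℂ) : ℂ := star v ⬝ᵥ X *ᵥ v

/-- The squared norm of a vector of `ℂ⁴`. -/
def sqNorm (v : Fin 4 → ℂ) : ℝ := ∑ k, Complex.normSq (v k)

lemma sqNorm_pos {v : Fin 4 → ℂ} (hv : v ≠ 0) : 0 < sqNorm v := by
  obtain ⟨i, hi⟩ := Function.ne_iff.1 hv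
  exact Finset.sum_pos' (fun _ _ => Complex.normSq_nonneg _)
    ⟨i, Finset.mem_univ _, Complex.normSq_pos.2 hi⟩

lemma sqNorm_smul (c : ℂ) (v : Fin 4 → ℂ) : sqNorm (c • v) = Complex.normSq c * sqNorm v := by
  simp [sqNorm, Finset.mul_sum]

lemma sqNorm_eq (v : Fin 4 → ℂ) : (sqNorm v : ℂ) = star v ⬝ᵥ v := by
  simp [sqNorm, dotProduct, Complex.normSq_eq_conj_mul_self]

lemma hform_smul (X : Matrix (Fin 4) (Fin 4) ℂ) (c : ℂ) (v : Fin 4 → ℂ) :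
    hform X (c • v) = Complex.normSq c * hform X v := by
  simp [hform, Matrix.mulVec_smul, Complex.normSq_eq_conj_mul_self]
  ring

lemma hform_mulVec (X A : Matrix (Fin 4) (Fin 4) ℂ) (v : Fin 4 → ℂ) :
    hform X (A *ᵥ v) = hform (Aᴴ * X * A) v := by
  simp [hform, Matrix.star_mulVec, Matrix.dotProduct_mulVec, Matrix.vecMul_vecMul, Matrix.mul_assoc]

lemma sqNorm_mulVec (a : Sp2) (v : Fin 4 → ℂ) : sqNorm (sp2Matrix a *ᵥ v) = sqNorm v := by
  have h1 : (sp2Matrix a)ᴴ * (sp2Matrix a) = 1 := Matrix.UnitaryGroup.star_mul_self a.1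
  have h : (sqNorm (sp2Matrix a *ᵥ v) : ℂ) = sqNorm v := by
    rw [sqNorm_eq, sqNorm_eq, Matrix.star_mulVec, Matrix.dotProduct_mulVec, Matrix.vecMul_vecMul,
      h1, Matrix.vecMul_one]
  exact_mod_cast h

lemma hform_add (X Y : Matrix (Fin 4) (Fin 4) ℂ) (v : Fin 4 → ℂ) :
    hform (X + Y) v = hform X v + hform Y v := by simp [hform, Matrix.add_mulVec]

lemma hform_const_smul (c : ℂ) (X : Matrix (Fin 4) (Fin 4) ℂ) (v : Fin 4 → ℂ) :
    hform (c • X) v = c * hform X v := by simp [hform, Matrix.smul_mulVec]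

lemma hform_sum {ι : Type*} (s : Finset ι) (X : ι → Matrix (Fin 4) (Fin 4) ℂ) (v : Fin 4 → ℂ) :
    hform (∑ i ∈ s, X i) v = ∑ i ∈ s, hform (X i) v := by
  classical
  induction s using Finset.induction_on with
  | empty => simp [hform]
  | insert i s hi ih => rw [Finset.sum_insert hi, Finset.sum_insert hi, hform_add, ih]

/-- `hopf`, as a function of the homogeneous coordinates. -/
def hopfV (v : Fin 4 → ℂ) (k : Fin 5) : ℝ := (hform (gam k) v).re / sqNorm v

/-- The complex structure attached to homogeneous coordinates. -/
def twistorJV (v : Fin 4 → ℂ) : Matrix (Fin 5) (Fin 5) ℝ :=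
  Matrix.of fun k l => -(hform (gam k * gam l) v).im / sqNorm v

/-- The complex structure `j` of `T S⁴` attached to a point of `ℂP³`. -/
def twistorJ (p : CP3) : Matrix (Fin 5) (Fin 5) ℝ := twistorJV p.rep

lemma hopf_eq (p : CP3) : hopf p = hopfV p.rep := by
  ext k
  simp only [hopf, hopfV]
  rw [Pi.smul_apply, smul_eq_mul, div_eq_inv_mul]
  refine congrArg₂ (· * ·) rfl ?_
  fin_cases k <;> simp [hform, gam, dotProduct, Matrix.mulVec, Fin.sum_univ_succ,
    Complex.normSq_apply] <;> ring

lemma exists_rep_proj {v : Fin 4 → ℂ} (hv : v ≠ 0) :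
    ∃ c : ℂ, c ≠ 0 ∧ (CP3.proj v).rep = c • v := by
  rw [CP3.proj_of_ne hv]; exact CP3.exists_rep_mk v hv

lemma hopf_proj {v : Fin 4 → ℂ} (hv : v ≠ 0) : hopf (CP3.proj v) = hopfV v := by
  obtain ⟨c, hc, h⟩ := exists_rep_proj hv
  have hc' : Complex.normSq c ≠ 0 := by simpa using hc
  rw [hopf_eq, h]
  ext k
  rw [hopfV, hopfV, hform_smul, sqNorm_smul, Complex.re_ofReal_mul, mul_div_mul_left _ _ hc']

lemma twistorJ_proj {v : Fin 4 → ℂ} (hv : v ≠ 0) : twistorJ (CP3.proj v) = twistorJV v := by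
  obtain ⟨c, hc, h⟩ := exists_rep_proj hv
  have hc' : Complex.normSq c ≠ 0 := by simpa using hc
  rw [twistorJ, h]
  ext k l
  simp only [twistorJV, Matrix.of_apply]
  rw [hform_smul, sqNorm_smul, Complex.im_ofReal_mul, ← mul_neg, mul_div_mul_left _ _ hc']


/-- Real quadratic polynomials in the coordinates giving `hopfV`. -/
def hopfNum (v : Fin 4 → ℂ) : Fin 5 → ℝ :=
  ![2 * ((v 0).re * (v 2).re + (v 0).im * (v 2).im + ((v 1).re * (v 3).re + (v 1).im * (v 3).im)),
    2 * (-((v 0).re * (v 2).im - (v 0).im * (v 2).re) +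
      ((v 1).re * (v 3).im - (v 1).im * (v 3).re)),
    2 * ((v 0).re * (v 3).re + (v 0).im * (v 3).im - ((v 1).re * (v 2).re + (v 1).im * (v 2).im)),
    2 * (-((v 0).re * (v 3).im - (v 0).im * (v 3).re) -
      ((v 1).re * (v 2).im - (v 1).im * (v 2).re)),
    Complex.normSq (v 0) + Complex.normSq (v 1) - Complex.normSq (v 2) - Complex.normSq (v 3)]

/-- Entries above the diagonal of the real quadratic matrix giving `twistorJV`. -/
def twistorNumUpper (v : Fin 4 → ℂ) : Matrix (Fin 5) (Fin 5) ℝ :=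
  let s (a b : Fin 4) : ℝ := (v a).re * (v b).re + (v a).im * (v b).im
  let t (a b : Fin 4) : ℝ := (v a).re * (v b).im - (v a).im * (v b).re
  !![0, s 0 0 - s 1 1 - s 2 2 + s 3 3, 2 * t 0 1 - 2 * t 2 3, 2 * s 0 1 - 2 * s 2 3,
      2 * t 0 2 + 2 * t 1 3;
     0, 0, 2 * s 0 1 + 2 * s 2 3, -(2 * t 0 1) - 2 * t 2 3, 2 * s 0 2 - 2 * s 1 3;
     0, 0, 0, s 0 0 - s 1 1 + s 2 2 - s 3 3, 2 * t 0 3 - 2 * t 1 2;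
     0, 0, 0, 0, 2 * s 0 3 + 2 * s 1 2;
     0, 0, 0, 0, 0]

lemma hopfV_eq (v : Fin 4 → ℂ) (k : Fin 5) : hopfV v k = hopfNum v k / sqNorm v := by
  refine congrArg (· / sqNorm v) ?_
  fin_cases k <;> simp [hform, hopfNum, gam_zero_mulVec, gam_one_mulVec, gam_two_mulVec,
    gam_three_mulVec, gam_four_mulVec, dotProduct, Fin.sum_univ_succ, Complex.normSq_apply] <;> ring

/-- With real and imaginary parts made explicit, the identities satisfied by `j` become polynomial
identities in eight real variables. -/
lemma twistorJV_eq (v : Fin 4 → ℂ) :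
    twistorJV v = (sqNorm v)⁻¹ • (twistorNumUpper v - (twistorNumUpper v)ᵀ) := by
  ext k l
  simp only [twistorJV, Matrix.of_apply, Matrix.smul_apply, smul_eq_mul, hform]
  rw [← Matrix.mulVec_mulVec, div_eq_inv_mul]
  refine congrArg ((sqNorm v)⁻¹ * ·) ?_
  fin_cases k <;> fin_cases l <;> simp [twistorNumUpper, gam_zero_mulVec, gam_one_mulVec,
    gam_two_mulVec, gam_three_mulVec, gam_four_mulVec, dotProduct, Fin.sum_univ_succ] <;> ring

lemma hopfV_fun_eq (v : Fin 4 → ℂ) : hopfV v = (sqNorm v)⁻¹ • hopfNum v := by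
  ext k; rw [hopfV_eq, Pi.smul_apply, smul_eq_mul, div_eq_inv_mul]

lemma sqNorm_expand (v : Fin 4 → ℂ) : sqNorm v =
    (v 0).re ^ 2 + (v 0).im ^ 2 + (v 1).re ^ 2 + (v 1).im ^ 2 + (v 2).re ^ 2 + (v 2).im ^ 2
      + (v 3).re ^ 2 + (v 3).im ^ 2 := by
  simp [sqNorm, Fin.sum_univ_succ, Complex.normSq_apply]; ring

lemma hopfV_dotProduct_self {v : Fin 4 → ℂ} (hv : v ≠ 0) : hopfV v ⬝ᵥ hopfV v = 1 := by
  have h := (sqNorm_pos hv).ne'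
  rw [hopfV_fun_eq, smul_dotProduct, dotProduct_smul, smul_smul]
  have : hopfNum v ⬝ᵥ hopfNum v = sqNorm v ^ 2 := by
    rw [sqNorm_expand]
    simp [hopfNum, dotProduct, Fin.sum_univ_succ, Complex.normSq_apply]
    ring
  rw [this, smul_eq_mul]
  field_simp

lemma twistorJV_transpose (v : Fin 4 → ℂ) : (twistorJV v)ᵀ = -twistorJV v := by
  rw [twistorJV_eq, Matrix.transpose_smul, ← smul_neg]
  simp

lemma twistorJV_mulVec_hopfV (v : Fin 4 → ℂ) : twistorJV v *ᵥ hopfV v = 0 := by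
  rw [twistorJV_eq, hopfV_fun_eq, Matrix.smul_mulVec, Matrix.mulVec_smul]
  have : (twistorNumUpper v - (twistorNumUpper v)ᵀ) *ᵥ hopfNum v = 0 := by
    ext k
    fin_cases k <;> simp [twistorNumUpper, hopfNum, Matrix.mulVec, dotProduct, Fin.sum_univ_succ,
      Complex.normSq_apply] <;> ring
  rw [this, smul_zero, smul_zero]

lemma twistorJV_mul_self {v : Fin 4 → ℂ} (hv : v ≠ 0) :
    twistorJV v * twistorJV v = -(1 - Matrix.vecMulVec (hopfV v) (hopfV v)) := by
  have h := (sqNorm_pos hv).ne'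
  have key : (twistorNumUpper v - (twistorNumUpper v)ᵀ) *
      (twistorNumUpper v - (twistorNumUpper v)ᵀ) =
      Matrix.vecMulVec (hopfNum v) (hopfNum v) - (sqNorm v ^ 2) • (1 : Matrix (Fin 5) (Fin 5) ℝ) := by
    rw [sqNorm_expand]
    ext k l
    fin_cases k <;> fin_cases l <;> simp [twistorNumUpper, hopfNum, Matrix.mul_apply,
      Fin.sum_univ_succ, Complex.normSq_apply] <;> ring
  rw [twistorJV_eq, hopfV_fun_eq, Matrix.smul_mul, Matrix.mul_smul, smul_smul, key,
    Matrix.vecMulVec_smul, Matrix.smul_vecMulVec, smul_smul, neg_sub, smul_sub, smul_smul]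
  congr 1
  rw [show (sqNorm v)⁻¹ * (sqNorm v)⁻¹ * sqNorm v ^ 2 = 1 by field_simp, one_smul]

/-- The Pfaffians of the minors of size 4 of an antisymmetric matrix of size 5, with signs. -/
def pfaffianVec (j : Matrix (Fin 5) (Fin 5) ℝ) : Fin 5 → ℝ :=
  ![j 1 2 * j 3 4 - j 1 3 * j 2 4 + j 1 4 * j 2 3,
    -(j 0 2 * j 3 4 - j 0 3 * j 2 4 + j 0 4 * j 2 3),
    j 0 1 * j 3 4 - j 0 3 * j 1 4 + j 0 4 * j 1 3,
    -(j 0 1 * j 2 4 - j 0 2 * j 1 4 + j 0 4 * j 1 2),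
    j 0 1 * j 2 3 - j 0 2 * j 1 3 + j 0 3 * j 1 2]

/-- This carries the orientation: the vector dual to `j ∧ j / 2` is `x` itself and not `-x`. -/
lemma pfaffianVec_twistorJV {v : Fin 4 → ℂ} (hv : v ≠ 0) :
    pfaffianVec (twistorJV v) = hopfV v := by
  have h := (sqNorm_pos hv).ne'
  have hs : ∀ (c : ℝ) (j : Matrix (Fin 5) (Fin 5) ℝ),
      pfaffianVec (c • j) = (c * c) • pfaffianVec j := by
    intro c j
    ext k
    fin_cases k <;> simp [pfaffianVec] <;> ring
  have key : pfaffianVec (twistorNumUpper v - (twistorNumUpper v)ᵀ) = sqNorm v • hopfNum v := by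
    rw [sqNorm_expand]
    ext k
    fin_cases k <;> simp [twistorNumUpper, hopfNum, pfaffianVec, Complex.normSq_apply] <;> ring
  rw [twistorJV_eq, hs, key, hopfV_fun_eq, smul_smul]
  congr 1
  field_simp

/-- Conjugation by a quaternionic unitary matrix preserves hermitian, traceless and quaternionic
matrices, hence the real span of the `γ_k`. It also preserves the Clifford relations, which force
the matrix of coefficients to be orthogonal. -/
lemma exists_rotation (a : Sp2) : ∃ R : Matrix (Fin 5) (Fin 5) ℝ, R * Rᵀ = 1 ∧ ∀ k,
    (sp2Matrix a)ᴴ * gam k * sp2Matrix a = ∑ m, (R k m : ℂ) • gam m := by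
  set A := sp2Matrix a with hA
  have h1 : Aᴴ * A = 1 := Matrix.UnitaryGroup.star_mul_self a.1
  have h1' : A * Aᴴ = 1 := mul_eq_one_comm.1 h1
  have h2 : A * quatΩ = quatΩ * A.map conj := a.2
  have h3 : Aᴴ * quatΩ = quatΩ * Aᴴ.map conj := (a⁻¹).2
  have h : ∀ k, ∃ r : Fin 5 → ℝ, Aᴴ * gam k * A = ∑ m, (r m : ℂ) • gam m := by
    intro k
    refine exists_eq_sum_gam ?_ ?_ ?_
    · rw [Matrix.conjTranspose_mul, Matrix.conjTranspose_mul, Matrix.conjTranspose_conjTranspose,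
        gam_conjTranspose, Matrix.mul_assoc]
    · rw [Matrix.mul_assoc, h2, ← Matrix.mul_assoc, Matrix.mul_assoc _ (gam k), gam_quatΩ,
        ← Matrix.mul_assoc, h3, Matrix.map_mul, Matrix.map_mul]
      simp only [Matrix.mul_assoc]
    · rw [Matrix.trace_mul_comm, ← Matrix.mul_assoc, h1', Matrix.one_mul, trace_gam]
  choose R hR using h
  refine ⟨Matrix.of R, ?_, fun k => hR k⟩
  ext k l
  have e1 : (Aᴴ * gam k * A) * (Aᴴ * gam l * A) + (Aᴴ * gam l * A) * (Aᴴ * gam k * A) =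
      if k = l then 2 else 0 := by
    have e2 : ∀ k l, (Aᴴ * gam k * A) * (Aᴴ * gam l * A) = Aᴴ * (gam k * gam l) * A := by
      intro k l
      calc _ = Aᴴ * gam k * (A * Aᴴ) * (gam l * A) := by simp only [Matrix.mul_assoc]
        _ = _ := by rw [h1', Matrix.mul_one]; simp only [Matrix.mul_assoc]
    rw [e2, e2, ← Matrix.add_mul, ← Matrix.mul_add, gam_clifford]
    split_ifs
    · have : (2 : Matrix (Fin 4) (Fin 4) ℂ) = (2 : ℂ) • 1 := by
        rw [← Matrix.diagonal_one]; ext i j; simp [Matrix.ofNat_apply, Matrix.one_apply]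
      rw [this, Matrix.mul_smul, Matrix.mul_one, Matrix.smul_mul, h1]
    · simp
  have e3 : ∀ k l, (∑ m, (R k m : ℂ) • gam m) * (∑ n, (R l n : ℂ) • gam n) =
      ∑ m, ∑ n, ((R k m : ℂ) * (R l n)) • (gam m * gam n) := by
    intro k l
    rw [Finset.sum_mul_sum]
    simp only [Matrix.smul_mul, Matrix.mul_smul, smul_smul]
    refine Finset.sum_congr rfl fun m _ => Finset.sum_congr rfl fun n _ => ?_
    rw [mul_comm]
  rw [hR, hR, e3, e3, Finset.sum_comm (f := fun m n => ((R l m : ℂ) * (R k n)) • (gam m * gam n)),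
    ← Finset.sum_add_distrib] at e1
  simp only [← Finset.sum_add_distrib] at e1
  have e4 : ∀ m n, ((R k m : ℂ) * (R l n)) • (gam m * gam n) +
      ((R l n : ℂ) * (R k m)) • (gam n * gam m) =
      if m = n then ((R k m : ℂ) * (R l n)) • 2 else 0 := by
    intro m n
    rw [mul_comm (R l n : ℂ), ← smul_add, gam_clifford]
    split_ifs <;> simp
  simp only [e4, Finset.sum_ite_eq, Finset.mem_univ, if_true] at e1
  -- Both sides are scalar matrices, so one diagonal entry contains all the information.
  have e5 := congrFun (congrFun e1 0) 0
  rw [Matrix.sum_apply] at e5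
  have e6 : ((∑ m, R k m * R l m : ℝ) : ℂ) * 2 = if k = l then 2 else 0 := by
    push_cast
    rw [Finset.sum_mul]
    refine Eq.trans ?_ (e5.trans ?_)
    · simp [Matrix.ofNat_apply]
    · split_ifs <;> simp [Matrix.ofNat_apply]
  simp only [Matrix.mul_apply, Matrix.transpose_apply, Matrix.of_apply, Matrix.one_apply]
  split_ifs at e6 ⊢
  · have : ((∑ m, R k m * R l m : ℝ) : ℂ) = 1 := by linear_combination e6 / 2
    exact_mod_cast this
  · have : ((∑ m, R k m * R l m : ℝ) : ℂ) = 0 := by linear_combination e6 / 2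
    exact_mod_cast this

/-- The rotation of `ℝ⁵` induced by an element of `Sp(2)`. -/
def spRotation (a : Sp2) : Matrix (Fin 5) (Fin 5) ℝ := Classical.choose (exists_rotation a)

lemma spRotation_mul_transpose (a : Sp2) : spRotation a * (spRotation a)ᵀ = 1 :=
  (Classical.choose_spec (exists_rotation a)).1

lemma transpose_mul_spRotation (a : Sp2) : (spRotation a)ᵀ * spRotation a = 1 :=
  mul_eq_one_comm.1 (spRotation_mul_transpose a)

lemma gam_conj (a : Sp2) (k : Fin 5) :
    (sp2Matrix a)ᴴ * gam k * sp2Matrix a = ∑ m, (spRotation a k m : ℂ) • gam m :=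
  (Classical.choose_spec (exists_rotation a)).2 k

lemma hopf_smul (a : Sp2) (p : CP3) : hopf (a • p) = spRotation a *ᵥ hopf p := by
  obtain ⟨v, hv, rfl⟩ := p.exists_proj
  rw [CP3.smul_proj a hv, hopf_proj hv, hopf_proj (CP3.mulVec_ne_zero a hv)]
  ext k
  simp only [hopfV, Matrix.mulVec, dotProduct, sqNorm_mulVec]
  rw [hform_mulVec, gam_conj, hform_sum, Complex.re_sum, Finset.sum_div]
  simp only [hform_const_smul, Complex.re_ofReal_mul, mul_div_assoc]

/-- Inserting `A Aᴴ = 1` between `γ_k` and `γ_l` reduces the conjugate of the product to the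
rotation of each factor. -/
lemma twistorJ_smul (a : Sp2) (p : CP3) :
    twistorJ (a • p) = spRotation a * twistorJ p * (spRotation a)ᵀ := by
  obtain ⟨v, hv, rfl⟩ := p.exists_proj
  rw [CP3.smul_proj a hv, twistorJ_proj hv, twistorJ_proj (CP3.mulVec_ne_zero a hv)]
  have h1 : (sp2Matrix a)ᴴ * (sp2Matrix a) = 1 := Matrix.UnitaryGroup.star_mul_self a.1
  have h1' : (sp2Matrix a) * (sp2Matrix a)ᴴ = 1 := mul_eq_one_comm.1 h1
  ext k l
  simp only [twistorJV, Matrix.of_apply, Matrix.mul_apply, Matrix.transpose_apply, sqNorm_mulVec]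
  have e : (sp2Matrix a)ᴴ * (gam k * gam l) * sp2Matrix a =
      ((sp2Matrix a)ᴴ * gam k * sp2Matrix a) * ((sp2Matrix a)ᴴ * gam l * sp2Matrix a) := by
    symm
    calc _ = (sp2Matrix a)ᴴ * gam k * (sp2Matrix a * (sp2Matrix a)ᴴ) * (gam l * sp2Matrix a) := by
          simp only [Matrix.mul_assoc]
      _ = _ := by rw [h1', Matrix.mul_one]; simp only [Matrix.mul_assoc]
  rw [hform_mulVec, e, gam_conj, gam_conj, Finset.sum_mul_sum, Finset.sum_comm, hform_sum,
    Complex.im_sum, ← Finset.sum_neg_distrib, Finset.sum_div]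
  refine Finset.sum_congr rfl fun n _ => ?_
  rw [hform_sum, Complex.im_sum, ← Finset.sum_neg_distrib, Finset.sum_div, Finset.sum_mul]
  refine Finset.sum_congr rfl fun m _ => ?_
  rw [Matrix.smul_mul, Matrix.mul_smul, hform_const_smul, hform_const_smul, Complex.im_ofReal_mul,
    Complex.im_ofReal_mul]
  ring


/-! ### Transitivity of `Sp(2)` and the isotropy subgroup -/

lemma exists_sp2Matrix_eq {A : Matrix (Fin 4) (Fin 4) ℂ} (h1 : Aᴴ * A = 1)
    (h2 : A * quatΩ = quatΩ * A.map conj) : ∃ a : Sp2, sp2Matrix a = A :=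
  ⟨⟨⟨A, Matrix.mem_unitaryGroup_iff'.2 h1⟩, h2⟩, rfl⟩

/-- The matrix with columns `v`, `Ω v̄`, `w`, `Ω w̄`. -/
def quatColumns (v w : Fin 4 → ℂ) : Matrix (Fin 4) (Fin 4) ℂ :=
  !![v 0, -conj (v 1), w 0, -conj (w 1);
     v 1, conj (v 0), w 1, conj (w 0);
     v 2, -conj (v 3), w 2, -conj (w 3);
     v 3, conj (v 2), w 3, conj (w 2)]

lemma quatColumns_quatΩ (v w : Fin 4 → ℂ) :
    quatColumns v w * quatΩ = quatΩ * (quatColumns v w).map conj := by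
  ext a b
  fin_cases a <;> fin_cases b <;>
    simp [quatColumns, quatΩ, Matrix.mul_apply, Fin.sum_univ_succ]

/-- The last two hypotheses say that `w` is orthogonal to `v` and to `Ω v̄`; the other orthogonality
relations are their images under the quaternionic structure. -/
lemma quatColumns_unitary {v w : Fin 4 → ℂ} (hv : star v ⬝ᵥ v = 1) (hw : star w ⬝ᵥ w = 1)
    (h1 : star v ⬝ᵥ w = 0) (h2 : v 0 * w 1 - v 1 * w 0 + v 2 * w 3 - v 3 * w 2 = 0) :
    (quatColumns v w)ᴴ * quatColumns v w = 1 := by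
  have h1' := congrArg conj h1
  have h2' := congrArg conj h2
  simp [dotProduct, Fin.sum_univ_succ] at hv hw h1 h1' h2'
  ext a b
  fin_cases a <;> fin_cases b <;>
    simp [quatColumns, Matrix.mul_apply, Fin.sum_univ_succ]
  · linear_combination hv
  · ring
  · linear_combination h1
  · linear_combination -h2'
  · ring
  · linear_combination hv
  · linear_combination h2
  · linear_combination h1'
  · linear_combination h1'
  · linear_combination h2'
  · linear_combination hw
  · ring
  · linear_combination -h2
  · linear_combination h1
  · ring
  · linear_combination hw

lemma star_dotProduct_self_smul (w : Fin 4 → ℂ) (hw : w ≠ 0) :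
    ∃ c : ℂ, c ≠ 0 ∧ star (c • w) ⬝ᵥ (c • w) = 1 := by
  have h := sqNorm_pos hw
  refine ⟨((Real.sqrt (sqNorm w))⁻¹ : ℝ), ?_, ?_⟩
  · exact_mod_cast (inv_pos.2 (Real.sqrt_pos.2 h)).ne'
  · rw [← sqNorm_eq, sqNorm_smul, Complex.normSq_ofReal, ← mul_inv, Real.mul_self_sqrt h.le,
      inv_mul_cancel₀ h.ne', Complex.ofReal_one]

/-- These are two linear equations in four complex unknowns. -/
lemma exists_orthogonal_quat (v : Fin 4 → ℂ) : ∃ w : Fin 4 → ℂ, w ≠ 0 ∧ star v ⬝ᵥ w = 0 ∧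
    v 0 * w 1 - v 1 * w 0 + v 2 * w 3 - v 3 * w 2 = 0 := by
  let M : Matrix (Fin 2) (Fin 4) ℂ := Matrix.of ![star v, ![-v 1, v 0, -v 3, v 2]]
  have hk : LinearMap.ker (Matrix.mulVecLin M) ≠ ⊥ :=
    LinearMap.ker_ne_bot_of_finrank_lt (by simp)
  obtain ⟨w, hw, hw0⟩ := (Submodule.ne_bot_iff _).1 hk
  have h : M *ᵥ w = 0 := hw
  refine ⟨w, hw0, congrFun h 0, ?_⟩
  have h1 : M 1 ⬝ᵥ w = 0 := congrFun h 1
  simp [M, dotProduct, Fin.sum_univ_succ] at h1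
  linear_combination h1

/-- A unit vector on the line is completed to a quaternionic orthonormal basis, whose matrix sends
the first basis vector to it. -/
lemma exists_smul_basePoint_eq (p : CP3) : ∃ a : Sp2, a • CP3.basePoint = p := by
  obtain ⟨v, hv, rfl⟩ := p.exists_proj
  obtain ⟨c, hc, hc1⟩ := star_dotProduct_self_smul v hv
  obtain ⟨w, hw, h1, h2⟩ := exists_orthogonal_quat (c • v)
  obtain ⟨d, hd, hd1⟩ := star_dotProduct_self_smul w hw
  obtain ⟨a, ha⟩ := exists_sp2Matrix_eq (quatColumns_unitary hc1 hd1
    (by rw [dotProduct_smul, h1, smul_zero])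
    (by simp only [Pi.smul_apply, smul_eq_mul] at h2 ⊢; linear_combination d * h2))
    (quatColumns_quatΩ _ _)
  refine ⟨a, ?_⟩
  rw [CP3.basePoint_eq, CP3.smul_proj a (by simp), ha, Matrix.mulVec_single_one,
    ← CP3.proj_smul hc v]
  congr 1
  ext k
  fin_cases k <;> simp [quatColumns]

instance : MulAction.IsPretransitive Sp2 CP3 := by
  refine ⟨fun p q => ?_⟩
  obtain ⟨a, rfl⟩ := exists_smul_basePoint_eq p
  obtain ⟨b, rfl⟩ := exists_smul_basePoint_eq q
  exact ⟨b * a⁻¹, by rw [mul_smul, inv_smul_smul]⟩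

lemma CP3.proj_eq_iff {v w : Fin 4 → ℂ} (hv : v ≠ 0) (hw : w ≠ 0) :
    CP3.proj v = CP3.proj w ↔ ∃ c : ℂ, c • w = v := by
  rw [CP3.proj_of_ne hv, CP3.proj_of_ne hw]
  exact Projectivization.mk_eq_mk_iff' ℂ v w hv hw

/-- For `q` in `SU(2)` the adjugate equals the conjugate transpose. This is the shape of a unit
quaternion, that is, commutation with the quaternionic structure. -/
lemma isotropyMatrix_unitary (x : Circle × Matrix.specialUnitaryGroup (Fin 2) ℂ) :
    ∃ a : Sp2, sp2Matrix a = isotropyMatrix x := by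
  obtain ⟨u, q⟩ := x
  have hu : conj (u : ℂ) * u = 1 := by
    rw [← Complex.normSq_eq_conj_mul_self]; simp
  have hq := Matrix.mem_specialUnitaryGroup_iff.1 q.2
  have hq1 : star (q : Matrix (Fin 2) (Fin 2) ℂ) * q = 1 := Matrix.mem_unitaryGroup_iff'.1 hq.1
  have hq2 : (q : Matrix (Fin 2) (Fin 2) ℂ).adjugate * q = 1 := by
    rw [Matrix.adjugate_mul, hq.2, one_smul]
  have hq3 : (q : Matrix (Fin 2) (Fin 2) ℂ).adjugate = star (q : Matrix (Fin 2) (Fin 2) ℂ) :=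
    (Matrix.inv_eq_left_inv hq2).symm.trans (Matrix.inv_eq_left_inv hq1)
  have e : ∀ a b, (q : Matrix (Fin 2) (Fin 2) ℂ).adjugate a b = conj (q.1 b a) :=
    fun a b => congrFun (congrFun hq3 a) b
  have e00 := e 0 0
  have e01 := e 0 1
  have g : ∀ a b, (star (q : Matrix (Fin 2) (Fin 2) ℂ) * q) a b = (1 : Matrix _ _ ℂ) a b :=
    fun a b => congrFun (congrFun hq1 a) b
  have g00 := g 0 0
  have g01 := g 0 1
  have g11 := g 1 1
  rw [Matrix.adjugate_fin_two] at e00 e01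
  simp at e00 e01
  have e01' := congrArg conj e01
  simp at e01'
  simp [Matrix.mul_apply, Fin.sum_univ_succ, Matrix.star_apply] at g00 g01 g11
  have g01' := congrArg conj g01
  simp at g01'
  refine exists_sp2Matrix_eq ?_ ?_
  · ext a b
    fin_cases a <;> fin_cases b <;>
      simp [isotropyMatrix, Matrix.mul_apply, Fin.sum_univ_succ]
    · linear_combination hu
    · linear_combination hu
    · linear_combination g00
    · linear_combination g01
    · linear_combination g01'
    · linear_combination g11
  · ext a b
    fin_cases a <;> fin_cases b <;>
      simp [isotropyMatrix, quatΩ, Matrix.mul_apply, Fin.sum_univ_succ, e00, ← e01']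

/-- Fixing the line puts the first column in the form `(u, 0, 0, 0)`, and commutation with `Ω` then
gives the second column. Unitarity clears the rest of the first row, and `Ω` clears that of the
second. The remaining block is unitary and quaternionic, hence in `SU(2)`. -/
lemma stabilizer_basePoint : sp2Matrix '' (MulAction.stabilizer Sp2 CP3.basePoint : Set Sp2) =
    Set.range isotropyMatrix := by
  have hs : ∀ a : Sp2, a • CP3.basePoint = CP3.basePoint ↔
      ∃ c : ℂ, c • (Pi.single 0 1 : Fin 4 → ℂ) = sp2Matrix a *ᵥ Pi.single 0 1 := by
    intro a
    have h0 : (Pi.single 0 1 : Fin 4 → ℂ) ≠ 0 := by simp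
    rw [CP3.basePoint_eq, CP3.smul_proj a h0, CP3.proj_eq_iff (CP3.mulVec_ne_zero a h0) h0]
  ext A
  constructor
  · rintro ⟨a, ha, rfl⟩
    obtain ⟨u, hu⟩ := (hs a).1 ha
    rw [Matrix.mulVec_single_one] at hu
    have h1 : (sp2Matrix a)ᴴ * sp2Matrix a = 1 := Matrix.UnitaryGroup.star_mul_self a.1
    have h2 : sp2Matrix a * quatΩ = quatΩ * (sp2Matrix a).map conj := a.2
    generalize sp2Matrix a = A at *
    have c0 : A 0 0 = u := by simpa using (congrFun hu 0).symm
    have c1 : A 1 0 = 0 := by simpa using (congrFun hu 1).symm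
    have c2 : A 2 0 = 0 := by simpa using (congrFun hu 2).symm
    have c3 : A 3 0 = 0 := by simpa using (congrFun hu 3).symm
    have e : ∀ a b, (Aᴴ * A) a b = (1 : Matrix _ _ ℂ) a b := fun a b => congrFun (congrFun h1 a) b
    have f : ∀ a b, (A * quatΩ) a b = (quatΩ * A.map conj) a b :=
      fun a b => congrFun (congrFun h2 a) b
    have e00 := e 0 0
    have e02 := e 0 2
    have e03 := e 0 3
    have e22 := e 2 2
    have f00 := f 0 0
    have f10 := f 1 0
    have f20 := f 2 0
    have f30 := f 3 0
    have f22 := f 2 2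
    have f32 := f 3 2
    have f02 := f 0 2
    have f12 := f 1 2
    simp [Matrix.mul_apply, Fin.sum_univ_succ, c0, c1, c2, c3] at e00 e02 e03 e22
    simp [Matrix.mul_apply, Fin.sum_univ_succ, quatΩ, c0, c1, c2, c3] at f00 f10 f20 f30
    simp [Matrix.mul_apply, Fin.sum_univ_succ, quatΩ] at f22 f32 f02 f12
    have hu0 : u ≠ 0 := by rintro rfl; simp at e00
    have e02' : A 0 2 = 0 := by simpa [hu0] using e02
    have e03' : A 0 3 = 0 := by simpa [hu0] using e03
    simp [e02', e03'] at f02 f12 e22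
    have hun : ‖u‖ = 1 := by
      have := Complex.normSq_eq_conj_mul_self (z := u)
      rw [e00] at this
      have h3 : Complex.normSq u = 1 := by exact_mod_cast this
      rw [Complex.normSq_eq_norm_sq] at h3
      nlinarith [norm_nonneg u]
    have hdet : A 2 2 * conj (A 2 2) + A 3 2 * conj (A 3 2) = 1 := by
      rw [f02] at e22
      simp at e22
      linear_combination e22
    have hq : !![A 2 2, A 2 3; A 3 2, A 3 3] ∈ Matrix.specialUnitaryGroup (Fin 2) ℂ := by
      rw [Matrix.mem_specialUnitaryGroup_iff, Matrix.mem_unitaryGroup_iff']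
      constructor
      · ext a b
        fin_cases a <;> fin_cases b <;>
          simp [Matrix.mul_apply, Fin.sum_univ_succ, Matrix.star_apply, f22, f32]
        · linear_combination hdet
        · ring
        · ring
        · linear_combination hdet
      · rw [Matrix.det_fin_two]
        simp [f22, f32]
        linear_combination hdet
    refine ⟨(⟨u, by simpa [Submonoid.unitSphere] using hun⟩, ⟨_, hq⟩), ?_⟩
    ext a b
    fin_cases a <;> fin_cases b <;>
      simp [isotropyMatrix, c0, c1, c2, c3, e02', e03', f00, f10, f20, f30, f02, f12]
  · rintro ⟨x, rfl⟩
    obtain ⟨a, ha⟩ := isotropyMatrix_unitary x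
    refine ⟨a, (hs a).2 ⟨x.1, ?_⟩, ha⟩
    rw [ha, Matrix.mulVec_single_one]
    ext k
    fin_cases k <;> simp [isotropyMatrix]


/-! ### Orientation and Pfaffians -/

/-- The right side is `ω ∧ ω / 2` for the 2-form `ω(u, w) = u · j w`, and `pfaffianVec j` is the
vector dual to this 4-form. -/
lemma det_pfaffianVec {j : Matrix (Fin 5) (Fin 5) ℝ} (hj : jᵀ = -j) (u w v z : Fin 5 → ℝ) :
    Matrix.det (Matrix.of ![pfaffianVec j, u, w, v, z]) =
      (u ⬝ᵥ j *ᵥ w) * (v ⬝ᵥ j *ᵥ z) - (u ⬝ᵥ j *ᵥ v) * (w ⬝ᵥ j *ᵥ z) +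
        (u ⬝ᵥ j *ᵥ z) * (w ⬝ᵥ j *ᵥ v) := by
  have e : ∀ a b, j b a = -j a b := fun a b => congrFun (congrFun hj a) b
  have e0 : ∀ a, j a a = 0 := fun a => by linarith [e a a]
  have h : ∀ u w, u ⬝ᵥ j *ᵥ w = j 0 1 * (u 0 * w 1 - u 1 * w 0) + j 0 2 * (u 0 * w 2 - u 2 * w 0)
      + j 0 3 * (u 0 * w 3 - u 3 * w 0) + j 0 4 * (u 0 * w 4 - u 4 * w 0)
      + j 1 2 * (u 1 * w 2 - u 2 * w 1) + j 1 3 * (u 1 * w 3 - u 3 * w 1)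
      + j 1 4 * (u 1 * w 4 - u 4 * w 1) + j 2 3 * (u 2 * w 3 - u 3 * w 2)
      + j 2 4 * (u 2 * w 4 - u 4 * w 2) + j 3 4 * (u 3 * w 4 - u 4 * w 3) := by
    intro u w
    simp only [dotProduct, Matrix.mulVec, Fin.sum_univ_five]
    rw [e0, e0, e0, e0, e0, e 0 1, e 0 2, e 0 3, e 0 4, e 1 2, e 1 3, e 1 4, e 2 3, e 2 4, e 3 4]
    ring
  simp only [h]
  simp [Matrix.det_succ_row_zero, Fin.sum_univ_succ, Fin.succAbove, pfaffianVec]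
  ring

lemma dotProduct_mulVec_of_antisymm {j : Matrix (Fin 5) (Fin 5) ℝ} (hj : jᵀ = -j)
    (u v : Fin 5 → ℝ) : u ⬝ᵥ j *ᵥ v = -((j *ᵥ u) ⬝ᵥ v) := by
  rw [Matrix.dotProduct_mulVec, ← Matrix.mulVec_transpose, hj, Matrix.neg_mulVec, neg_dotProduct]

lemma mulVec_mulVec_of_sq {x : Fin 5 → ℝ} {j : Matrix (Fin 5) (Fin 5) ℝ}
    (hjj : j * j = -(1 - Matrix.vecMulVec x x)) (v : Fin 5 → ℝ) :
    j *ᵥ (j *ᵥ v) = (x ⬝ᵥ v) • x - v := by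
  rw [Matrix.mulVec_mulVec, hjj, Matrix.neg_mulVec, Matrix.sub_mulVec, Matrix.one_mulVec,
    Matrix.vecMulVec_mulVec]
  ext k; simp

section

variable {x : Fin 5 → ℝ} {j : Matrix (Fin 5) (Fin 5) ℝ}

lemma dotProduct_mulVec_self (hj : jᵀ = -j) (u : Fin 5 → ℝ) : u ⬝ᵥ j *ᵥ u = 0 := by
  have := dotProduct_mulVec_of_antisymm hj u u
  rw [dotProduct_comm (j *ᵥ u)] at this
  linarith

lemma dotProduct_mulVec_mulVec
    (hjj : j * j = -(1 - Matrix.vecMulVec x x)) (u v : Fin 5 → ℝ) :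
    u ⬝ᵥ j *ᵥ (j *ᵥ v) = (x ⬝ᵥ u) * (x ⬝ᵥ v) - u ⬝ᵥ v := by
  rw [mulVec_mulVec_of_sq hjj, dotProduct_sub, dotProduct_smul, smul_eq_mul, dotProduct_comm u x]
  ring

/-- Bessel's inequality for the pair `u, j u`. -/
lemma bessel_of_sq (hx : x ⬝ᵥ x = 1) (hj : jᵀ = -j) (hjx : j *ᵥ x = 0)
    (hjj : j * j = -(1 - Matrix.vecMulVec x x)) (u v : Fin 5 → ℝ) :
    (u ⬝ᵥ v - (x ⬝ᵥ u) * (x ⬝ᵥ v)) ^ 2 + (u ⬝ᵥ j *ᵥ v) ^ 2 ≤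
      (u ⬝ᵥ u - (x ⬝ᵥ u) ^ 2) * (v ⬝ᵥ v - (x ⬝ᵥ v) ^ 2) := by
  have hnn : ∀ w : Fin 5 → ℝ, 0 ≤ w ⬝ᵥ w := fun w =>
    Finset.sum_nonneg fun i _ => mul_self_nonneg (w i)
  set u' := u - (x ⬝ᵥ u) • x with hu'
  set v' := v - (x ⬝ᵥ v) • x with hv'
  set y := j *ᵥ u with hy
  have hyx : y ⬝ᵥ x = 0 := by
    have := dotProduct_mulVec_of_antisymm hj u x
    rw [hjx, dotProduct_zero] at this; linarith
  have hyu : y ⬝ᵥ u = 0 := by rw [dotProduct_comm]; exact dotProduct_mulVec_self hj u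
  have hyy : y ⬝ᵥ y = u ⬝ᵥ u - (x ⬝ᵥ u) ^ 2 := by
    have h1 := dotProduct_mulVec_of_antisymm hj u y
    have h2 := dotProduct_mulVec_mulVec hjj u u
    rw [← hy] at h1 h2
    linarith
  have hyv : y ⬝ᵥ v = -(u ⬝ᵥ j *ᵥ v) := by
    rw [dotProduct_mulVec_of_antisymm hj u v, neg_neg]
  have hxu' : x ⬝ᵥ u' = 0 := by rw [hu', dotProduct_sub, dotProduct_smul, hx]; simp
  set U := u ⬝ᵥ u - (x ⬝ᵥ u) ^ 2
  set V := v ⬝ᵥ v - (x ⬝ᵥ v) ^ 2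
  set A := u ⬝ᵥ v - (x ⬝ᵥ u) * (x ⬝ᵥ v)
  set B := u ⬝ᵥ j *ᵥ v
  have huu : u' ⬝ᵥ u' = U := by
    simp only [hu', sub_dotProduct, dotProduct_sub, smul_dotProduct, dotProduct_smul, hx,
      smul_eq_mul, dotProduct_comm u x, U]; ring
  have hvv : v' ⬝ᵥ v' = V := by
    simp only [hv', sub_dotProduct, dotProduct_sub, smul_dotProduct, dotProduct_smul, hx,
      smul_eq_mul, dotProduct_comm v x, V]; ring
  have huv : u' ⬝ᵥ v' = A := by
    simp only [hu', hv', sub_dotProduct, dotProduct_sub, smul_dotProduct, dotProduct_smul, hx,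
      smul_eq_mul, dotProduct_comm u x, A]; ring
  have hyu' : y ⬝ᵥ u' = 0 := by
    rw [hu', dotProduct_sub, dotProduct_smul, hyx, hyu]; simp
  have hyv' : y ⬝ᵥ v' = -B := by
    rw [hv', dotProduct_sub, dotProduct_smul, hyx, hyv]; simp
  have hU : 0 ≤ U := huu ▸ hnn u'
  rcases hU.eq_or_lt with h0 | h0
  · have h1 : u' = 0 := dotProduct_self_eq_zero.1 (huu.trans h0.symm)
    have h2 : y = 0 := dotProduct_self_eq_zero.1 (hyy.trans h0.symm)
    rw [h1, zero_dotProduct] at huv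
    rw [h2, zero_dotProduct] at hyv'
    rw [← huv, ← h0]
    nlinarith
  -- This vector is `U` times the component of `v'` orthogonal to `u'` and `y`, which are orthogonal
  -- and both of squared norm `U`.
  · have hw := hnn (U • v' - A • u' + B • y)
    simp only [add_dotProduct, sub_dotProduct, dotProduct_add, dotProduct_sub, smul_dotProduct,
      dotProduct_smul, smul_eq_mul, huu, hvv, huv, hyu', hyv', dotProduct_comm v' u',
      dotProduct_comm v' y, dotProduct_comm u' y, hyy] at hw
    have : 0 ≤ U * (U * V - A ^ 2 - B ^ 2) := by
      refine hw.trans_eq ?_; ring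
    linarith [nonneg_of_mul_nonneg_right this h0]

/-- The determinant is exactly the defect in Bessel's inequality `bessel_of_sq`; so the orientation
condition holds as soon as `pfaffianVec j = x`. -/
lemma det_pfaffianVec_structure (hj : jᵀ = -j) (hjx : j *ᵥ x = 0)
    (hjj : j * j = -(1 - Matrix.vecMulVec x x)) (u v : Fin 5 → ℝ) :
    Matrix.det (Matrix.of ![pfaffianVec j, u, j *ᵥ u, v, j *ᵥ v]) =
      (u ⬝ᵥ u - (x ⬝ᵥ u) ^ 2) * (v ⬝ᵥ v - (x ⬝ᵥ v) ^ 2) -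
        (u ⬝ᵥ v - (x ⬝ᵥ u) * (x ⬝ᵥ v)) ^ 2 - (u ⬝ᵥ j *ᵥ v) ^ 2 := by
  have h3 : (j *ᵥ u) ⬝ᵥ j *ᵥ v = u ⬝ᵥ v - (x ⬝ᵥ u) * (x ⬝ᵥ v) := by
    have h1 := dotProduct_mulVec_of_antisymm hj u (j *ᵥ v)
    have h2 := dotProduct_mulVec_mulVec hjj u v
    linarith
  have h4 : x ⬝ᵥ j *ᵥ u = 0 := by
    rw [dotProduct_mulVec_of_antisymm hj, hjx, zero_dotProduct, neg_zero]
  have h6 : (j *ᵥ u) ⬝ᵥ j *ᵥ (j *ᵥ v) = u ⬝ᵥ j *ᵥ v := by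
    rw [dotProduct_mulVec_mulVec hjj, h4, dotProduct_mulVec_of_antisymm hj u v]; ring
  rw [det_pfaffianVec hj, h6, h3, dotProduct_mulVec_mulVec hjj, dotProduct_mulVec_mulVec hjj,
    dotProduct_mulVec_mulVec hjj]
  ring

end

lemma twistorJ_transpose (p : CP3) : (twistorJ p)ᵀ = -twistorJ p := twistorJV_transpose _

lemma hopf_dotProduct_self (p : CP3) : hopf p ⬝ᵥ hopf p = 1 := by
  rw [hopf_eq]; exact hopfV_dotProduct_self p.rep_nonzero

lemma twistorJ_mulVec_hopf (p : CP3) : twistorJ p *ᵥ hopf p = 0 := by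
  rw [hopf_eq]; exact twistorJV_mulVec_hopfV _

lemma twistorJ_mul_self (p : CP3) :
    twistorJ p * twistorJ p = -(1 - Matrix.vecMulVec (hopf p) (hopf p)) := by
  rw [hopf_eq]; exact twistorJV_mul_self p.rep_nonzero

lemma pfaffianVec_twistorJ (p : CP3) : pfaffianVec (twistorJ p) = hopf p := by
  rw [hopf_eq]; exact pfaffianVec_twistorJV p.rep_nonzero

lemma twistorJ_mem_twistorSpace (p : CP3) : (hopf p, twistorJ p) ∈ twistorSpaceS4 := by
  refine ⟨hopf_dotProduct_self p, twistorJ_transpose p, twistorJ_mulVec_hopf p,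
    twistorJ_mul_self p, fun u v => ?_⟩
  have h := det_pfaffianVec_structure (twistorJ_transpose p) (twistorJ_mulVec_hopf p)
    (twistorJ_mul_self p) u v
  rw [pfaffianVec_twistorJ] at h
  have h2 := bessel_of_sq (hopf_dotProduct_self p) (twistorJ_transpose p)
    (twistorJ_mulVec_hopf p) (twistorJ_mul_self p) u v
  change 0 ≤ Matrix.det (Matrix.of ![hopf p, u, twistorJ p *ᵥ u, v, twistorJ p *ᵥ v])
  rw [h]
  linarith

/-! ### Bijectivity onto the twistor space -/

/-- The matrices `1`, `γ_k` and `γ_k γ_l` with `k < l` form a basis of the matrices of size 4 (`1 +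
5 + 10 = 16`), so the entries of the projector `v v* / |v|²` are linear combinations of `1`, `x` and
`j`. -/
lemma conj_mul_div_sqNorm_eq {v w : Fin 4 → ℂ} (h1 : hopfV v = hopfV w)
    (h2 : twistorJV v = twistorJV w) (hv : v ≠ 0) (hw : w ≠ 0) (a b : Fin 4) :
    (sqNorm v : ℂ)⁻¹ * (conj (v a) * v b) = (sqNorm w : ℂ)⁻¹ * (conj (w a) * w b) := by
  -- This is the trace of the projector, the coefficient along the identity matrix.
  have h3 : (sqNorm v)⁻¹ * sqNorm v = (sqNorm w)⁻¹ * sqNorm w := by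
    rw [inv_mul_cancel₀ (sqNorm_pos hv).ne', inv_mul_cancel₀ (sqNorm_pos hw).ne']
  have h1' := fun k => congrFun h1 k
  have h2' := fun k l => congrFun (congrFun h2 k) l
  simp only [hopfV_eq, div_eq_inv_mul] at h1'
  simp only [twistorJV_eq, Matrix.smul_apply, smul_eq_mul] at h2'
  have x0 := h1' 0
  have x1 := h1' 1
  have x2 := h1' 2
  have x3 := h1' 3
  have x4 := h1' 4
  have j01 := h2' 0 1
  have j02 := h2' 0 2
  have j03 := h2' 0 3
  have j04 := h2' 0 4
  have j12 := h2' 1 2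
  have j13 := h2' 1 3
  have j14 := h2' 1 4
  have j23 := h2' 2 3
  have j24 := h2' 2 4
  have j34 := h2' 3 4
  clear h1' h2'
  rw [← Complex.ofReal_inv, ← Complex.ofReal_inv]
  generalize e : (sqNorm v)⁻¹ = c at *
  generalize e' : (sqNorm w)⁻¹ = d at *
  rw [sqNorm_expand, sqNorm_expand] at h3
  simp [hopfNum, Complex.normSq_apply] at x0 x1 x2 x3 x4
  simp [twistorNumUpper] at j01 j02 j03 j04 j12 j13 j14 j23 j24 j34
  have hre : c * ((v a).re * (v b).re + (v a).im * (v b).im) =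
      d * ((w a).re * (w b).re + (w a).im * (w b).im) := by
    fin_cases a <;> fin_cases b <;> dsimp only [Fin.reduceFinMk, Fin.mk_one, Fin.zero_eta]
    · linear_combination (h3 + x4 + j01 + j23) / 4
    · linear_combination (j03 + j12) / 4
    · linear_combination (x0 + j14) / 4
    · linear_combination (x2 + j34) / 4
    · linear_combination (j03 + j12) / 4
    · linear_combination (h3 + x4 - j01 - j23) / 4
    · linear_combination (j34 - x2) / 4
    · linear_combination (x0 - j14) / 4
    · linear_combination (x0 + j14) / 4
    · linear_combination (j34 - x2) / 4
    · linear_combination (h3 - x4 - j01 + j23) / 4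
    · linear_combination (j12 - j03) / 4
    · linear_combination (x2 + j34) / 4
    · linear_combination (x0 - j14) / 4
    · linear_combination (j12 - j03) / 4
    · linear_combination (h3 - x4 + j01 - j23) / 4
  have him : c * ((v a).re * (v b).im - (v a).im * (v b).re) =
      d * ((w a).re * (w b).im - (w a).im * (w b).re) := by
    fin_cases a <;> fin_cases b <;> dsimp only [Fin.reduceFinMk, Fin.mk_one, Fin.zero_eta]
    · ring
    · linear_combination (j02 - j13) / 4
    · linear_combination (j04 - x1) / 4
    · linear_combination (j24 - x3) / 4
    · linear_combination -((j02 - j13) / 4)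
    · ring
    · linear_combination -(x3 + j24) / 4
    · linear_combination (j04 + x1) / 4
    · linear_combination -((j04 - x1) / 4)
    · linear_combination -(-(x3 + j24) / 4)
    · ring
    · linear_combination -(j02 + j13) / 4
    · linear_combination -((j24 - x3) / 4)
    · linear_combination -((j04 + x1) / 4)
    · linear_combination -(-(j02 + j13) / 4)
    · ring
  refine Complex.ext ?_ ?_
  · simp only [Complex.mul_re, Complex.mul_im, Complex.conj_re, Complex.conj_im, Complex.ofReal_re,
      Complex.ofReal_im]
    linear_combination hre
  · simp only [Complex.mul_re, Complex.mul_im, Complex.conj_re, Complex.conj_im, Complex.ofReal_re,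
      Complex.ofReal_im]
    linear_combination him

lemma proj_eq_of_twistor_eq {v w : Fin 4 → ℂ} (h1 : hopfV v = hopfV w)
    (h2 : twistorJV v = twistorJV w) (hv : v ≠ 0) (hw : w ≠ 0) : CP3.proj v = CP3.proj w := by
  obtain ⟨a, ha⟩ := Function.ne_iff.1 hv
  have ha : v a ≠ 0 := ha
  have hs : (sqNorm v : ℂ) ≠ 0 := by exact_mod_cast (sqNorm_pos hv).ne'
  rw [CP3.proj_eq_iff hv hw]
  refine ⟨sqNorm v * (sqNorm w : ℂ)⁻¹ * conj (w a) * (conj (v a))⁻¹, ?_⟩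
  have hc : conj (v a) ≠ 0 := by simpa using ha
  ext b
  have h := conj_mul_div_sqNorm_eq h1 h2 hv hw a b
  have h3 : v b = sqNorm v * (conj (v a))⁻¹ * ((sqNorm v : ℂ)⁻¹ * (conj (v a) * v b)) := by
    field_simp
  rw [h3, h, Pi.smul_apply, smul_eq_mul]
  ring

lemma twistor_injective : Function.Injective (fun p => (hopf p, twistorJ p)) := by
  intro p q h
  have h1 : hopf p = hopf q := congrArg Prod.fst h
  have h2 : twistorJ p = twistorJ q := congrArg Prod.snd h
  obtain ⟨v, hv, rfl⟩ := p.exists_proj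
  obtain ⟨w, hw, rfl⟩ := q.exists_proj
  rw [hopf_proj hv, hopf_proj hw] at h1
  rw [twistorJ_proj hv, twistorJ_proj hw] at h2
  exact proj_eq_of_twistor_eq h1 h2 hv hw

lemma exists_hopf_eq {x : Fin 5 → ℝ} (hx : x ⬝ᵥ x = 1) : ∃ p, hopf p = x := by
  have hx' : x 0 ^ 2 + x 1 ^ 2 + x 2 ^ 2 + x 3 ^ 2 + x 4 ^ 2 = 1 := by
    simp [dotProduct, Fin.sum_univ_five] at hx; linarith
  by_cases h : x 4 = -1
  · have hv : (Pi.single 2 1 : Fin 4 → ℂ) ≠ 0 := by simp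
    have h0 : x 0 = 0 := by nlinarith [sq_nonneg (x 0), sq_nonneg (x 1), sq_nonneg (x 2), sq_nonneg (x 3)]
    have h1 : x 1 = 0 := by nlinarith [sq_nonneg (x 0), sq_nonneg (x 1), sq_nonneg (x 2), sq_nonneg (x 3)]
    have h2 : x 2 = 0 := by nlinarith [sq_nonneg (x 0), sq_nonneg (x 1), sq_nonneg (x 2), sq_nonneg (x 3)]
    have h3 : x 3 = 0 := by nlinarith [sq_nonneg (x 0), sq_nonneg (x 1), sq_nonneg (x 2), sq_nonneg (x 3)]
    refine ⟨CP3.proj (Pi.single 2 1), ?_⟩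
    rw [hopf_proj hv]
    ext k
    rw [hopfV_eq, sqNorm_expand]
    fin_cases k <;> simp [hopfNum, h, h0, h1, h2, h3]
  · have h' : 1 + x 4 ≠ 0 := fun h2 => h (by linarith)
    -- Inverse stereographic projection from the point `x₄ = -1`, in the section `v₁ = 0`, `v₀`
    -- real, of the fibration.
    set v : Fin 4 → ℂ := ![((1 + x 4 : ℝ) : ℂ), 0, ⟨x 0, -x 1⟩, ⟨x 2, -x 3⟩] with hv'
    have hv : v ≠ 0 := fun h2 => h' (by
      have := congrFun h2 0
      simp only [hv', Matrix.cons_val_zero, Pi.zero_apply] at this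
      exact_mod_cast this)
    have hN : sqNorm v = 2 * (1 + x 4) := by
      rw [sqNorm_expand]; simp [hv']; linarith
    refine ⟨CP3.proj v, ?_⟩
    rw [hopf_proj hv]
    ext k
    rw [hopfV_eq, hN, div_eq_iff (by simpa using h')]
    fin_cases k <;> simp [hopfNum, hv', Complex.normSq_apply] <;> linarith

lemma hopf_basePoint : hopf CP3.basePoint = Pi.single 4 1 := by
  rw [CP3.basePoint_eq, hopf_proj (by simp)]
  ext k
  rw [hopfV_eq, sqNorm_expand]
  fin_cases k <;> simp [hopfNum]

/-- The complex structure at the base point. -/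
def baseJ : Matrix (Fin 5) (Fin 5) ℝ :=
  !![0, 1, 0, 0, 0; -1, 0, 0, 0, 0; 0, 0, 0, 1, 0; 0, 0, -1, 0, 0; 0, 0, 0, 0, 0]

lemma twistorJ_basePoint : twistorJ CP3.basePoint = baseJ := by
  rw [CP3.basePoint_eq, twistorJ_proj (by simp), twistorJV_eq, sqNorm_expand]
  ext k l
  fin_cases k <;> fin_cases l <;> simp [twistorNumUpper, baseJ]

lemma det_of_mulVec (R : Matrix (Fin 5) (Fin 5) ℝ) (a b c d e : Fin 5 → ℝ) :
    Matrix.det (Matrix.of ![R *ᵥ a, R *ᵥ b, R *ᵥ c, R *ᵥ d, R *ᵥ e]) =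
      Matrix.det (Matrix.of ![a, b, c, d, e]) * R.det := by
  rw [← Matrix.det_transpose R, ← Matrix.det_mul]
  congr 1
  ext i k
  fin_cases i <;> simp [Matrix.mul_apply, Matrix.mulVec, dotProduct, mul_comm]

lemma twistorSpace_sign {x : Fin 5 → ℝ} {j : Matrix (Fin 5) (Fin 5) ℝ} {R : Matrix (Fin 5) (Fin 5) ℝ}
    (hR : Rᵀ * R = 1) (u v : Fin 5 → ℝ) :
    Matrix.det (Matrix.of ![R *ᵥ x, R *ᵥ u, (R * j * Rᵀ) *ᵥ (R *ᵥ u), R *ᵥ v,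
      (R * j * Rᵀ) *ᵥ (R *ᵥ v)]) = Matrix.det (Matrix.of ![x, u, j *ᵥ u, v, j *ᵥ v]) * R.det := by
  have h : ∀ u, (R * j * Rᵀ) *ᵥ (R *ᵥ u) = R *ᵥ (j *ᵥ u) := by
    intro u
    rw [Matrix.mulVec_mulVec, Matrix.mul_assoc, hR, Matrix.mul_one, Matrix.mulVec_mulVec]
  rw [h, h, det_of_mulVec]

/-- An orthogonal matrix has determinant `±1`. The orientation condition holds at the base point and
at its image, and its determinant at the base point for the vectors `e₀`, `e₂` is `1`, so the sign
is `+`. -/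
lemma det_spRotation_pos (a : Sp2) : 0 < (spRotation a).det := by
  have h1 := (twistorJ_mem_twistorSpace (a • CP3.basePoint)).2.2.2.2
    (spRotation a *ᵥ Pi.single 0 1) (spRotation a *ᵥ Pi.single 2 1)
  simp only [hopf_smul, twistorJ_smul] at h1
  rw [twistorSpace_sign (transpose_mul_spRotation a)] at h1
  have h2 := det_pfaffianVec_structure (twistorJ_transpose CP3.basePoint)
    (twistorJ_mulVec_hopf CP3.basePoint) (twistorJ_mul_self CP3.basePoint)
    (Pi.single 0 1) (Pi.single 2 1)
  rw [pfaffianVec_twistorJ] at h2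
  rw [h2, hopf_basePoint, twistorJ_basePoint] at h1
  have h3 : (spRotation a).det * (spRotation a).det = 1 := by
    have := congrArg Matrix.det (transpose_mul_spRotation a)
    rwa [Matrix.det_mul, Matrix.det_transpose, Matrix.det_one] at this
  have h4 : 0 ≤ (spRotation a).det := by
    simpa [baseJ, Pi.single_apply] using h1
  nlinarith

/-- An antisymmetric matrix of size 4 with square `-1` is self-dual or anti-self-dual, according to
the sign of its Pfaffian `a f - b e + c d = ±1`. -/
lemma antisymm_sq_eq_neg_one {a b c d e f : ℝ} (q00 : a * a + b * b + c * c = 1)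
    (q11 : a * a + d * d + e * e = 1) (q22 : b * b + d * d + f * f = 1)
    (q33 : c * c + e * e + f * f = 1)
    (q12 : a * b + e * f = 0)
    (q13 : a * c = d * f) (q23 : b * c + d * e = 0) :
    f = (a * f - b * e + c * d) * a ∧ e = -((a * f - b * e + c * d) * b) ∧
      d = (a * f - b * e + c * d) * c ∧
      (a * f - b * e + c * d) * (a * f - b * e + c * d) = 1 := by
  have h1 : f = (a * f - b * e + c * d) * a := by
    linear_combination (-f) * q11 + e * q12 - d * q13
  have h2 : e = -((a * f - b * e + c * d) * b) := by
    linear_combination (-e) * q22 + f * q12 + d * q23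
  have h3 : d = (a * f - b * e + c * d) * c := by
    linear_combination (-d) * q33 - f * q13 + e * q23
  refine ⟨h1, h2, h3, ?_⟩
  generalize a * f - b * e + c * d = P at *
  have q : d * d + e * e + f * f = 1 := by linarith
  rw [h1, h2, h3] at q
  linear_combination q - P * P * q00

/-- The entries of the complex structures above the base point. -/
lemma twistorSpace_base_entries {j : Matrix (Fin 5) (Fin 5) ℝ}
    (h : ((Pi.single 4 1 : Fin 5 → ℝ), j) ∈ twistorSpaceS4) :
    j 2 3 = j 0 1 ∧ j 1 3 = -j 0 2 ∧ j 1 2 = j 0 3 ∧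
      j 0 1 * j 0 1 + j 0 2 * j 0 2 + j 0 3 * j 0 3 = 1 := by
  obtain ⟨hx, hj, hjx, hjj, hdet⟩ := h
  simp only at hx hj hjx hjj hdet
  have e : ∀ a b, j b a = -j a b := fun a b => congrFun (congrFun hj a) b
  have e0 : ∀ a, j a a = 0 := fun a => by linarith [e a a]
  have e4 : ∀ a, j a 4 = 0 := fun a => by simpa using congrFun hjx a
  have hp : pfaffianVec j = (j 0 1 * j 2 3 - j 0 2 * j 1 3 + j 0 3 * j 1 2) •
      (Pi.single 4 1 : Fin 5 → ℝ) := by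
    ext k; fin_cases k <;> simp [pfaffianVec, e4]
  have q : ∀ a b, (j * j) a b = (-(1 - Matrix.vecMulVec (Pi.single 4 1 : Fin 5 → ℝ)
      (Pi.single 4 1))) a b := fun a b => congrFun (congrFun hjj a) b
  have q00 := q 0 0
  have q11 := q 1 1
  have q22 := q 2 2
  have q33 := q 3 3
  have q02 := q 0 2
  have q03 := q 0 3
  have q12 := q 1 2
  have q13 := q 1 3
  have q23 := q 2 3
  have s10 := e 0 1
  have s20 := e 0 2
  have s30 := e 0 3
  have s21 := e 1 2
  have s31 := e 1 3
  have s32 := e 2 3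
  simp [Matrix.mul_apply, Fin.sum_univ_five, Matrix.vecMulVec_apply, e0, e4, s10, s20, s30, s21,
    s31, s32] at q00 q11 q22 q33
  simp [Matrix.mul_apply, Fin.sum_univ_five, Matrix.vecMulVec_apply, e0, e4, s32]
    at q02 q03
  simp [Matrix.mul_apply, Fin.sum_univ_five, Matrix.vecMulVec_apply, e0, e4, s10, s20, s21, s32]
    at q12 q13 q23
  obtain ⟨h23, h13, h12, hP2⟩ := antisymm_sq_eq_neg_one (a := j 0 1) (b := j 0 2) (c := j 0 3)
    (d := j 1 2) (e := j 1 3) (f := j 2 3) (by linarith) (by linarith) (by linarith) (by linarith)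
    (by linarith) (by linarith) (by linarith)
  set P := j 0 1 * j 2 3 - j 0 2 * j 1 3 + j 0 3 * j 1 2 with hP
  have hP0 : 0 ≤ P := by
    -- With a negative Pfaffian, the orientation condition on `(e₀, e_k)` gives `1 ≤ j₀ₖ²` for `k =
    -- 1, 2, 3`, whereas the sum of these three squares is `1`.
    by_contra! hneg
    have hd : ∀ v : Fin 5 → ℝ, Matrix.det (Matrix.of ![Pi.single 4 1, Pi.single 0 1,
        j *ᵥ Pi.single 0 1, v, j *ᵥ v]) * P = ((Pi.single 0 1 : Fin 5 → ℝ) ⬝ᵥ Pi.single 0 1 -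
          ((Pi.single 4 1 : Fin 5 → ℝ) ⬝ᵥ Pi.single 0 1) ^ 2) *
          (v ⬝ᵥ v - ((Pi.single 4 1 : Fin 5 → ℝ) ⬝ᵥ v) ^ 2) -
        ((Pi.single 0 1 : Fin 5 → ℝ) ⬝ᵥ v - ((Pi.single 4 1 : Fin 5 → ℝ) ⬝ᵥ Pi.single 0 1) *
          ((Pi.single 4 1 : Fin 5 → ℝ) ⬝ᵥ v)) ^ 2 - ((Pi.single 0 1 : Fin 5 → ℝ) ⬝ᵥ j *ᵥ v) ^ 2 := by
      intro v
      rw [← det_pfaffianVec_structure hj hjx hjj, hp]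
      have := Matrix.det_updateRow_smul (Matrix.of ![Pi.single 4 1, Pi.single 0 1,
        j *ᵥ Pi.single 0 1, v, j *ᵥ v]) 0 P (Pi.single 4 1)
      rw [mul_comm]
      refine Eq.trans ?_ (this.symm.trans ?_)
      · congr 2
        ext i k
        fin_cases i <;> simp [Matrix.updateRow_apply]
      · congr 1
        ext i k
        fin_cases i <;> simp [Matrix.updateRow_apply]
    have hn : ∀ v : Fin 5 → ℝ, Matrix.det (Matrix.of ![Pi.single 4 1, Pi.single 0 1,
        j *ᵥ Pi.single 0 1, v, j *ᵥ v]) * P ≤ 0 :=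
      fun v => mul_nonpos_of_nonneg_of_nonpos (hdet _ v) hneg.le
    have n1 := hn (Pi.single 1 1)
    have n2 := hn (Pi.single 2 1)
    have n3 := hn (Pi.single 3 1)
    rw [hd] at n1 n2 n3
    simp at n1 n2 n3
    have n1 := (one_le_sq_iff_one_le_abs _).2 n1
    have n2 := (one_le_sq_iff_one_le_abs _).2 n2
    have n3 := (one_le_sq_iff_one_le_abs _).2 n3
    linarith
  have hP1 : P = 1 := by nlinarith
  rw [hP1] at h23 h13 h12
  exact ⟨by linarith, by linarith, by linarith, by linarith⟩

/-- The fibre of the twistor space above the base point. -/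
lemma exists_twistorJ_eq_of_base {j : Matrix (Fin 5) (Fin 5) ℝ}
    (h : ((Pi.single 4 1 : Fin 5 → ℝ), j) ∈ twistorSpaceS4) :
    ∃ p, hopf p = Pi.single 4 1 ∧ twistorJ p = j := by
  obtain ⟨h23, h13, h12, hs⟩ := twistorSpace_base_entries h
  have e : ∀ a b, j b a = -j a b := fun a b => congrFun (congrFun h.2.1 a) b
  have e0 : ∀ a, j a a = 0 := fun a => by linarith [e a a]
  have e4 : ∀ a, j a 4 = 0 := fun a => by simpa using congrFun h.2.2.1 a
  have e4' : ∀ a, j 4 a = 0 := fun a => by rw [e a 4, e4, neg_zero]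
  have s10 := e 0 1
  have s20 := e 0 2
  have s30 := e 0 3
  have s21 := e 1 2
  have s31 := e 1 3
  have s32 := e 2 3
  by_cases ha : j 0 1 = -1
  · have hb : j 0 2 = 0 := by nlinarith [sq_nonneg (j 0 2), sq_nonneg (j 0 3)]
    have hc : j 0 3 = 0 := by nlinarith [sq_nonneg (j 0 2), sq_nonneg (j 0 3)]
    have hv : (Pi.single 1 1 : Fin 4 → ℂ) ≠ 0 := by simp
    refine ⟨CP3.proj (Pi.single 1 1), ?_, ?_⟩
    · rw [hopf_proj hv]
      ext k
      rw [hopfV_eq, sqNorm_expand]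
      fin_cases k <;> simp [hopfNum]
    · rw [twistorJ_proj hv, twistorJV_eq, sqNorm_expand]
      ext k l
      fin_cases k <;> fin_cases l <;> simp [twistorNumUpper, e0, e4, s10, s20, s30, s21, s31, s32,
        e4', ha, hb, hc, h23, h13, h12]
  · have h' : 1 + j 0 1 ≠ 0 := fun h2 => ha (by linarith)
    -- Inverse stereographic projection of the fibre sphere with coordinates `(j₀₁, j₀₂, j₀₃)` from
    -- the point `j₀₁ = -1`.
    set v : Fin 4 → ℂ := ![((1 + j 0 1 : ℝ) : ℂ), ⟨j 0 3, j 0 2⟩, 0, 0] with hv'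
    have hv : v ≠ 0 := fun h2 => h' (by
      have := congrFun h2 0
      simp only [hv', Matrix.cons_val_zero, Pi.zero_apply] at this
      exact_mod_cast this)
    have hN : sqNorm v = 2 * (1 + j 0 1) := by
      rw [sqNorm_expand]; simp [hv']; linarith
    refine ⟨CP3.proj v, ?_, ?_⟩
    · rw [hopf_proj hv]
      ext k
      rw [hopfV_eq, div_eq_iff (sqNorm_pos hv).ne', sqNorm_expand]
      fin_cases k <;> simp [hopfNum, hv', Complex.normSq_apply]
      ring
    · rw [twistorJ_proj hv, twistorJV_eq, hN]
      ext k l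
      rw [Matrix.smul_apply, smul_eq_mul, inv_mul_eq_iff_eq_mul₀ (by simpa using h')]
      fin_cases k <;> fin_cases l <;> simp [twistorNumUpper, hv', e0, e4, s10, s20, s30, s21, s31,
        s32, e4', h23, h13, h12] <;> linarith

/-- For surjectivity, a rotation coming from `Sp(2)` carries the fibre over `x` to the fibre over
the base point; its positive determinant preserves the orientation condition. -/
lemma twistor_bijOn : Set.BijOn (fun p => (hopf p, twistorJ p)) Set.univ twistorSpaceS4 := by
  refine ⟨fun p _ => twistorJ_mem_twistorSpace p, twistor_injective.injOn, ?_⟩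
  rintro ⟨x, j⟩ hxj
  obtain ⟨p, hp : hopf p = x⟩ := exists_hopf_eq hxj.1
  obtain ⟨a, rfl⟩ := exists_smul_basePoint_eq p
  rw [hopf_smul, hopf_basePoint] at hp
  set R := spRotation a with hR
  have hR1 : R * Rᵀ = 1 := spRotation_mul_transpose a
  have hR2 : Rᵀ * R = 1 := transpose_mul_spRotation a
  have hp' : Rᵀ *ᵥ x = Pi.single 4 1 := by
    rw [← hp, Matrix.mulVec_mulVec, hR2, Matrix.one_mulVec]
  obtain ⟨hx, hj, hjx, hjj, hdet⟩ := hxj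
  simp only at hx hj hjx hjj hdet
  have hmem : ((Pi.single 4 1 : Fin 5 → ℝ), Rᵀ * j * R) ∈ twistorSpaceS4 := by
    refine ⟨by simp, ?_, ?_, ?_, fun u v => ?_⟩
    · simp only [Matrix.transpose_mul, Matrix.transpose_transpose, hj]
      simp [Matrix.mul_assoc]
    · simp only
      rw [← Matrix.mulVec_mulVec, hp, ← Matrix.mulVec_mulVec, hjx, Matrix.mulVec_zero]
    · simp only
      calc Rᵀ * j * R * (Rᵀ * j * R) = Rᵀ * j * (R * Rᵀ) * j * R := by simp only [Matrix.mul_assoc]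
        _ = Rᵀ * (j * j) * R := by rw [hR1, Matrix.mul_one]; simp only [Matrix.mul_assoc]
        _ = _ := by
          rw [hjj, ← hp', Matrix.mul_neg, Matrix.neg_mul, Matrix.mul_sub, Matrix.sub_mul,
            Matrix.mul_one, hR2, Matrix.mul_vecMulVec, Matrix.vecMulVec_mul,
            ← Matrix.mulVec_transpose]
    · simp only
      have h1 := twistorSpace_sign (x := Pi.single 4 1) (j := Rᵀ * j * R) hR2 u v
      have h2 : R * (Rᵀ * j * R) * Rᵀ = j := by
        calc _ = (R * Rᵀ) * j * (R * Rᵀ) := by simp only [Matrix.mul_assoc]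
          _ = j := by rw [hR1, Matrix.one_mul, Matrix.mul_one]
      rw [h2, hp] at h1
      have h3 := hdet (R *ᵥ u) (R *ᵥ v)
      rw [h1] at h3
      exact nonneg_of_mul_nonneg_left h3 (det_spRotation_pos a)
  obtain ⟨q, hq1, hq2⟩ := exists_twistorJ_eq_of_base hmem
  refine ⟨a • q, Set.mem_univ _, ?_⟩
  simp only
  rw [hopf_smul, twistorJ_smul, hq1, hq2, ← hR, hp]
  congr 1
  calc _ = (R * Rᵀ) * j * (R * Rᵀ) := by simp only [Matrix.mul_assoc]
    _ = j := by rw [hR1, Matrix.one_mul, Matrix.mul_one]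


/-! ### Smoothness and equivariance of the differentials -/

lemma contDiff_hform (X : Matrix (Fin 4) (Fin 4) ℂ) : ContDiff ℝ ∞ (hform X) := by
  have h : hform X = fun v => ∑ a, conj (v a) * ∑ b, X a b * v b := by
    ext v; simp [hform, dotProduct, Matrix.mulVec]
  rw [h]
  refine ContDiff.sum fun a _ => ContDiff.mul ?_ (ContDiff.sum fun b _ =>
    contDiff_const.mul (contDiff_apply ℝ ℂ b))
  exact Complex.conjCLE.contDiff.comp (contDiff_apply ℝ ℂ a)

lemma contDiff_sqNorm : ContDiff ℝ ∞ sqNorm := by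
  have h : sqNorm = fun v => (hform 1 v).re := by
    ext v
    rw [hform, Matrix.one_mulVec, ← sqNorm_eq, Complex.ofReal_re]
  rw [h]
  exact Complex.reCLM.contDiff.comp (contDiff_hform 1)

lemma contDiffAt_hopfV {v : Fin 4 → ℂ} (hv : v ≠ 0) (k : Fin 5) :
    ContDiffAt ℝ ∞ (fun w => hopfV w k) v :=
  (Complex.reCLM.contDiff.comp (contDiff_hform _)).contDiffAt.div contDiff_sqNorm.contDiffAt
    (sqNorm_pos hv).ne'

lemma contDiffAt_twistorJV {v : Fin 4 → ℂ} (hv : v ≠ 0) (k l : Fin 5) :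
    ContDiffAt ℝ ∞ (fun w => twistorJV w k l) v :=
  (Complex.imCLM.contDiff.comp (contDiff_hform _)).neg.contDiffAt.div contDiff_sqNorm.contDiffAt
    (sqNorm_pos hv).ne'

lemma contMDiff_hopf_apply (k : Fin 5) :
    ContMDiff 𝓘(ℝ, Fin 3 → ℂ) 𝓘(ℝ, ℝ) ∞ (fun p => hopf p k) := by
  refine CP3.contMDiff_of_comp_proj fun v hv => (contDiffAt_hopfV hv k).congr_of_eventuallyEq ?_
  filter_upwards [isOpen_ne.mem_nhds hv] with w hw
  rw [hopf_proj hw]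

lemma contMDiff_hopf : ContMDiff 𝓘(ℝ, Fin 3 → ℂ) 𝓘(ℝ, Fin 5 → ℝ) ∞ hopf := by
  refine CP3.contMDiff_of_comp_proj fun v hv => contDiffAt_pi.2 fun k =>
    (contDiffAt_hopfV hv k).congr_of_eventuallyEq ?_
  filter_upwards [isOpen_ne.mem_nhds hv] with w hw
  rw [hopf_proj hw]

lemma contMDiff_twistorJ (k l : Fin 5) :
    ContMDiff 𝓘(ℝ, Fin 3 → ℂ) 𝓘(ℝ, ℝ) ∞ (fun p => twistorJ p k l) := by
  refine CP3.contMDiff_of_comp_proj fun v hv =>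
    (contDiffAt_twistorJV hv k l).congr_of_eventuallyEq ?_
  filter_upwards [isOpen_ne.mem_nhds hv] with w hw
  rw [twistorJ_proj hw]

lemma dHopf_apply (p : CP3) (u : TangentSpace 𝓘(ℝ, Fin 3 → ℂ) p) (k : Fin 5) :
    dHopf p u k = mvfderiv 𝓘(ℝ, Fin 3 → ℂ) (fun q => hopf q k) p u := by
  have h1 := ((contMDiff_hopf p).mdifferentiableAt (by simp)).hasMFDerivAt
  have h2 := (ContinuousLinearMap.proj (R := ℝ) (φ := fun _ : Fin 5 => ℝ) k).hasMFDerivAt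
    (x := hopf p)
  exact (DFunLike.congr_fun (HasMFDerivAt.comp p h2 h1).mfderiv u).symm

lemma mvfderiv_linearCombination {κ : Type*} [Fintype κ] (c : κ → ℝ) {f : κ → CP3 → ℝ} {p : CP3}
    (hf : ∀ i, ContMDiff 𝓘(ℝ, Fin 3 → ℂ) 𝓘(ℝ, ℝ) ∞ (f i)) (u : TangentSpace 𝓘(ℝ, Fin 3 → ℂ) p) :
    mvfderiv 𝓘(ℝ, Fin 3 → ℂ) (fun q => ∑ i, c i * f i q) p u =
      ∑ i, c i * mvfderiv 𝓘(ℝ, Fin 3 → ℂ) (f i) p u := by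
  rw [mvfderiv_sum (f := fun i q => c i * f i q) Finset.univ (fun i =>
    ((contMDiff_const.mul (hf i)) p).mdifferentiableAt (by simp))]
  exact Finset.sum_congr rfl fun i _ =>
    mvfderiv_const_mul_apply _ ((hf i p).mdifferentiableAt (by simp)) u

section Action

variable (a : Sp2) (p : CP3) (u : TangentSpace 𝓘(ℝ, Fin 3 → ℂ) p)

/-- The differential of the action of an element of `Sp(2)`. -/
def dAct : TangentSpace 𝓘(ℝ, Fin 3 → ℂ) (a • p) :=
  mfderiv 𝓘(ℝ, Fin 3 → ℂ) 𝓘(ℝ, Fin 3 → ℂ) (fun y : CP3 => a • y) p u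

lemma mvfderiv_dAct {f : CP3 → ℝ} (hf : ContMDiff 𝓘(ℝ, Fin 3 → ℂ) 𝓘(ℝ, ℝ) ∞ f) :
    mvfderiv 𝓘(ℝ, Fin 3 → ℂ) f (a • p) (dAct a p u) =
      mvfderiv 𝓘(ℝ, Fin 3 → ℂ) (fun q => f (a • q)) p u :=
  (mvfderiv_comp_apply (I := 𝓘(ℝ, Fin 3 → ℂ)) (I' := 𝓘(ℝ, Fin 3 → ℂ))
    (g := f) (f := fun y : CP3 => a • y) p ((hf _).mdifferentiableAt (by simp))
    ((CP3.contMDiff_smul a p).mdifferentiableAt (by simp)) u).symm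

lemma dHopf_dAct : dHopf (a • p) (dAct a p u) = spRotation a *ᵥ dHopf p u := by
  ext k
  rw [dHopf_apply, mvfderiv_dAct a p u (contMDiff_hopf_apply k)]
  have h : (fun q => hopf (a • q) k) = fun q => ∑ m, spRotation a k m * hopf q m := by
    ext q; rw [hopf_smul]; rfl
  rw [h, mvfderiv_linearCombination (fun m => spRotation a k m) contMDiff_hopf_apply]
  simp only [Matrix.mulVec, dotProduct, dHopf_apply]

lemma dMatrix_dAct {m : CP3 → Matrix (Fin 5) (Fin 5) ℝ}
    (hm : ∀ k l, ContMDiff 𝓘(ℝ, Fin 3 → ℂ) 𝓘(ℝ, ℝ) ∞ (fun p => m p k l))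
    (ha : ∀ q, m (a • q) = spRotation a * m q * (spRotation a)ᵀ) :
    dMatrix m (a • p) (dAct a p u) = spRotation a * dMatrix m p u * (spRotation a)ᵀ := by
  ext k l
  change mvfderiv 𝓘(ℝ, Fin 3 → ℂ) (fun q => m q k l) (a • p) (dAct a p u) = _
  rw [mvfderiv_dAct a p u (hm k l)]
  have h : (fun q => m (a • q) k l) = fun q => ∑ n : Fin 5 × Fin 5,
      (spRotation a l n.1 * spRotation a k n.2) * m q n.2 n.1 := by
    ext q
    rw [ha, Fintype.sum_prod_type]
    simp only [Matrix.mul_apply, Matrix.transpose_apply, Finset.sum_mul]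
    refine Finset.sum_congr rfl fun n _ => Finset.sum_congr rfl fun m _ => ?_
    ring
  rw [h, mvfderiv_linearCombination (fun n : Fin 5 × Fin 5 => spRotation a l n.1 *
    spRotation a k n.2) (fun n => hm n.2 n.1), Fintype.sum_prod_type]
  simp only [Matrix.mul_apply, Matrix.transpose_apply, Finset.sum_mul]
  refine Finset.sum_congr rfl fun n _ => Finset.sum_congr rfl fun m _ => ?_
  simp only [dMatrix, Matrix.of_apply]
  ring

lemma mulI_dAct : CP3.mulI (a • p) (dAct a p u) = dAct a p (CP3.mulI p u) := by
  obtain ⟨v, hv, rfl⟩ := p.exists_proj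
  obtain ⟨w, rfl⟩ := CP3.dproj_surjective hv u
  rw [CP3.mulI_dproj hv]
  -- The relation `i u = u'` is handled as a `Prop`-valued function of a pair of tangent vectors,
  -- which avoids transporting vectors between equal points.
  have h := CP3.mfderiv_smul_dproj (κ := Bool)
    (fun q u => CP3.mulI q (u true) = u false) a hv (fun i => if i then w else Complex.I • w)
  refine (iff_of_eq h).2 ?_
  simp only [if_true, Bool.false_eq_true, if_false]
  rw [CP3.mulI_dproj (CP3.mulVec_ne_zero a hv), Matrix.mulVec_smul]

end Action

/-! ### Reduction to the base point -/

/-- The first vector of the standard basis of `ℂ⁴`. -/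
def baseVec : Fin 4 → ℂ := Pi.single 0 1

lemma baseVec_ne_zero : baseVec ≠ 0 := by simp [baseVec]

lemma proj_baseVec : CP3.proj baseVec = CP3.basePoint := CP3.basePoint_eq.symm

lemma exists_dproj_baseVec (u : TangentSpace 𝓘(ℝ, Fin 3 → ℂ) (CP3.proj baseVec)) :
    ∃ w, w 0 = 0 ∧ CP3.dproj baseVec w = u := by
  obtain ⟨w, rfl⟩ := CP3.dproj_surjective baseVec_ne_zero u
  refine ⟨w - w 0 • baseVec, by simp [baseVec], ?_⟩
  rw [map_sub, CP3.dproj_self baseVec_ne_zero, sub_zero]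

/-- Invariant properties of families of tangent vectors may be checked at the base point. -/
lemma tangent_induction {κ : Type*}
    {P : ∀ p : CP3, (κ → TangentSpace 𝓘(ℝ, Fin 3 → ℂ) p) → Prop}
    (h0 : ∀ w : κ → Fin 4 → ℂ, (∀ i, w i 0 = 0) →
      P (CP3.proj baseVec) (fun i => CP3.dproj baseVec (w i)))
    (hs : ∀ a p u, P p u → P (a • p) (fun i => dAct a p (u i))) (p : CP3)
    (u : κ → TangentSpace 𝓘(ℝ, Fin 3 → ℂ) p) : P p u := by
  obtain ⟨a, ha⟩ := exists_smul_basePoint_eq p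
  rw [← proj_baseVec, CP3.smul_proj a baseVec_ne_zero] at ha
  subst ha
  have hav := CP3.mulVec_ne_zero a baseVec_ne_zero
  have h1' : (sp2Matrix a) * (sp2Matrix a)ᴴ = 1 :=
    mul_eq_one_comm.1 (Matrix.UnitaryGroup.star_mul_self a.1)
  have key : ∀ i, ∃ w, CP3.dproj (sp2Matrix a *ᵥ baseVec) (sp2Matrix a *ᵥ w) = u i := by
    intro i
    obtain ⟨w, hw⟩ := CP3.dproj_surjective hav (u i)
    exact ⟨(sp2Matrix a)ᴴ *ᵥ w, by rw [Matrix.mulVec_mulVec, h1', Matrix.one_mulVec, hw]⟩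
  choose w hw using key
  obtain rfl : (fun i => CP3.dproj (sp2Matrix a *ᵥ baseVec) (sp2Matrix a *ᵥ w i)) = u := funext hw
  refine (iff_of_eq (CP3.mfderiv_smul_dproj P a baseVec_ne_zero w)).1
    (hs a _ (fun i => CP3.dproj baseVec (w i)) ?_)
  choose z hz e using fun i => exists_dproj_baseVec (CP3.dproj baseVec (w i))
  simp only [← e]
  exact h0 z hz

/-- Invariant properties of tangent vectors may be checked at the base point. -/
lemma tangent_induction_one {P : ∀ p : CP3, TangentSpace 𝓘(ℝ, Fin 3 → ℂ) p → Prop}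
    (h0 : ∀ w : Fin 4 → ℂ, w 0 = 0 → P (CP3.proj baseVec) (CP3.dproj baseVec w))
    (hs : ∀ a p u, P p u → P (a • p) (dAct a p u)) (p : CP3)
    (u : TangentSpace 𝓘(ℝ, Fin 3 → ℂ) p) : P p u :=
  tangent_induction (κ := Unit) (P := fun p u => P p (u ())) (fun _ hw => h0 _ (hw ()))
    (fun a p _ h => hs a p _ h) p (fun _ => u)

lemma hasDerivAt_quadratic_div (A B C n : ℝ) :
    HasDerivAt (fun t : ℝ => (A + t * B + t ^ 2 * C) / (1 + t ^ 2 * n)) B 0 := by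
  have h1 : HasDerivAt (fun t : ℝ => A + t * B + t ^ 2 * C) B 0 := by
    refine ((((hasDerivAt_id' (0 : ℝ)).mul_const B).const_add A).add
      (((hasDerivAt_id' (0 : ℝ)).pow 2).mul_const C)).congr_deriv ?_
    simp
  have h2 : HasDerivAt (fun t : ℝ => 1 + t ^ 2 * n) 0 0 := by
    refine ((((hasDerivAt_id' (0 : ℝ)).pow 2).mul_const n).const_add 1).congr_deriv ?_
    simp
  refine (h1.div h2 (by simp)).congr_deriv ?_
  simp

/-- Along `baseVec + t w` with `w 0 = 0` the squared norm is `1 + t² |w|²`, without linear term, so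
a quotient of quadratic forms has the linear coefficient of its numerator as derivative. -/
lemma mvfderiv_dproj_of_quadratic {f : CP3 → ℝ} (hf : ContMDiff 𝓘(ℝ, Fin 3 → ℂ) 𝓘(ℝ, ℝ) ∞ f)
    {w : Fin 4 → ℂ} (hw : w 0 = 0) {A B C n : ℝ}
    (h : ∀ t : ℝ, baseVec + (t : ℂ) • w ≠ 0 →
      f (CP3.proj (baseVec + (t : ℂ) • w)) = (A + t * B + t ^ 2 * C) / (1 + t ^ 2 * n)) :
    mvfderiv 𝓘(ℝ, Fin 3 → ℂ) f (CP3.proj baseVec) (CP3.dproj baseVec w) = B := by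
  have hmd := (hf (CP3.proj baseVec)).mdifferentiableAt (by simp)
  rw [CP3.mvfderiv_dproj baseVec_ne_zero hmd]
  have hd : DifferentiableAt ℝ (fun y => f (CP3.proj y)) baseVec :=
    (hmd.comp baseVec ((CP3.contMDiffAt_proj baseVec_ne_zero).mdifferentiableAt
      (by simp))).differentiableAt
  have h1 : HasDerivAt (fun t : ℝ => baseVec + t • w) w 0 := by
    refine ((hasDerivAt_id' (0 : ℝ)).smul_const w |>.const_add baseVec).congr_deriv ?_
    simp
  have h2 : HasFDerivAt (fun y => f (CP3.proj y)) (fderiv ℝ (fun y => f (CP3.proj y)) baseVec)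
      (baseVec + (0 : ℝ) • w) := by simpa using hd.hasFDerivAt
  have h3 := h2.comp_hasDerivAt (0 : ℝ) h1
  refine h3.unique ((hasDerivAt_quadratic_div A B C n).congr_of_eventuallyEq
    (Filter.Eventually.of_forall fun t => ?_))
  refine h t fun h0 => ?_
  have := congrFun h0 0
  simp [baseVec, hw] at this

/-- The differential of `hopf` at the base point. -/
def baseDHopf (w : Fin 4 → ℂ) : Fin 5 → ℝ :=
  ![2 * (w 2).re, -(2 * (w 2).im), 2 * (w 3).re, -(2 * (w 3).im), 0]

/-- The differential of `twistorJ` at the base point. -/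
def baseDJUpper (w : Fin 4 → ℂ) : Matrix (Fin 5) (Fin 5) ℝ :=
  !![0, 0, 2 * (w 1).im, 2 * (w 1).re, 2 * (w 2).im;
     0, 0, 2 * (w 1).re, -(2 * (w 1).im), 2 * (w 2).re;
     0, 0, 0, 0, 2 * (w 3).im;
     0, 0, 0, 0, 2 * (w 3).re;
     0, 0, 0, 0, 0]

lemma sqNorm_baseVec_add {w : Fin 4 → ℂ} (hw : w 0 = 0) (t : ℝ) :
    sqNorm (baseVec + (t : ℂ) • w) = 1 + t ^ 2 * sqNorm w := by
  rw [sqNorm_expand, sqNorm_expand]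
  simp [baseVec, hw]; ring

lemma dHopf_baseVec {w : Fin 4 → ℂ} (hw : w 0 = 0) :
    dHopf (CP3.proj baseVec) (CP3.dproj baseVec w) = baseDHopf w := by
  ext k
  rw [dHopf_apply]
  refine mvfderiv_dproj_of_quadratic (contMDiff_hopf_apply k) hw (A := hopfNum baseVec k)
    (C := hopfNum w k) (n := sqNorm w) fun t ht => ?_
  rw [hopf_proj ht, hopfV_eq, sqNorm_baseVec_add hw]
  congr 1
  fin_cases k <;> simp [hopfNum, baseVec, baseDHopf, hw, Complex.normSq_apply] <;> ring

lemma dMatrix_baseVec {w : Fin 4 → ℂ} (hw : w 0 = 0) :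
    dMatrix twistorJ (CP3.proj baseVec) (CP3.dproj baseVec w) =
      baseDJUpper w - (baseDJUpper w)ᵀ := by
  ext k l
  change mvfderiv 𝓘(ℝ, Fin 3 → ℂ) (fun q => twistorJ q k l) _ _ = _
  refine mvfderiv_dproj_of_quadratic (contMDiff_twistorJ k l) hw
    (A := (twistorNumUpper baseVec - (twistorNumUpper baseVec)ᵀ) k l)
    (C := (twistorNumUpper w - (twistorNumUpper w)ᵀ) k l) (n := sqNorm w) fun t ht => ?_
  rw [twistorJ_proj ht, twistorJV_eq, sqNorm_baseVec_add hw, Matrix.smul_apply, smul_eq_mul,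
    ← div_eq_inv_mul]
  congr 1
  fin_cases k <;> fin_cases l <;>
    simp [twistorNumUpper, baseVec, baseDJUpper, hw] <;> ring


/-! ### The ambient operators inducing `i` and `J_-` -/

lemma mul_conj_mul {R : Matrix (Fin 5) (Fin 5) ℝ} (hR : Rᵀ * R = 1)
    (X Y : Matrix (Fin 5) (Fin 5) ℝ) : (R * X * Rᵀ) * (R * Y * Rᵀ) = R * (X * Y) * Rᵀ := by
  calc _ = R * X * (Rᵀ * R) * Y * Rᵀ := by simp only [Matrix.mul_assoc]
    _ = _ := by rw [hR, Matrix.mul_one]; simp only [Matrix.mul_assoc]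

lemma vecMulVec_mulVec_conj (R : Matrix (Fin 5) (Fin 5) ℝ) (u v : Fin 5 → ℝ) :
    Matrix.vecMulVec (R *ᵥ u) (R *ᵥ v) = R * Matrix.vecMulVec u v * Rᵀ := by
  rw [Matrix.mul_vecMulVec, Matrix.vecMulVec_mul, Matrix.vecMul_transpose]

lemma trace_conj_conj {R : Matrix (Fin 5) (Fin 5) ℝ} (hR : Rᵀ * R = 1)
    (X Y : Matrix (Fin 5) (Fin 5) ℝ) :
    ((R * X * Rᵀ)ᵀ * (R * Y * Rᵀ)).trace = (Xᵀ * Y).trace := by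
  have h : (R * X * Rᵀ)ᵀ = R * Xᵀ * Rᵀ := by
    simp [Matrix.transpose_mul, Matrix.mul_assoc]
  rw [h, mul_conj_mul hR, Matrix.trace_mul_comm, ← Matrix.mul_assoc, hR, Matrix.one_mul]

/-- For `ε = 1` (resp. `ε = -1`), the differential of `j` along `i u` (resp. along `J_- u`), where
`A` is the differential of `j` along `u` and `N` is the matrix `x xᵀ`. -/
def twistOp (ε : ℝ) (j N A : Matrix (Fin 5) (Fin 5) ℝ) : Matrix (Fin 5) (Fin 5) ℝ :=
  -- A vertical `A` anticommutes with `j` and satisfies `A N = N A = 0`, so the value is `ε j A`.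
  -- For a horizontal `A`, `j A - A j = j A N - N A j`, and the total coefficient is `ε / 2 + (1 - ε
  -- / 2) = 1`. Thus `ε` changes the sign on the fibres only.
  (ε / 2) • (j * A - A * j) + (1 - ε / 2) • (j * A * N - N * A * j)

lemma twistOp_conj (ε : ℝ) (j N A : Matrix (Fin 5) (Fin 5) ℝ) {R : Matrix (Fin 5) (Fin 5) ℝ}
    (hR : Rᵀ * R = 1) : twistOp ε (R * j * Rᵀ) (R * N * Rᵀ) (R * A * Rᵀ) =
      R * twistOp ε j N A * Rᵀ := by
  simp only [twistOp, mul_conj_mul hR, Matrix.mul_add, Matrix.add_mul, Matrix.mul_sub,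
    Matrix.sub_mul, Matrix.mul_smul, Matrix.smul_mul]

/-- The projection onto the line of `hopf p`. -/
def twistorN (p : CP3) : Matrix (Fin 5) (Fin 5) ℝ := Matrix.vecMulVec (hopf p) (hopf p)

lemma twistorN_smul (a : Sp2) (p : CP3) :
    twistorN (a • p) = spRotation a * twistorN p * (spRotation a)ᵀ := by
  rw [twistorN, hopf_smul, vecMulVec_mulVec_conj]; rfl

lemma contMDiff_twistorN (k l : Fin 5) :
    ContMDiff 𝓘(ℝ, Fin 3 → ℂ) 𝓘(ℝ, ℝ) ∞ (fun p => twistorN p k l) :=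
  (contMDiff_hopf_apply k).mul (contMDiff_hopf_apply l)

lemma dMatrix_twistorN (p : CP3) (u : TangentSpace 𝓘(ℝ, Fin 3 → ℂ) p) :
    dMatrix twistorN p u =
      Matrix.vecMulVec (dHopf p u) (hopf p) + Matrix.vecMulVec (hopf p) (dHopf p u) := by
  ext k l
  refine (mvfderiv_fun_mul_apply (((contMDiff_hopf_apply k) p).mdifferentiableAt (by simp))
    (((contMDiff_hopf_apply l) p).mdifferentiableAt (by simp)) u).trans ?_
  rw [← dHopf_apply, ← dHopf_apply]
  simp only [Matrix.add_apply, Matrix.vecMulVec_apply]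
  ring

lemma dMatrix_twistorN_dAct (a : Sp2) (p : CP3) (u : TangentSpace 𝓘(ℝ, Fin 3 → ℂ) p) :
    dMatrix twistorN (a • p) (dAct a p u) =
      spRotation a * dMatrix twistorN p u * (spRotation a)ᵀ :=
  dMatrix_dAct a p u contMDiff_twistorN (twistorN_smul a)

lemma dMatrix_twistorJ_dAct (a : Sp2) (p : CP3) (u : TangentSpace 𝓘(ℝ, Fin 3 → ℂ) p) :
    dMatrix twistorJ (a • p) (dAct a p u) =
      spRotation a * dMatrix twistorJ p u * (spRotation a)ᵀ :=
  dMatrix_dAct a p u contMDiff_twistorJ (twistorJ_smul a)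

lemma hopf_proj_baseVec : hopf (CP3.proj baseVec) = Pi.single 4 1 := by
  rw [proj_baseVec, hopf_basePoint]

lemma twistorJ_proj_baseVec : twistorJ (CP3.proj baseVec) = baseJ := by
  rw [proj_baseVec, twistorJ_basePoint]

lemma twistorJ_mulVec_dHopf (p : CP3) (u : TangentSpace 𝓘(ℝ, Fin 3 → ℂ) p) :
    twistorJ p *ᵥ dHopf p u = dHopf p (CP3.mulI p u) := by
  refine tangent_induction_one
    (P := fun p u => twistorJ p *ᵥ dHopf p u = dHopf p (CP3.mulI p u)) ?_ ?_ p u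
  · intro w hw
    rw [CP3.mulI_dproj baseVec_ne_zero, twistorJ_proj_baseVec, dHopf_baseVec hw,
      dHopf_baseVec (by simp [hw])]
    ext k
    fin_cases k <;> simp [baseDHopf, baseJ]
  · intro a p u h
    rw [mulI_dAct, twistorJ_smul, dHopf_dAct, dHopf_dAct, ← h, Matrix.mulVec_mulVec,
      Matrix.mul_assoc, transpose_mul_spRotation, Matrix.mul_one, Matrix.mulVec_mulVec]

lemma isTwistorIdentification_twistorJ : IsTwistorIdentification twistorJ :=
  ⟨contMDiff_hopf, contMDiff_twistorJ, twistor_bijOn, twistorJ_mulVec_dHopf⟩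

/-- The tangent vector `u'` is `i u` if `ε = 1` and `J_- u` if `ε = -1`. -/
structure IsTwist (ε : ℝ) (p : CP3) (u u' : TangentSpace 𝓘(ℝ, Fin 3 → ℂ) p) : Prop where
  dN : dMatrix twistorN p u' = twistorJ p * dMatrix twistorN p u - dMatrix twistorN p u * twistorJ p
  dJ : dMatrix twistorJ p u' = twistOp ε (twistorJ p) (twistorN p) (dMatrix twistorJ p u)

lemma IsTwist.dAct {ε : ℝ} {p : CP3} {u u' : TangentSpace 𝓘(ℝ, Fin 3 → ℂ) p}
    (h : IsTwist ε p u u') (a : Sp2) : IsTwist ε (a • p) (dAct a p u) (dAct a p u') := by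
  have hR := transpose_mul_spRotation a
  constructor
  · rw [dMatrix_twistorN_dAct, dMatrix_twistorN_dAct, twistorJ_smul, mul_conj_mul hR,
      mul_conj_mul hR, h.dN, Matrix.mul_sub, Matrix.sub_mul]
  · rw [dMatrix_twistorJ_dAct, dMatrix_twistorJ_dAct, twistorJ_smul, twistorN_smul,
      twistOp_conj _ _ _ _ hR, h.dJ]

/-- The differential of `twistorJ` at the base point. -/
def baseDJ (w : Fin 4 → ℂ) : Matrix (Fin 5) (Fin 5) ℝ := baseDJUpper w - (baseDJUpper w)ᵀ

lemma baseDJ_eq (w : Fin 4 → ℂ) : baseDJ w =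
    !![0, 0, 2 * (w 1).im, 2 * (w 1).re, 2 * (w 2).im;
      0, 0, 2 * (w 1).re, -(2 * (w 1).im), 2 * (w 2).re;
      -(2 * (w 1).im), -(2 * (w 1).re), 0, 0, 2 * (w 3).im;
      -(2 * (w 1).re), 2 * (w 1).im, 0, 0, 2 * (w 3).re;
      -(2 * (w 2).im), -(2 * (w 2).re), -(2 * (w 3).im), -(2 * (w 3).re), 0] := by
  ext k l
  fin_cases k <;> fin_cases l <;> simp [baseDJ, baseDJUpper]

/-- The differential of `twistorN` at the base point. -/
def baseDN (w : Fin 4 → ℂ) : Matrix (Fin 5) (Fin 5) ℝ :=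
  !![0, 0, 0, 0, 2 * (w 2).re;
    0, 0, 0, 0, -(2 * (w 2).im);
    0, 0, 0, 0, 2 * (w 3).re;
    0, 0, 0, 0, -(2 * (w 3).im);
    2 * (w 2).re, -(2 * (w 2).im), 2 * (w 3).re, -(2 * (w 3).im), 0]

/-- The projection onto the line of `hopf` at the base point. -/
def baseN : Matrix (Fin 5) (Fin 5) ℝ :=
  !![0, 0, 0, 0, 0; 0, 0, 0, 0, 0; 0, 0, 0, 0, 0; 0, 0, 0, 0, 0; 0, 0, 0, 0, 1]

lemma twistorN_proj_baseVec : twistorN (CP3.proj baseVec) = baseN := by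
  rw [twistorN, hopf_proj_baseVec]
  ext k l
  rw [Matrix.vecMulVec_apply]
  fin_cases k <;> fin_cases l <;> simp [baseN]

lemma dMatrix_twistorN_baseVec {w : Fin 4 → ℂ} (hw : w 0 = 0) :
    dMatrix twistorN (CP3.proj baseVec) (CP3.dproj baseVec w) = baseDN w := by
  rw [dMatrix_twistorN, hopf_proj_baseVec, dHopf_baseVec hw]
  ext k l
  simp only [Matrix.add_apply, Matrix.vecMulVec_apply]
  fin_cases k <;> fin_cases l <;> simp [baseDHopf, baseDN]

lemma dMatrix_twistorJ_baseVec {w : Fin 4 → ℂ} (hw : w 0 = 0) :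
    dMatrix twistorJ (CP3.proj baseVec) (CP3.dproj baseVec w) = baseDJ w := dMatrix_baseVec hw

lemma baseJ_mul_apply (M : Matrix (Fin 5) (Fin 5) ℝ) (k l : Fin 5) :
    (baseJ * M) k l = ![M 1 l, -M 0 l, M 3 l, -M 2 l, 0] k := by
  rw [Matrix.mul_apply, Fin.sum_univ_five]
  fin_cases k <;> simp [baseJ]

lemma mul_baseJ_apply (M : Matrix (Fin 5) (Fin 5) ℝ) (k l : Fin 5) :
    (M * baseJ) k l = ![-M k 1, M k 0, -M k 3, M k 2, 0] l := by
  rw [Matrix.mul_apply, Fin.sum_univ_five]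
  fin_cases l <;> simp [baseJ]

lemma baseN_mul_apply (M : Matrix (Fin 5) (Fin 5) ℝ) (k l : Fin 5) :
    (baseN * M) k l = ![0, 0, 0, 0, M 4 l] k := by
  rw [Matrix.mul_apply, Fin.sum_univ_five]
  fin_cases k <;> simp [baseN]

lemma mul_baseN_apply (M : Matrix (Fin 5) (Fin 5) ℝ) (k l : Fin 5) :
    (M * baseN) k l = ![0, 0, 0, 0, M k 4] l := by
  rw [Matrix.mul_apply, Fin.sum_univ_five]
  fin_cases l <;> simp [baseN]

/-- The coordinate `w 1` is tangent to the fibre and `w 2`, `w 3` are horizontal, which is why `ε`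
affects `w 1` alone. -/
lemma isTwist_baseVec {ε : ℝ} (hε : ε = 1 ∨ ε = -1) {w : Fin 4 → ℂ} (hw : w 0 = 0) :
    IsTwist ε (CP3.proj baseVec) (CP3.dproj baseVec w)
      (CP3.dproj baseVec ![0, ε * Complex.I * w 1, Complex.I * w 2, Complex.I * w 3]) := by
  constructor
  · rw [twistorJ_proj_baseVec, dMatrix_twistorN_baseVec hw, dMatrix_twistorN_baseVec rfl]
    ext k l
    simp only [Matrix.sub_apply, baseJ_mul_apply, mul_baseJ_apply]
    fin_cases k <;> fin_cases l <;> simp [baseDN]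
  · rw [twistorJ_proj_baseVec, twistorN_proj_baseVec, dMatrix_twistorJ_baseVec hw,
      dMatrix_twistorJ_baseVec rfl, baseDJ_eq, baseDJ_eq]
    ext k l
    simp only [twistOp, Matrix.add_apply, Matrix.smul_apply, Matrix.sub_apply, Matrix.mul_assoc,
      baseN_mul_apply, baseJ_mul_apply, mul_baseJ_apply, mul_baseN_apply]
    rcases hε with rfl | rfl <;> fin_cases k <;> fin_cases l <;> simp <;> ring

lemma exists_isTwist {ε : ℝ} (hε : ε = 1 ∨ ε = -1) (p : CP3)
    (u : TangentSpace 𝓘(ℝ, Fin 3 → ℂ) p) : ∃ u', IsTwist ε p u u' :=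
  tangent_induction_one (P := fun p u => ∃ u', IsTwist ε p u u')
    (fun _ hw => ⟨_, isTwist_baseVec hε hw⟩) (fun a _ _ ⟨_, h⟩ => ⟨_, h.dAct a⟩) p u


/-! ### The metric `g₁` and the almost complex structure `J_-` -/

/-- By compactness of the unit sphere, `B v v ≥ m ‖v‖²` for some `m > 0`. -/
lemma isVonNBounded_of_pos {E : Type*} [NormedAddCommGroup E] [NormedSpace ℝ E]
    [FiniteDimensional ℝ E] (B : E →L[ℝ] E →L[ℝ] ℝ) (hB : ∀ v, v ≠ 0 → 0 < B v v) :
    Bornology.IsVonNBounded ℝ {v : E | B v v < 1} := by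
  have : ProperSpace E := FiniteDimensional.proper ℝ E
  rw [NormedSpace.isVonNBounded_iff]
  rcases (Metric.sphere (0 : E) 1).eq_empty_or_nonempty with h | h
  · refine (Bornology.isBounded_singleton (x := (0 : E))).subset fun v _ => ?_
    by_contra hv
    have hv : v ≠ 0 := hv
    have : ‖v‖⁻¹ • v ∈ Metric.sphere (0 : E) 1 := by
      simp [norm_smul, norm_ne_zero_iff.2 hv]
    rw [h] at this
    exact this
  · obtain ⟨v₀, hv₀, hmin⟩ := (isCompact_sphere (0 : E) 1).exists_isMinOn h
      (f := fun v => B v v) (B.continuous.clm_apply continuous_id).continuousOn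
    have hne : v₀ ≠ 0 := fun h0 => by simp [h0] at hv₀
    have hm := hB v₀ hne
    refine (Metric.isBounded_iff_subset_closedBall 0).2
      ⟨Real.sqrt (1 / B v₀ v₀), fun v hv => ?_⟩
    have hv : B v v < 1 := hv
    rw [mem_closedBall_zero_iff]
    refine Real.le_sqrt_of_sq_le ?_
    by_cases hv0 : v = 0
    · simp [hv0, hm.le]
    have hn : 0 < ‖v‖ := norm_pos_iff.2 hv0
    have hs : ‖v‖⁻¹ • v ∈ Metric.sphere (0 : E) 1 := by
      simp [norm_smul, hn.ne']
    have h1 : B v₀ v₀ ≤ B (‖v‖⁻¹ • v) (‖v‖⁻¹ • v) := hmin hs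
    simp only [map_smul, smul_apply, smul_eq_mul] at h1
    rw [le_div_iff₀ hm]
    have h2 : ‖v‖ ^ 2 * (‖v‖⁻¹ * (‖v‖⁻¹ * B v v)) = B v v := by field_simp
    nlinarith [mul_le_mul_of_nonneg_left h1 (sq_nonneg ‖v‖)]

/-- The weights of the embedding of the twistor space by `twistorN` and `twistorJ`. -/
def twistorWeight (α β : ℝ) : (Fin 5 × Fin 5) ⊕ (Fin 5 × Fin 5) → ℝ :=
  Sum.elim (fun _ => α / 2) (fun _ => β)

/-- The entries of `twistorN` and `twistorJ`. -/
def twistorCoord : (Fin 5 × Fin 5) ⊕ (Fin 5 × Fin 5) → CP3 → ℝ :=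
  Sum.elim (fun k p => twistorN p k.1 k.2) (fun k p => twistorJ p k.1 k.2)

lemma contMDiff_twistorCoord (i : (Fin 5 × Fin 5) ⊕ (Fin 5 × Fin 5)) :
    ContMDiff 𝓘(ℝ, Fin 3 → ℂ) 𝓘(ℝ, ℝ) ∞ (twistorCoord i) := by
  rcases i with i | i
  · exact contMDiff_twistorN _ _
  · exact contMDiff_twistorJ _ _

/-- The bilinear form `(α / 2) tr (dNᵀ dN) + β tr (djᵀ dj)`. -/
def twistorForm (α β : ℝ) (p : CP3) (u v : TangentSpace 𝓘(ℝ, Fin 3 → ℂ) p) : ℝ :=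
  α / 2 * ((dMatrix twistorN p u)ᵀ * dMatrix twistorN p v).trace +
    β * ((dMatrix twistorJ p u)ᵀ * dMatrix twistorJ p v).trace

lemma trace_transpose_mul (A B : Matrix (Fin 5) (Fin 5) ℝ) :
    (Aᵀ * B).trace = ∑ k : Fin 5 × Fin 5, A k.1 k.2 * B k.1 k.2 := by
  rw [Fintype.sum_prod_type, Finset.sum_comm]
  simp [Matrix.trace, Matrix.mul_apply]

lemma sum_twistorWeight (α β : ℝ) (a b : (Fin 5 × Fin 5) ⊕ (Fin 5 × Fin 5) → ℝ) :
    ∑ i, twistorWeight α β i * a i * b i =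
      α / 2 * ((Matrix.of fun k l => a (Sum.inl (k, l)))ᵀ *
        (Matrix.of fun k l => b (Sum.inl (k, l)))).trace +
      β * ((Matrix.of fun k l => a (Sum.inr (k, l)))ᵀ *
        (Matrix.of fun k l => b (Sum.inr (k, l)))).trace := by
  rw [Fintype.sum_sum_type, trace_transpose_mul, trace_transpose_mul, Finset.mul_sum,
    Finset.mul_sum]
  simp [twistorWeight, mul_assoc]

lemma sum_mvfderiv_twistorCoord (α β : ℝ) (p : CP3) (u v : TangentSpace 𝓘(ℝ, Fin 3 → ℂ) p) :
    ∑ i, twistorWeight α β i * mvfderiv 𝓘(ℝ, Fin 3 → ℂ) (twistorCoord i) p u *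
      mvfderiv 𝓘(ℝ, Fin 3 → ℂ) (twistorCoord i) p v = twistorForm α β p u v :=
  sum_twistorWeight α β _ _

lemma twistorForm_dAct (α β : ℝ) (a : Sp2) (p : CP3) (u v : TangentSpace 𝓘(ℝ, Fin 3 → ℂ) p) :
    twistorForm α β (a • p) (dAct a p u) (dAct a p v) = twistorForm α β p u v := by
  have hR := transpose_mul_spRotation a
  rw [twistorForm, dMatrix_twistorN_dAct, dMatrix_twistorN_dAct, dMatrix_twistorJ_dAct,
    dMatrix_twistorJ_dAct, trace_conj_conj hR, trace_conj_conj hR]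
  rfl

/-- The two coefficients are independent functions of `(α, β)`, so all invariant metrics are
reached. The values `(3/4, 1/8)` give the coefficients `2` and `4` of `g₁`. -/
lemma twistorForm_baseVec (α β : ℝ) {w w' : Fin 4 → ℂ} (hw : w 0 = 0) (hw' : w' 0 = 0) :
    twistorForm α β (CP3.proj baseVec) (CP3.dproj baseVec w) (CP3.dproj baseVec w') =
      16 * β * (conj (w 1) * w' 1).re +
        (4 * α + 8 * β) * ((conj (w 2) * w' 2).re + (conj (w 3) * w' 3).re) := by
  rw [twistorForm, dMatrix_twistorN_baseVec hw, dMatrix_twistorN_baseVec hw',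
    dMatrix_twistorJ_baseVec hw, dMatrix_twistorJ_baseVec hw', trace_transpose_mul,
    trace_transpose_mul, baseDJ_eq, baseDJ_eq, Fintype.sum_prod_type, Fintype.sum_prod_type]
  simp [Fin.sum_univ_five, baseDN]
  ring

/-- The metric `g₁`, as a family of bilinear forms. -/
def twistorInner (p : CP3) : TangentSpace 𝓘(ℝ, Fin 3 → ℂ) p →L[ℝ]
    TangentSpace 𝓘(ℝ, Fin 3 → ℂ) p →L[ℝ] ℝ :=
  ∑ i, twistorWeight (3 / 4) (1 / 8) i • (mvfderiv 𝓘(ℝ, Fin 3 → ℂ) (twistorCoord i) p).smulRight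
    (mvfderiv 𝓘(ℝ, Fin 3 → ℂ) (twistorCoord i) p)

lemma twistorInner_eq_sum (p : CP3) (u v : TangentSpace 𝓘(ℝ, Fin 3 → ℂ) p) :
    twistorInner p u v = ∑ i, twistorWeight (3 / 4) (1 / 8) i *
      mvfderiv 𝓘(ℝ, Fin 3 → ℂ) (twistorCoord i) p u *
      mvfderiv 𝓘(ℝ, Fin 3 → ℂ) (twistorCoord i) p v := by
  simp [twistorInner, mul_assoc]

lemma twistorInner_apply (p : CP3) (u v : TangentSpace 𝓘(ℝ, Fin 3 → ℂ) p) :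
    twistorInner p u v = twistorForm (3 / 4) (1 / 8) p u v :=
  (twistorInner_eq_sum p u v).trans (sum_mvfderiv_twistorCoord _ _ _ _ _)

lemma twistorInner_pos (p : CP3) (u : TangentSpace 𝓘(ℝ, Fin 3 → ℂ) p) (hu : u ≠ 0) :
    0 < twistorInner p u u := by
  rw [twistorInner_apply]
  refine tangent_induction_one
    (P := fun p u => u ≠ 0 → 0 < twistorForm (3 / 4) (1 / 8) p u u) ?_ ?_ p u hu
  · intro w hw hne
    rw [twistorForm_baseVec _ _ hw hw]
    have hw0 : w ≠ 0 := fun h => hne (by rw [h, map_zero])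
    have h := sqNorm_pos hw0
    rw [sqNorm_expand] at h
    simp [hw] at h ⊢
    nlinarith [sq_nonneg (w 1).re, sq_nonneg (w 1).im]
  · intro a p u h hne
    rw [twistorForm_dAct]
    refine h fun h0 => hne ?_
    rw [h0]
    exact map_zero (mfderiv 𝓘(ℝ, Fin 3 → ℂ) 𝓘(ℝ, Fin 3 → ℂ) (fun y : CP3 => a • y) p)

attribute [irreducible] twistorInner

/-- The twistor metric `g₁`. -/
def twistorMetric : ContMDiffRiemannianMetric 𝓘(ℝ, Fin 3 → ℂ) ∞ (Fin 3 → ℂ)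
    (fun p : CP3 => TangentSpace 𝓘(ℝ, Fin 3 → ℂ) p) where
  inner := twistorInner
  symm p u v := by
    rw [twistorInner_eq_sum, twistorInner_eq_sum]
    exact Finset.sum_congr rfl fun i _ => by ring
  pos := twistorInner_pos
  isVonNBounded p := isVonNBounded_of_pos (E := Fin 3 → ℂ) (twistorInner p) (twistorInner_pos p)
  contMDiff := by
    classical
    refine contMDiff_bilinear (a := fun i k _ => if i = k then twistorWeight (3 / 4) (1 / 8) i
      else 0) (fun i k => contMDiff_const) contMDiff_twistorCoord contMDiff_twistorCoord
      twistorInner fun p u v => ?_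
    rw [twistorInner_eq_sum]
    refine Finset.sum_congr rfl fun i _ => ?_
    simp [ite_mul]

lemma twistorMetric_inner (p : CP3) (u v : TangentSpace 𝓘(ℝ, Fin 3 → ℂ) p) :
    twistorMetric.inner p u v = twistorForm (3 / 4) (1 / 8) p u v := twistorInner_apply p u v

lemma isInducedMetric_of_twistorForm {α β : ℝ} {g : ContMDiffRiemannianMetric 𝓘(ℝ, Fin 3 → ℂ) ∞
      (Fin 3 → ℂ) (fun p : CP3 => TangentSpace 𝓘(ℝ, Fin 3 → ℂ) p)}
    (h : ∀ p u v, g.inner p u v = twistorForm α β p u v) :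
    IsInducedMetric (twistorWeight α β) twistorCoord g := fun p u v =>
  (h p u v).trans (sum_mvfderiv_twistorCoord _ _ _ _ _).symm

lemma twistOp_add (ε : ℝ) (j N A B : Matrix (Fin 5) (Fin 5) ℝ) :
    twistOp ε j N (A + B) = twistOp ε j N A + twistOp ε j N B := by
  simp only [twistOp, Matrix.mul_add, Matrix.add_mul, smul_sub, smul_add]
  abel

lemma twistOp_smul (ε : ℝ) (j N : Matrix (Fin 5) (Fin 5) ℝ) (c : ℝ)
    (A : Matrix (Fin 5) (Fin 5) ℝ) : twistOp ε j N (c • A) = c • twistOp ε j N A := by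
  simp only [twistOp, Matrix.mul_smul, Matrix.smul_mul, smul_sub, smul_add, smul_comm c]

/-- The extension to `ℝ²⁵ × ℝ²⁵` of the endomorphism `dF u ↦ dF (J u)`. -/
def twistLin (ε : ℝ) (j N : Matrix (Fin 5) (Fin 5) ℝ) :
    ((Fin 5 × Fin 5) ⊕ (Fin 5 × Fin 5) → ℝ) →ₗ[ℝ] ((Fin 5 × Fin 5) ⊕ (Fin 5 × Fin 5) → ℝ) where
  toFun y := Sum.elim
    (fun k => (j * (Matrix.of fun k l => y (Sum.inl (k, l))) -
      (Matrix.of fun k l => y (Sum.inl (k, l))) * j) k.1 k.2)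
    (fun k => twistOp ε j N (Matrix.of fun k l => y (Sum.inr (k, l))) k.1 k.2)
  map_add' y z := by
    have h1 : ∀ A B : Matrix (Fin 5) (Fin 5) ℝ,
        j * (A + B) - (A + B) * j = (j * A - A * j) + (j * B - B * j) := fun A B => by noncomm_ring
    ext (k | k)
    · exact congrFun (congrFun (h1 (Matrix.of fun k l => y (Sum.inl (k, l)))
        (Matrix.of fun k l => z (Sum.inl (k, l)))) k.1) k.2
    · exact congrFun (congrFun (twistOp_add ε j N (Matrix.of fun k l => y (Sum.inr (k, l)))
        (Matrix.of fun k l => z (Sum.inr (k, l)))) k.1) k.2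
  map_smul' c y := by
    have h1 : ∀ A : Matrix (Fin 5) (Fin 5) ℝ,
        j * (c • A) - (c • A) * j = c • (j * A - A * j) := fun A => by
      rw [Matrix.mul_smul, Matrix.smul_mul, smul_sub]
    ext (k | k)
    · exact congrFun (congrFun (h1 (Matrix.of fun k l => y (Sum.inl (k, l)))) k.1) k.2
    · exact congrFun (congrFun (twistOp_smul ε j N c (Matrix.of fun k l => y (Sum.inr (k, l)))) k.1)
        k.2

lemma contMDiff_mul_apply {A B : CP3 → Matrix (Fin 5) (Fin 5) ℝ}
    (hA : ∀ k l, ContMDiff 𝓘(ℝ, Fin 3 → ℂ) 𝓘(ℝ, ℝ) ∞ (fun p => A p k l))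
    (hB : ∀ k l, ContMDiff 𝓘(ℝ, Fin 3 → ℂ) 𝓘(ℝ, ℝ) ∞ (fun p => B p k l)) (k l : Fin 5) :
    ContMDiff 𝓘(ℝ, Fin 3 → ℂ) 𝓘(ℝ, ℝ) ∞ (fun p => (A p * B p) k l) := by
  simp only [Matrix.mul_apply]
  exact contMDiff_finsetSum fun m _ => (hA k m).mul (hB m l)

lemma contMDiff_twistLin (ε : ℝ) (y : (Fin 5 × Fin 5) ⊕ (Fin 5 × Fin 5) → ℝ)
    (i : (Fin 5 × Fin 5) ⊕ (Fin 5 × Fin 5)) : ContMDiff 𝓘(ℝ, Fin 3 → ℂ) 𝓘(ℝ, ℝ) ∞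
      (fun p => twistLin ε (twistorJ p) (twistorN p) y i) := by
  have hc : ∀ (C : Matrix (Fin 5) (Fin 5) ℝ) (k l : Fin 5),
      ContMDiff 𝓘(ℝ, Fin 3 → ℂ) 𝓘(ℝ, ℝ) ∞ (fun _ : CP3 => C k l) := fun C k l => contMDiff_const
  rcases i with ⟨k, l⟩ | ⟨k, l⟩
  · exact (contMDiff_mul_apply contMDiff_twistorJ (hc _) k l).sub
      (contMDiff_mul_apply (hc _) contMDiff_twistorJ k l)
  · exact (contMDiff_const.mul ((contMDiff_mul_apply contMDiff_twistorJ (hc _) k l).sub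
      (contMDiff_mul_apply (hc _) contMDiff_twistorJ k l))).add
      (contMDiff_const.mul ((contMDiff_mul_apply (contMDiff_mul_apply contMDiff_twistorJ (hc _))
        contMDiff_twistorN k l).sub (contMDiff_mul_apply (contMDiff_mul_apply contMDiff_twistorN
          (hc _)) contMDiff_twistorJ k l)))

/-- The bilinear form `g₁ (J_- u, v)`. -/
def jMinusForm (p : CP3) : TangentSpace 𝓘(ℝ, Fin 3 → ℂ) p →L[ℝ]
    TangentSpace 𝓘(ℝ, Fin 3 → ℂ) p →L[ℝ] ℝ := by
  classical
  -- Writing `g₁ (J_- u, v)` through the matrix of the ambient operator presents it as a combination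
  -- of `dFᵢ ⊗ dFₖ` with smooth coefficients; the smoothness of `J_-` then follows by raising an
  -- index.
  exact ∑ i, ∑ k, (twistorWeight (3 / 4) (1 / 8) k *
    twistLin (-1) (twistorJ p) (twistorN p) (Pi.single i 1) k) •
    (mvfderiv 𝓘(ℝ, Fin 3 → ℂ) (twistorCoord i) p).smulRight
      (mvfderiv 𝓘(ℝ, Fin 3 → ℂ) (twistorCoord k) p)

lemma jMinusForm_eq_sum (p : CP3) (u v : TangentSpace 𝓘(ℝ, Fin 3 → ℂ) p) :
    jMinusForm p u v = ∑ i, ∑ k, (twistorWeight (3 / 4) (1 / 8) k *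
      twistLin (-1) (twistorJ p) (twistorN p) (Pi.single i 1) k) *
      mvfderiv 𝓘(ℝ, Fin 3 → ℂ) (twistorCoord i) p u *
      mvfderiv 𝓘(ℝ, Fin 3 → ℂ) (twistorCoord k) p v := by
  simp [jMinusForm, mul_assoc]

attribute [irreducible] jMinusForm

lemma IsTwist.twistLin_apply {ε : ℝ} {p : CP3} {u u' : TangentSpace 𝓘(ℝ, Fin 3 → ℂ) p}
    (h : IsTwist ε p u u') (k : (Fin 5 × Fin 5) ⊕ (Fin 5 × Fin 5)) :
    twistLin ε (twistorJ p) (twistorN p)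
      (fun i => mvfderiv 𝓘(ℝ, Fin 3 → ℂ) (twistorCoord i) p u) k =
      mvfderiv 𝓘(ℝ, Fin 3 → ℂ) (twistorCoord k) p u' := by
  rcases k with ⟨k, l⟩ | ⟨k, l⟩
  · exact (congrFun (congrFun h.dN k) l).symm
  · exact (congrFun (congrFun h.dJ k) l).symm

lemma IsTwist.jMinusForm_apply {p : CP3} {u u' : TangentSpace 𝓘(ℝ, Fin 3 → ℂ) p}
    (h : IsTwist (-1) p u u') (v : TangentSpace 𝓘(ℝ, Fin 3 → ℂ) p) :
    jMinusForm p u v = twistorMetric.inner p u' v := by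
  rw [jMinusForm_eq_sum, Finset.sum_comm]
  refine Eq.trans ?_ (twistorInner_eq_sum p u' v).symm
  refine Finset.sum_congr rfl fun k _ => ?_
  rw [← h.twistLin_apply k, LinearMap.pi_apply_eq_sum_univ (twistLin _ _ _) (fun i =>
    mvfderiv 𝓘(ℝ, Fin 3 → ℂ) (twistorCoord i) p u), Finset.sum_apply, Finset.mul_sum,
    Finset.sum_mul]
  refine Finset.sum_congr rfl fun i _ => ?_
  have : (fun j => if i = j then (1 : ℝ) else 0) = Pi.single i 1 := by
    ext j; simp [Pi.single_apply, eq_comm]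
  rw [this, Pi.smul_apply, smul_eq_mul]
  ring

/-- The almost complex structure `J_-`. -/
def jMinus (p : CP3) : TangentSpace 𝓘(ℝ, Fin 3 → ℂ) p →L[ℝ] TangentSpace 𝓘(ℝ, Fin 3 → ℂ) p :=
  (sharp twistorMetric p).comp (jMinusForm p)

lemma inner_jMinus (p : CP3) (u w : TangentSpace 𝓘(ℝ, Fin 3 → ℂ) p) :
    twistorMetric.inner p (jMinus p u) w = jMinusForm p u w :=
  inner_sharp twistorMetric p (jMinusForm p u) w

lemma contMDiff_jMinus : ContMDiff 𝓘(ℝ, Fin 3 → ℂ)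
    (𝓘(ℝ, Fin 3 → ℂ).prod 𝓘(ℝ, (Fin 3 → ℂ) →L[ℝ] (Fin 3 → ℂ))) ∞
    (fun p => TotalSpace.mk' ((Fin 3 → ℂ) →L[ℝ] (Fin 3 → ℂ))
      (E := fun p : CP3 => TangentSpace 𝓘(ℝ, Fin 3 → ℂ) p →L[ℝ] TangentSpace 𝓘(ℝ, Fin 3 → ℂ) p)
      p (jMinus p)) :=
  contMDiff_sharp_comp twistorMetric jMinusForm
    (contMDiff_bilinear (fun _ k => contMDiff_const.mul (contMDiff_twistLin _ _ k))
      contMDiff_twistorCoord contMDiff_twistorCoord jMinusForm jMinusForm_eq_sum)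

attribute [irreducible] jMinus

/-- The metric is a function of the differentials of the embedding, so prescribing these
differentials determines the vector. -/
lemma IsTwist.jMinus_eq {p : CP3} {u u' : TangentSpace 𝓘(ℝ, Fin 3 → ℂ) p}
    (h : IsTwist (-1) p u u') : jMinus p u = u' := by
  refine ext_inner twistorMetric fun w => ?_
  rw [← h.jMinusForm_apply w, inner_jMinus]

lemma isTwist_jMinus (p : CP3) (u : TangentSpace 𝓘(ℝ, Fin 3 → ℂ) p) :
    IsTwist (-1) p u (jMinus p u) := by
  obtain ⟨u', h⟩ := exists_isTwist (Or.inr rfl) p u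
  rw [h.jMinus_eq]
  exact h

lemma jMinus_dAct (a : Sp2) (p : CP3) (u : TangentSpace 𝓘(ℝ, Fin 3 → ℂ) p) :
    jMinus (a • p) (dAct a p u) = dAct a p (jMinus p u) :=
  ((isTwist_jMinus p u).dAct a).jMinus_eq


/-- Invariant properties of pairs of tangent vectors may be checked at the base point. -/
lemma tangent_induction_two
    {P : ∀ p : CP3, TangentSpace 𝓘(ℝ, Fin 3 → ℂ) p → TangentSpace 𝓘(ℝ, Fin 3 → ℂ) p → Prop}
    (h0 : ∀ w w' : Fin 4 → ℂ, w 0 = 0 → w' 0 = 0 →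
      P (CP3.proj baseVec) (CP3.dproj baseVec w) (CP3.dproj baseVec w'))
    (hs : ∀ a p u v, P p u v → P (a • p) (dAct a p u) (dAct a p v)) (p : CP3)
    (u v : TangentSpace 𝓘(ℝ, Fin 3 → ℂ) p) : P p u v :=
  tangent_induction (κ := Bool) (P := fun p u => P p (u true) (u false))
    (fun _ hw => h0 _ _ (hw true) (hw false)) (fun a p _ h => hs a p _ _ h) p
    (fun i => if i then u else v)

lemma dAct_neg (a : Sp2) (p : CP3) (u : TangentSpace 𝓘(ℝ, Fin 3 → ℂ) p) :
    dAct a p (-u) = -dAct a p u :=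
  map_neg (mfderiv 𝓘(ℝ, Fin 3 → ℂ) 𝓘(ℝ, Fin 3 → ℂ) (fun y : CP3 => a • y) p) u

lemma jMinus_baseVec {w : Fin 4 → ℂ} (hw : w 0 = 0) :
    jMinus (CP3.proj baseVec) (CP3.dproj baseVec w) =
      CP3.dproj baseVec ![0, -(Complex.I * w 1), Complex.I * w 2, Complex.I * w 3] := by
  have h := (isTwist_baseVec (Or.inr rfl) hw).jMinus_eq
  simpa using h

lemma jMinus_jMinus (p : CP3) (u : TangentSpace 𝓘(ℝ, Fin 3 → ℂ) p) :
    jMinus p (jMinus p u) = -u := by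
  refine tangent_induction_one (P := fun p u => jMinus p (jMinus p u) = -u) ?_ ?_ p u
  · intro w hw
    rw [jMinus_baseVec hw, jMinus_baseVec rfl, ← map_neg]
    congr 1
    ext k
    fin_cases k <;> simp [hw, ← mul_assoc]
  · intro a p u h
    rw [jMinus_dAct, jMinus_dAct, h, dAct_neg]

lemma twistorForm_jMinus (α β : ℝ) (p : CP3) (u v : TangentSpace 𝓘(ℝ, Fin 3 → ℂ) p) :
    twistorForm α β p (jMinus p u) (jMinus p v) = twistorForm α β p u v := by
  refine tangent_induction_two (P := fun p u v =>
    twistorForm α β p (jMinus p u) (jMinus p v) = twistorForm α β p u v) ?_ ?_ p u v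
  · intro w w' hw hw'
    rw [jMinus_baseVec hw, jMinus_baseVec hw', twistorForm_baseVec _ _ rfl rfl,
      twistorForm_baseVec _ _ hw hw']
    simp
  · intro a p u v h
    rw [jMinus_dAct, jMinus_dAct, twistorForm_dAct, twistorForm_dAct, h]

/-- The structure `(g₁, J_-)` on `ℂP³`. -/
def twistorStructure : AlmostHermitian (Fin 3 → ℂ) CP3 where
  g := twistorMetric
  J := jMinus
  smooth_J := contMDiff_jMinus
  J_sq := jMinus_jMinus
  compat p u v := by
    rw [twistorMetric_inner, twistorMetric_inner, twistorForm_jMinus]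

lemma isInvariant_twistorStructure : twistorStructure.IsInvariant Sp2 := fun a p u v =>
  ⟨(twistorMetric_inner _ _ _).trans
    ((twistorForm_dAct _ _ a p u v).trans (twistorMetric_inner _ _ _).symm),
    (jMinus_dAct a p u).symm⟩

lemma verticalPart_conj {R : Matrix (Fin 5) (Fin 5) ℝ} (hR : Rᵀ * R = 1)
    (x : Fin 5 → ℝ) (A : Matrix (Fin 5) (Fin 5) ℝ) :
    verticalPart (R *ᵥ x) (R * A * Rᵀ) = R * verticalPart x A * Rᵀ := by
  have h : 1 - Matrix.vecMulVec (R *ᵥ x) (R *ᵥ x) = R * (1 - Matrix.vecMulVec x x) * Rᵀ := by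
    rw [vecMulVec_mulVec_conj, Matrix.mul_sub, Matrix.sub_mul, Matrix.mul_one,
      mul_eq_one_comm.1 hR]
  rw [verticalPart, h, mul_conj_mul hR, mul_conj_mul hR, verticalPart]

lemma vert_dAct (a : Sp2) (p : CP3) (u : TangentSpace 𝓘(ℝ, Fin 3 → ℂ) p) :
    vert twistorJ (a • p) (dAct a p u) =
      spRotation a * vert twistorJ p u * (spRotation a)ᵀ := by
  rw [vert, hopf_smul, dMatrix_twistorJ_dAct, verticalPart_conj (transpose_mul_spRotation a), vert]

/-- The vertical part of a tangent vector at the base point. -/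
def baseVert (w : Fin 4 → ℂ) : Matrix (Fin 5) (Fin 5) ℝ :=
  !![0, 0, 2 * (w 1).im, 2 * (w 1).re, 0;
    0, 0, 2 * (w 1).re, -(2 * (w 1).im), 0;
    -(2 * (w 1).im), -(2 * (w 1).re), 0, 0, 0;
    -(2 * (w 1).re), 2 * (w 1).im, 0, 0, 0;
    0, 0, 0, 0, 0]

lemma vert_baseVec {w : Fin 4 → ℂ} (hw : w 0 = 0) :
    vert twistorJ (CP3.proj baseVec) (CP3.dproj baseVec w) = baseVert w := by
  have h : Matrix.vecMulVec (Pi.single 4 1) (Pi.single 4 1) = baseN := by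
    rw [← twistorN_proj_baseVec, twistorN, hopf_proj_baseVec]
  rw [vert, verticalPart, hopf_proj_baseVec, dMatrix_twistorJ_baseVec hw, h, baseDJ_eq,
    Matrix.mul_sub, Matrix.sub_mul, Matrix.sub_mul, Matrix.one_mul, Matrix.mul_one, Matrix.mul_one]
  ext k l
  simp only [Matrix.sub_apply, baseN_mul_apply, mul_baseN_apply]
  fin_cases k <;> fin_cases l <;> simp [baseVert]

/-- At the base point both sides have coefficient `2` on `w 1` and `4` on `w 2`, `w 3`. -/
lemma isTwistorMetric_twistorStructure : IsTwistorMetric twistorJ 1 twistorStructure.g := by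
  intro p u v
  refine (twistorMetric_inner p u v).trans ?_
  refine tangent_induction_two (P := fun p u v => twistorForm (3 / 4) (1 / 8) p u v =
    dHopf p u ⬝ᵥ dHopf p v + 1 / 2 * (((vert twistorJ p u)ᵀ * vert twistorJ p v).trace / 4))
    ?_ ?_ p u v
  · intro w w' hw hw'
    rw [twistorForm_baseVec _ _ hw hw', vert_baseVec hw, vert_baseVec hw', dHopf_baseVec hw,
      dHopf_baseVec hw', trace_transpose_mul, Fintype.sum_prod_type, dotProduct]
    simp [Fin.sum_univ_five, baseDHopf, baseVert]
    ring
  · intro a p u v h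
    rw [twistorForm_dAct, dHopf_dAct, dHopf_dAct, vert_dAct, vert_dAct,
      trace_conj_conj (transpose_mul_spRotation a), Matrix.dotProduct_mulVec,
      ← Matrix.mulVec_transpose, Matrix.mulVec_mulVec, transpose_mul_spRotation, Matrix.one_mulVec,
      h]

lemma isTwistorJMinus_twistorStructure : IsTwistorJMinus twistorJ twistorStructure.J := by
  intro p u
  refine tangent_induction_one (P := fun p u => dHopf p (jMinus p u) = twistorJ p *ᵥ dHopf p u ∧
    vert twistorJ p (jMinus p u) = -(twistorJ p * vert twistorJ p u)) ?_ ?_ p u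
  · intro w hw
    rw [jMinus_baseVec hw, dHopf_baseVec rfl, dHopf_baseVec hw, vert_baseVec rfl, vert_baseVec hw,
      twistorJ_proj_baseVec]
    constructor
    · ext k
      fin_cases k <;> simp [baseDHopf, baseJ]
    · ext k l
      simp only [Matrix.neg_apply, baseJ_mul_apply]
      fin_cases k <;> fin_cases l <;> simp [baseVert]
  · intro a p u h
    have hR := transpose_mul_spRotation a
    rw [jMinus_dAct, dHopf_dAct, dHopf_dAct, vert_dAct, vert_dAct, twistorJ_smul, h.1, h.2]
    constructor
    · rw [Matrix.mulVec_mulVec, Matrix.mulVec_mulVec, Matrix.mul_assoc, hR, Matrix.mul_one]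
    · rw [mul_conj_mul hR, Matrix.mul_neg, Matrix.neg_mul]


/-! ### The tensor `g((D_u J) v, w)` at the base point -/

/-- The terms of the derivative of `twistOp ε j N A` in which `j` and `N` are differentiated, with
derivatives `A'` and `B'`. -/
def nkOp (ε : ℝ) (j N B' A' A : Matrix (Fin 5) (Fin 5) ℝ) : Matrix (Fin 5) (Fin 5) ℝ :=
  (ε / 2) • (A' * A - A * A') + (1 - ε / 2) • (A' * A * N + j * A * B' - (B' * A * j + N * A * A'))

/-- The trilinear form `g((D_u J) v, w)`, for the metric `twistorForm α β` and the almost complex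
structure `IsTwist ε`. -/
def nkTensor (α β ε : ℝ) (p : CP3) (u v w : TangentSpace 𝓘(ℝ, Fin 3 → ℂ) p) : ℝ :=
  α / 2 * ((dMatrix twistorJ p u * dMatrix twistorN p v -
      dMatrix twistorN p v * dMatrix twistorJ p u)ᵀ * dMatrix twistorN p w).trace +
    β * ((nkOp ε (twistorJ p) (twistorN p) (dMatrix twistorN p u) (dMatrix twistorJ p u)
      (dMatrix twistorJ p v))ᵀ * dMatrix twistorJ p w).trace

lemma nkOp_conj (ε : ℝ) (j N B' A' A : Matrix (Fin 5) (Fin 5) ℝ) {R : Matrix (Fin 5) (Fin 5) ℝ}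
    (hR : Rᵀ * R = 1) : nkOp ε (R * j * Rᵀ) (R * N * Rᵀ) (R * B' * Rᵀ) (R * A' * Rᵀ)
      (R * A * Rᵀ) = R * nkOp ε j N B' A' A * Rᵀ := by
  simp only [nkOp, mul_conj_mul hR, Matrix.mul_add, Matrix.add_mul, Matrix.mul_sub,
    Matrix.sub_mul, Matrix.mul_smul, Matrix.smul_mul]

lemma nkTensor_dAct (α β ε : ℝ) (a : Sp2) (p : CP3) (u v w : TangentSpace 𝓘(ℝ, Fin 3 → ℂ) p) :
    nkTensor α β ε (a • p) (dAct a p u) (dAct a p v) (dAct a p w) = nkTensor α β ε p u v w := by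
  have hR := transpose_mul_spRotation a
  simp only [nkTensor, dMatrix_twistorN_dAct, dMatrix_twistorJ_dAct, twistorN_smul, twistorJ_smul,
    nkOp_conj _ _ _ _ _ _ hR, mul_conj_mul hR, ← Matrix.sub_mul, ← Matrix.mul_sub,
    trace_conj_conj hR]

lemma baseJ_transpose : baseJᵀ = -baseJ := by
  rw [← twistorJ_proj_baseVec, twistorJ_transpose]

lemma trace_mul_mul_baseN (A B C : Matrix (Fin 5) (Fin 5) ℝ) :
    ((A * B * baseN)ᵀ * C).trace = ∑ k, (∑ l, A k l * B l 4) * C k 4 := by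
  rw [trace_transpose_mul, Fintype.sum_prod_type]
  simp only [mul_baseN_apply, Fin.sum_univ_five]
  simp [Matrix.mul_apply, Fin.sum_univ_five]

lemma trace_baseN_mul_mul (A B C : Matrix (Fin 5) (Fin 5) ℝ) :
    ((baseN * A * B)ᵀ * C).trace = ∑ k, (∑ l, A 4 l * B l k) * C 4 k := by
  rw [trace_transpose_mul, Fintype.sum_prod_type]
  simp only [Matrix.mul_assoc, baseN_mul_apply, Fin.sum_univ_five]
  simp [Matrix.mul_apply, Fin.sum_univ_five]

lemma trace_mul (A B C : Matrix (Fin 5) (Fin 5) ℝ) :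
    ((A * B)ᵀ * C).trace = ∑ k, ∑ l, (∑ m, A k m * B m l) * C k l := by
  rw [trace_transpose_mul, Fintype.sum_prod_type]
  simp only [Matrix.mul_apply]

/-- The trilinear form `⟪x₃, V₁ x₂⟫`, where `V₁` is the vertical part of `w₁` and `x₂`, `x₃` are
the horizontal parts of `w₂`, `w₃`. -/
def baseTriple (w₁ w₂ w₃ : Fin 4 → ℂ) : ℝ :=
  baseDHopf w₃ ⬝ᵥ (baseVert w₁ *ᵥ baseDHopf w₂)

/-- In this trace and the following ones only the terms with one vertical and two horizontal
arguments survive, so each is a combination of values of `baseTriple`. -/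
lemma trace_baseDJ_baseDN (w₁ w₂ w₃ : Fin 4 → ℂ) :
    ((baseDJ w₁ * baseDN w₂)ᵀ * baseDN w₃).trace = baseTriple w₁ w₂ w₃ := by
  rw [trace_mul, baseDJ_eq]
  simp [Fin.sum_univ_five, baseDN, baseVert, baseDHopf, dotProduct, Matrix.mulVec, baseTriple]
  ring

lemma trace_baseDN_baseDJ (w₁ w₂ w₃ : Fin 4 → ℂ) :
    ((baseDN w₂ * baseDJ w₁)ᵀ * baseDN w₃).trace = -baseTriple w₁ w₂ w₃ := by
  rw [trace_mul, baseDJ_eq]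
  simp [Fin.sum_univ_five, baseDN, baseVert, baseDHopf, dotProduct, Matrix.mulVec, baseTriple]
  ring

lemma trace_baseDJ_baseDJ (w₁ w₂ w₃ : Fin 4 → ℂ) :
    ((baseDJ w₁ * baseDJ w₂)ᵀ * baseDJ w₃).trace =
      -(baseTriple w₁ w₂ w₃ + baseTriple w₂ w₃ w₁ - baseTriple w₃ w₂ w₁) := by
  rw [trace_mul, baseDJ_eq, baseDJ_eq, baseDJ_eq]
  simp [Fin.sum_univ_five, baseVert, baseDHopf, dotProduct, Matrix.mulVec, baseTriple]
  ring

lemma trace_baseDJ_baseDJ_baseN (w₁ w₂ w₃ : Fin 4 → ℂ) :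
    ((baseDJ w₁ * baseDJ w₂ * baseN)ᵀ * baseDJ w₃).trace = -baseTriple w₁ w₂ w₃ := by
  rw [trace_mul_mul_baseN, baseDJ_eq, baseDJ_eq, baseDJ_eq]
  simp [Fin.sum_univ_five, baseVert, baseDHopf, dotProduct, Matrix.mulVec, baseTriple]
  ring

lemma trace_baseN_baseDJ_baseDJ (w₁ w₂ w₃ : Fin 4 → ℂ) :
    ((baseN * baseDJ w₂ * baseDJ w₁)ᵀ * baseDJ w₃).trace = baseTriple w₁ w₂ w₃ := by
  rw [trace_baseN_mul_mul, baseDJ_eq, baseDJ_eq, baseDJ_eq]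
  simp [Fin.sum_univ_five, baseVert, baseDHopf, dotProduct, Matrix.mulVec, baseTriple]
  ring

lemma trace_baseJ_baseDJ_baseDN (w₁ w₂ w₃ : Fin 4 → ℂ) :
    ((baseJ * baseDJ w₂ * baseDN w₁)ᵀ * baseDJ w₃).trace =
      baseTriple w₂ w₃ w₁ - baseTriple w₃ w₂ w₁ := by
  have h : ∀ A B C : Matrix (Fin 5) (Fin 5) ℝ, ((baseJ * A * B)ᵀ * C).trace =
      -((A * B)ᵀ * (baseJ * C)).trace := by
    intro A B C
    rw [Matrix.mul_assoc, Matrix.transpose_mul, baseJ_transpose, Matrix.mul_neg, Matrix.neg_mul,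
      Matrix.trace_neg, Matrix.mul_assoc]
  rw [h, trace_mul, baseDJ_eq, baseDJ_eq]
  simp only [baseJ_mul_apply]
  simp [Fin.sum_univ_five, baseDN, baseVert, baseDHopf, dotProduct, Matrix.mulVec, baseTriple]
  ring

lemma trace_baseDN_baseDJ_baseJ (w₁ w₂ w₃ : Fin 4 → ℂ) :
    ((baseDN w₁ * baseDJ w₂ * baseJ)ᵀ * baseDJ w₃).trace =
      baseTriple w₃ w₂ w₁ - baseTriple w₂ w₃ w₁ := by
  have h : ∀ A B C : Matrix (Fin 5) (Fin 5) ℝ, ((A * B * baseJ)ᵀ * C).trace =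
      -((A * B)ᵀ * (C * baseJ)).trace := by
    intro A B C
    rw [Matrix.transpose_mul, baseJ_transpose, Matrix.neg_mul, Matrix.neg_mul, Matrix.trace_neg,
      Matrix.mul_assoc, Matrix.trace_mul_comm, Matrix.mul_assoc]
  rw [h, trace_mul, baseDJ_eq, baseDJ_eq]
  simp only [mul_baseJ_apply]
  simp [Fin.sum_univ_five, baseDN, baseVert, baseDHopf, dotProduct, Matrix.mulVec, baseTriple]
  ring

lemma nkTensor_baseVec (α β ε : ℝ) {w₁ w₂ w₃ : Fin 4 → ℂ} (h₁ : w₁ 0 = 0) (h₂ : w₂ 0 = 0)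
    (h₃ : w₃ 0 = 0) : nkTensor α β ε (CP3.proj baseVec) (CP3.dproj baseVec w₁)
      (CP3.dproj baseVec w₂) (CP3.dproj baseVec w₃) =
      α * baseTriple w₁ w₂ w₃ -
        β * (ε * (baseTriple w₁ w₂ w₃ + baseTriple w₂ w₃ w₁ - baseTriple w₃ w₂ w₁) +
          (2 - ε) * (baseTriple w₁ w₂ w₃ - baseTriple w₂ w₃ w₁ + baseTriple w₃ w₂ w₁)) := by
  have hs : ∀ w w' w'', baseTriple w w' w'' = -baseTriple w w'' w' := by
    intro w w' w''
    simp [baseVert, baseDHopf, dotProduct, Matrix.mulVec, baseTriple, Fin.sum_univ_five]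
    ring
  rw [nkTensor, twistorN_proj_baseVec, twistorJ_proj_baseVec, dMatrix_twistorN_baseVec h₁,
    dMatrix_twistorN_baseVec h₂, dMatrix_twistorN_baseVec h₃, dMatrix_twistorJ_baseVec h₁,
    dMatrix_twistorJ_baseVec h₂, dMatrix_twistorJ_baseVec h₃]
  simp only [nkOp, Matrix.transpose_add, Matrix.transpose_sub, Matrix.transpose_smul,
    Matrix.add_mul, Matrix.sub_mul, Matrix.smul_mul, Matrix.trace_add, Matrix.trace_sub,
    Matrix.trace_smul, smul_eq_mul, trace_baseDJ_baseDN, trace_baseDN_baseDJ, trace_baseDJ_baseDJ,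
    trace_baseDJ_baseDJ_baseN, trace_baseN_baseDJ_baseDJ, trace_baseJ_baseDJ_baseDN,
    trace_baseDN_baseDJ_baseJ]
  rw [hs w₁ w₃ w₂, hs w₂ w₁ w₃, hs w₃ w₁ w₂]
  ring


/-! ### The covariant derivative of the almost complex structure -/

section AlmostHermitian

variable {E : Type*} [NormedAddCommGroup E] [NormedSpace ℝ E]
  {M : Type*} [TopologicalSpace M] [ChartedSpace E M] [IsManifold 𝓘(ℝ, E) ∞ M]

lemma AlmostHermitian.diffFieldAt_J (S : AlmostHermitian E M)
    {Y : ∀ x : M, TangentSpace 𝓘(ℝ, E) x} {x : M} (hY : DiffFieldAt Y x) :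
    DiffFieldAt (fun y => S.J y (Y y)) x :=
  MDifferentiableAt.clm_bundle_apply (F₁ := E) (F₂ := E) (E₁ := fun x : M => TangentSpace 𝓘(ℝ, E) x)
    (E₂ := fun x : M => TangentSpace 𝓘(ℝ, E) x) (b := fun y : M => y)
    ((S.smooth_J x).mdifferentiableAt (by simp)) hY

lemma AlmostHermitian.inner_J_left (S : AlmostHermitian E M) (x : M)
    (u v : TangentSpace 𝓘(ℝ, E) x) : S.g.inner x (S.J x u) v = -S.g.inner x u (S.J x v) := by
  rw [← S.compat x u (S.J x v), S.J_sq, map_neg, neg_neg]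

end AlmostHermitian

/-- The matrix-valued function `A` is differentiable at `p`. -/
def MatrixDiffAt (A : CP3 → Matrix (Fin 5) (Fin 5) ℝ) (p : CP3) : Prop :=
  ∀ k l, MDifferentiableAt 𝓘(ℝ, Fin 3 → ℂ) 𝓘(ℝ, ℝ) (fun q => A q k l) p

section MatrixDiffAt

variable {A B : CP3 → Matrix (Fin 5) (Fin 5) ℝ} {p : CP3}

lemma MatrixDiffAt.mul (hA : MatrixDiffAt A p) (hB : MatrixDiffAt B p) :
    MatrixDiffAt (fun q => A q * B q) p := by
  intro k l
  have h : (fun q => (A q * B q) k l) = ∑ m, fun q => A q k m * B q m l := by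
    ext q; rw [Matrix.mul_apply, Finset.sum_apply]
  rw [h]
  exact MDifferentiableAt.sum fun m _ => (hA k m).mul (hB m l)

lemma MatrixDiffAt.sub (hA : MatrixDiffAt A p) (hB : MatrixDiffAt B p) :
    MatrixDiffAt (fun q => A q - B q) p := fun k l => (hA k l).sub (hB k l)

lemma MatrixDiffAt.add (hA : MatrixDiffAt A p) (hB : MatrixDiffAt B p) :
    MatrixDiffAt (fun q => A q + B q) p := fun k l => (hA k l).add (hB k l)

lemma MatrixDiffAt.const_smul (c : ℝ) (hA : MatrixDiffAt A p) :
    MatrixDiffAt (fun q => c • A q) p := fun k l => mdifferentiableAt_const.mul (hA k l)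

lemma dMatrix_mul (hA : MatrixDiffAt A p) (hB : MatrixDiffAt B p)
    (u : TangentSpace 𝓘(ℝ, Fin 3 → ℂ) p) :
    dMatrix (fun q => A q * B q) p u = dMatrix A p u * B p + A p * dMatrix B p u := by
  ext k l
  have h : (fun q => (A q * B q) k l) = fun q => ∑ m, A q k m * B q m l := by
    ext q; rw [Matrix.mul_apply]
  change mvfderiv 𝓘(ℝ, Fin 3 → ℂ) (fun q => (A q * B q) k l) p u = _
  rw [h, mvfderiv_sum (f := fun m q => A q k m * B q m l) Finset.univ
    (fun m => (hA k m).mul (hB m l)), Matrix.add_apply, Matrix.mul_apply, Matrix.mul_apply,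
    ← Finset.sum_add_distrib]
  refine Finset.sum_congr rfl fun m _ => ?_
  rw [mvfderiv_fun_mul_apply (hA k m) (hB m l)]
  simp only [dMatrix, Matrix.of_apply]
  ring

lemma dMatrix_sub_fun (hA : MatrixDiffAt A p) (hB : MatrixDiffAt B p)
    (u : TangentSpace 𝓘(ℝ, Fin 3 → ℂ) p) :
    dMatrix (fun q => A q - B q) p u = dMatrix A p u - dMatrix B p u := by
  ext k l
  exact DFunLike.congr_fun (mvfderiv_fun_sub (hA k l) (hB k l)) u

lemma dMatrix_add_fun (hA : MatrixDiffAt A p) (hB : MatrixDiffAt B p)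
    (u : TangentSpace 𝓘(ℝ, Fin 3 → ℂ) p) :
    dMatrix (fun q => A q + B q) p u = dMatrix A p u + dMatrix B p u := by
  ext k l
  exact DFunLike.congr_fun (mvfderiv_fun_add (hA k l) (hB k l)) u

lemma dMatrix_smul_fun (c : ℝ) (hA : MatrixDiffAt A p) (u : TangentSpace 𝓘(ℝ, Fin 3 → ℂ) p) :
    dMatrix (fun q => c • A q) p u = c • dMatrix A p u := by
  ext k l
  exact mvfderiv_const_mul_apply c (hA k l) u

end MatrixDiffAt

lemma trace_commutator {j : Matrix (Fin 5) (Fin 5) ℝ} (hj : jᵀ = -j)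
    (X Y : Matrix (Fin 5) (Fin 5) ℝ) :
    ((j * X - X * j)ᵀ * Y).trace = -(Xᵀ * (j * Y - Y * j)).trace := by
  have h : (Xᵀ * (Y * j)).trace = (j * Xᵀ * Y).trace := by
    rw [← Matrix.mul_assoc, Matrix.trace_mul_comm, Matrix.mul_assoc]
  simp only [Matrix.transpose_sub, Matrix.transpose_mul, hj, Matrix.mul_neg, Matrix.neg_mul,
    Matrix.sub_mul, Matrix.mul_sub, Matrix.trace_sub, Matrix.trace_neg, h]
  rw [Matrix.mul_assoc Xᵀ j Y]
  ring

/-- Skewness comes from `jᵀ = -j` and `Nᵀ = N`. With `trace_commutator` it makes the ambient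
extension of `J` skew on the whole flat space, and not only on tangent vectors. -/
lemma trace_twistOp (ε : ℝ) {j N : Matrix (Fin 5) (Fin 5) ℝ} (hj : jᵀ = -j) (hN : Nᵀ = N)
    (X Y : Matrix (Fin 5) (Fin 5) ℝ) :
    ((twistOp ε j N X)ᵀ * Y).trace = -(Xᵀ * twistOp ε j N Y).trace := by
  have h : ((j * X * N - N * X * j)ᵀ * Y).trace =
      -(Xᵀ * (j * Y * N - N * Y * j)).trace := by
    have h1 : (Xᵀ * (j * Y * N)).trace = (N * (Xᵀ * j) * Y).trace := by
      rw [← Matrix.mul_assoc, ← Matrix.mul_assoc, Matrix.trace_mul_comm]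
      simp only [Matrix.mul_assoc]
    have h2 : (Xᵀ * (N * Y * j)).trace = (j * (Xᵀ * N) * Y).trace := by
      rw [← Matrix.mul_assoc, ← Matrix.mul_assoc, Matrix.trace_mul_comm]
      simp only [Matrix.mul_assoc]
    simp only [Matrix.transpose_sub, Matrix.transpose_mul, hj, hN, Matrix.mul_neg, Matrix.neg_mul,
      Matrix.sub_mul, Matrix.mul_sub, Matrix.trace_sub, Matrix.trace_neg, h1, h2]
    ring
  simp only [twistOp, Matrix.transpose_add, Matrix.transpose_smul, Matrix.add_mul, Matrix.smul_mul,
    Matrix.mul_add, Matrix.mul_smul, Matrix.trace_add, Matrix.trace_smul, trace_commutator hj, h,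
    smul_eq_mul]
  ring

lemma twistorN_transpose (p : CP3) : (twistorN p)ᵀ = twistorN p := by
  ext k l
  simp [twistorN, Matrix.vecMulVec_apply, mul_comm]

lemma dMatrix_smul (m : CP3 → Matrix (Fin 5) (Fin 5) ℝ) (p : CP3) (c : ℝ)
    (u : TangentSpace 𝓘(ℝ, Fin 3 → ℂ) p) : dMatrix m p (c • u) = c • dMatrix m p u := by
  ext k l
  exact map_smul (mvfderiv 𝓘(ℝ, Fin 3 → ℂ) (fun q => m q k l) p) c u

lemma secondForm_twistorCoord (α β : ℝ) (Y : ∀ p : CP3, TangentSpace 𝓘(ℝ, Fin 3 → ℂ) p) (p : CP3)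
    (u w : TangentSpace 𝓘(ℝ, Fin 3 → ℂ) p) :
    secondForm (twistorWeight α β) twistorCoord Y p u w =
      α / 2 * ((dMatrix (fun q => dMatrix twistorN q (Y q)) p u)ᵀ * dMatrix twistorN p w).trace +
        β * ((dMatrix (fun q => dMatrix twistorJ q (Y q)) p u)ᵀ * dMatrix twistorJ p w).trace :=
  sum_twistorWeight α β _ _

/-- The derivative of the almost complex structure of a twistor type almost Hermitian structure. -/
theorem inner_covDerivJ {α β ε σ : ℝ} (hσ : σ * σ = 1) (S : AlmostHermitian (Fin 3 → ℂ) CP3)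
    (hg : ∀ p u v, S.g.inner p u v = twistorForm α β p u v)
    (hJ : ∀ p u, IsTwist ε p u (σ • S.J p u))
    {D : CovariantDerivative 𝓘(ℝ, Fin 3 → ℂ) (Fin 3 → ℂ)
      (fun p : CP3 => TangentSpace 𝓘(ℝ, Fin 3 → ℂ) p)} (hD : IsLeviCivita S.g D)
    {Y : ∀ p : CP3, TangentSpace 𝓘(ℝ, Fin 3 → ℂ) p} {p : CP3} (hY : DiffFieldAt Y p)
    (u w : TangentSpace 𝓘(ℝ, Fin 3 → ℂ) p) :
    S.g.inner p (covDerivJ D S.J Y p u) w = σ * nkTensor α β ε p u (Y p) w := by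
  have hind := isInducedMetric_of_twistorForm hg
  have hN : ∀ q v, dMatrix twistorN q (S.J q v) =
      σ • (twistorJ q * dMatrix twistorN q v - dMatrix twistorN q v * twistorJ q) := by
    intro q v
    rw [← (hJ q v).dN, dMatrix_smul, smul_smul, hσ, one_smul]
  have hJ' : ∀ q v, dMatrix twistorJ q (S.J q v) =
      σ • twistOp ε (twistorJ q) (twistorN q) (dMatrix twistorJ q v) := by
    intro q v
    rw [← (hJ q v).dJ, dMatrix_smul, smul_smul, hσ, one_smul]
  set B := fun q => dMatrix twistorN q (Y q) with hB
  set A := fun q => dMatrix twistorJ q (Y q) with hA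
  have dB : MatrixDiffAt B p := fun k l =>
    mdifferentiableAt_fieldDeriv (contMDiff_twistorN k l) hY
  have dA : MatrixDiffAt A p := fun k l =>
    mdifferentiableAt_fieldDeriv (contMDiff_twistorJ k l) hY
  have dj : MatrixDiffAt twistorJ p :=
    fun k l => (contMDiff_twistorJ k l p).mdifferentiableAt (by simp)
  have dn : MatrixDiffAt twistorN p :=
    fun k l => (contMDiff_twistorN k l p).mdifferentiableAt (by simp)
  -- By the Leibniz rule, one group of terms contains the second derivatives of the embedding along
  -- `u` and `Y`, the other the derivatives of the coefficients of the ambient operator.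
  have e1 : dMatrix (fun q => dMatrix twistorN q (S.J q (Y q))) p u =
      σ • ((twistorJ p * dMatrix B p u - dMatrix B p u * twistorJ p) +
        (dMatrix twistorJ p u * B p - B p * dMatrix twistorJ p u)) := by
    have h1 := dj.mul dB
    have h2 := dB.mul dj
    have h : (fun q => dMatrix twistorN q (S.J q (Y q))) =
        fun q => σ • (twistorJ q * B q - B q * twistorJ q) := funext fun q => hN q (Y q)
    rw [h, dMatrix_smul_fun σ (h1.sub h2), dMatrix_sub_fun h1 h2,
      dMatrix_mul dj dB, dMatrix_mul dB dj]
    congr 1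
    abel
  have e2 : dMatrix (fun q => dMatrix twistorJ q (S.J q (Y q))) p u =
      σ • (twistOp ε (twistorJ p) (twistorN p) (dMatrix A p u) +
        nkOp ε (twistorJ p) (twistorN p) (dMatrix twistorN p u) (dMatrix twistorJ p u) (A p)) := by
    have h1 := dj.mul dA
    have h2 := dA.mul dj
    have h3 := h1.mul dn
    have h4' := dn.mul dA
    have h4 := h4'.mul dj
    have h : (fun q => dMatrix twistorJ q (S.J q (Y q))) =
        fun q => σ • ((ε / 2) • (twistorJ q * A q - A q * twistorJ q) + (1 - ε / 2) •
          (twistorJ q * A q * twistorN q - twistorN q * A q * twistorJ q)) :=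
      funext fun q => hJ' q (Y q)
    have h5 := (h1.sub h2).const_smul (ε / 2)
    have h6 := (h3.sub h4).const_smul (1 - ε / 2)
    rw [h, dMatrix_smul_fun σ (h5.add h6), dMatrix_add_fun h5 h6,
      dMatrix_smul_fun _ (h1.sub h2),
      dMatrix_smul_fun _ (h3.sub h4), dMatrix_sub_fun h1 h2,
      dMatrix_sub_fun h3 h4, dMatrix_mul h1 dn, dMatrix_mul h4' dj, dMatrix_mul dj dA,
      dMatrix_mul dA dj, dMatrix_mul dn dA, twistOp, nkOp]
    congr 1
    simp only [Matrix.add_mul, smul_sub, smul_add]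
    abel
  rw [covDerivJ, metric_sub_left, S.inner_J_left, hD.inner_eq hind contMDiff_twistorCoord
    (S.diffFieldAt_J hY), hD.inner_eq hind contMDiff_twistorCoord hY, secondForm_twistorCoord,
    secondForm_twistorCoord, e1, e2, hN, hJ', nkTensor]
  -- By skewness, the second derivatives in `D_u (J Y)` cancel those in `J (D_u Y)`; the remaining
  -- terms form `nkTensor`.
  have t1 := trace_commutator (twistorJ_transpose p) (dMatrix B p u) (dMatrix twistorN p w)
  have t2 := trace_twistOp ε (twistorJ_transpose p) (twistorN_transpose p) (dMatrix A p u)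
    (dMatrix twistorJ p w)
  simp only [Matrix.transpose_add, Matrix.transpose_smul, Matrix.add_mul, Matrix.smul_mul,
    Matrix.mul_smul, Matrix.trace_add, Matrix.trace_smul, smul_eq_mul, t1, t2]
  ring


lemma exists_diffFieldAt_eq (p : CP3) (u : TangentSpace 𝓘(ℝ, Fin 3 → ℂ) p) :
    ∃ Y : ∀ p : CP3, TangentSpace 𝓘(ℝ, Fin 3 → ℂ) p, DiffFieldAt Y p ∧ Y p = u :=
  ⟨FiberBundle.extend (Fin 3 → ℂ) u, FiberBundle.mdifferentiableAt_extend .., 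
    FiberBundle.extend_apply_self (Fin 3 → ℂ) u⟩

lemma baseTriple_antisymm (w₁ w₂ w₃ : Fin 4 → ℂ) :
    baseTriple w₁ w₂ w₃ = -baseTriple w₁ w₃ w₂ := by
  simp [baseVert, baseDHopf, dotProduct, Matrix.mulVec, baseTriple, Fin.sum_univ_five]
  ring

/-- For equal first arguments, with `T` for `baseTriple`, antisymmetry in the last two arguments
gives `T(w', w, w) = 0` and `T(w, w', w) = -T(w, w, w')`. The bracket with factor `ε` vanishes and
the one with factor `2 - ε` doubles. -/
lemma nkTensor_baseVec_self (α β ε : ℝ) {w w' : Fin 4 → ℂ} (hw : w 0 = 0) (hw' : w' 0 = 0) :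
    nkTensor α β ε (CP3.proj baseVec) (CP3.dproj baseVec w)
      (CP3.dproj baseVec w) (CP3.dproj baseVec w') =
      (α - 2 * (2 - ε) * β) * baseTriple w w w' := by
  have h := baseTriple_antisymm w' w w
  rw [nkTensor_baseVec _ _ _ hw hw hw', baseTriple_antisymm w w' w]
  linear_combination β * (ε - 1) * h

lemma nkTensor_self {α β ε : ℝ} (h : α = 2 * (2 - ε) * β) (p : CP3)
    (u v : TangentSpace 𝓘(ℝ, Fin 3 → ℂ) p) : nkTensor α β ε p u u v = 0 := by
  refine tangent_induction_two (P := fun p u v => nkTensor α β ε p u u v = 0) ?_ ?_ p u v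
  · intro w w' hw hw'
    rw [nkTensor_baseVec_self _ _ _ hw hw', h]
    ring
  · intro a p u v h
    rw [nkTensor_dAct, h]

/-- For `β > 0` this is the Kähler case: `α = 2 β` makes the vertical and horizontal coefficients of
the metric equal, as for `g₂`, and the structure is multiplication by `i`. -/
lemma nkTensor_eq_zero (β : ℝ) (p : CP3) (u v w : TangentSpace 𝓘(ℝ, Fin 3 → ℂ) p) :
    nkTensor (2 * β) β 1 p u v w = 0 := by
  refine tangent_induction (κ := Fin 3) (P := fun p u => nkTensor (2 * β) β 1 p (u 0) (u 1) (u 2)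
    = 0) ?_ ?_ p ![u, v, w]
  · intro w hw
    rw [nkTensor_baseVec _ _ _ (hw 0) (hw 1) (hw 2)]
    ring
  · intro a p u h
    rw [nkTensor_dAct, h]

lemma isStrictlyNearlyKahler_twistorStructure : twistorStructure.IsStrictlyNearlyKahler := by
  have hg : ∀ p u v, twistorStructure.g.inner p u v = twistorForm (3 / 4) (1 / 8) p u v :=
    twistorMetric_inner
  have hJ : ∀ p u, IsTwist (-1) p u ((1 : ℝ) • twistorStructure.J p u) := by
    intro p u
    rw [one_smul]
    exact isTwist_jMinus p u
  have hD := isLeviCivita_inducedConnection twistorStructure.g (isInducedMetric_of_twistorForm hg)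
    contMDiff_twistorCoord
  refine ⟨_, hD, fun X x hX => ?_, ?_⟩
  · refine ext_inner twistorStructure.g fun w => ?_
    rw [inner_covDerivJ (one_mul 1) _ hg hJ hD hX, nkTensor_self (by norm_num)]
    simp
  · obtain ⟨Y, hY, hY0⟩ := exists_diffFieldAt_eq (CP3.proj baseVec)
      (CP3.dproj baseVec ![0, 0, 1, 0])
    -- On this vertical vector and the two horizontal ones `baseTriple` is `8` and its cyclic
    -- companions vanish, so the tensor has the value `8 (α - 2 β) = 4`.
    refine ⟨Y, CP3.proj baseVec, CP3.dproj baseVec ![0, 1, 0, 0], hY, fun h => ?_⟩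
    have h1 := inner_covDerivJ (one_mul 1) _ hg hJ hD hY (CP3.dproj baseVec ![0, 1, 0, 0])
      (CP3.dproj baseVec ![0, 0, 0, Complex.I])
    rw [h, hY0, nkTensor_baseVec _ _ _ rfl rfl rfl] at h1
    simp [baseTriple, baseVert, baseDHopf, dotProduct, Matrix.mulVec, Fin.sum_univ_five] at h1
    norm_num at h1


/-! ### The isotropy representation -/

/-- The tangent vector at the base point with affine coordinates `(z₁, z₂, z₃)`. -/
def baseTangent (z : Fin 3 → ℂ) : TangentSpace 𝓘(ℝ, Fin 3 → ℂ) (CP3.proj baseVec) :=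
  CP3.dproj baseVec ![0, z 0, z 1, z 2]

lemma baseTangent_add (z z' : Fin 3 → ℂ) :
    baseTangent (z + z') = baseTangent z + baseTangent z' := by
  rw [baseTangent, baseTangent, baseTangent, ← map_add]
  simp

lemma baseTangent_smul (r : ℝ) (z : Fin 3 → ℂ) : baseTangent (r • z) = r • baseTangent z := by
  rw [baseTangent, baseTangent, ← map_smul]
  simp

lemma dproj_baseVec {w : Fin 4 → ℂ} (hw : w 0 = 0) :
    CP3.dproj baseVec w = baseTangent ![w 1, w 2, w 3] := by
  rw [baseTangent]
  congr 1
  ext k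
  fin_cases k <;> simp [hw]

lemma exists_baseTangent (u : TangentSpace 𝓘(ℝ, Fin 3 → ℂ) (CP3.proj baseVec)) :
    ∃ z, baseTangent z = u := by
  obtain ⟨w, hw, rfl⟩ := exists_dproj_baseVec u
  exact ⟨_, (dproj_baseVec hw).symm⟩

lemma baseTangent_injective : Function.Injective baseTangent := by
  intro z z' h
  have h1 := dMatrix_twistorJ_baseVec (w := ![0, z 0, z 1, z 2]) rfl
  have h2 := dMatrix_twistorJ_baseVec (w := ![0, z' 0, z' 1, z' 2]) rfl
  have h3 : baseDJ ![0, z 0, z 1, z 2] = baseDJ ![0, z' 0, z' 1, z' 2] := by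
    rw [← h1, ← h2]
    exact congrArg (dMatrix twistorJ (CP3.proj baseVec)) h
  rw [baseDJ_eq, baseDJ_eq] at h3
  have e1 := congrFun (congrFun h3 0) 2
  have e2 := congrFun (congrFun h3 0) 3
  have e3 := congrFun (congrFun h3 0) 4
  have e4 := congrFun (congrFun h3 1) 4
  have e5 := congrFun (congrFun h3 2) 4
  have e6 := congrFun (congrFun h3 3) 4
  simp at e1 e2 e3 e4 e5 e6
  ext k
  fin_cases k <;> simp [Complex.ext_iff, *]

section Isotropy

variable {α κ : Type*} {Φ : ∀ p : CP3, (κ → TangentSpace 𝓘(ℝ, Fin 3 → ℂ) p) → α}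

/-- The function `Φ` of families of tangent vectors is invariant under `Sp(2)`. -/
def IsActInvariant (Φ : ∀ p : CP3, (κ → TangentSpace 𝓘(ℝ, Fin 3 → ℂ) p) → α) : Prop :=
  ∀ (a : Sp2) (p : CP3) (u : κ → TangentSpace 𝓘(ℝ, Fin 3 → ℂ) p),
    Φ (a • p) (fun i => dAct a p (u i)) = Φ p u

/-- The matrix `diag(u, q)` multiplies the base vector by `u`, so the other homogeneous coordinates
are divided by `u`. The second one already carries the factor `ū`, whence the weight 2. -/
lemma isotropy_apply (hΦ : IsActInvariant Φ) (x : Circle × Matrix.specialUnitaryGroup (Fin 2) ℂ) 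
    (z : κ → Fin 3 → ℂ) :
    Φ (CP3.proj baseVec) (fun i => baseTangent ![conj (x.1 : ℂ) ^ 2 * z i 0,
      conj (x.1 : ℂ) * (x.2.1 0 0 * z i 1 + x.2.1 0 1 * z i 2),
      conj (x.1 : ℂ) * (x.2.1 1 0 * z i 1 + x.2.1 1 1 * z i 2)]) =
    Φ (CP3.proj baseVec) (fun i => baseTangent (z i)) := by
  obtain ⟨a, ha⟩ := isotropyMatrix_unitary x
  have hx : (x.1 : ℂ) ≠ 0 := x.1.coe_ne_zero
  have hx1 : (x.1 : ℂ) * conj (x.1 : ℂ) = 1 := by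
    rw [Complex.mul_conj, Circle.normSq_coe, Complex.ofReal_one]
  have h1 := hΦ a (CP3.proj baseVec) (fun i => baseTangent (z i))
  have h2 := CP3.mfderiv_smul_dproj Φ a baseVec_ne_zero (fun i => ![0, z i 0, z i 1, z i 2])
  have h3 : sp2Matrix a *ᵥ baseVec = (x.1 : ℂ) • baseVec := by
    rw [ha]
    ext k
    fin_cases k <;> simp [isotropyMatrix, baseVec, Matrix.mulVec, dotProduct, Fin.sum_univ_four]
  have h4 : ∀ i, sp2Matrix a *ᵥ ![0, z i 0, z i 1, z i 2] = (x.1 : ℂ) •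
      ![0, conj (x.1 : ℂ) ^ 2 * z i 0, conj (x.1 : ℂ) * (x.2.1 0 0 * z i 1 + x.2.1 0 1 * z i 2),
        conj (x.1 : ℂ) * (x.2.1 1 0 * z i 1 + x.2.1 1 1 * z i 2)] := by
    intro i
    rw [ha]
    ext k
    fin_cases k <;>
      simp [isotropyMatrix, Matrix.mulVec, dotProduct, Fin.sum_univ_four, ← mul_assoc, pow_two, hx1]
  simp only [h4] at h2
  rw [h3] at h2
  rw [CP3.dproj_smul Φ hx baseVec_ne_zero] at h2
  exact h2.symm.trans h1

/-- Together with `isotropy_swap` and `isotropy_diag`, this is all of the isotropy group that the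
classification uses. -/
lemma isotropy_circle (hΦ : IsActInvariant Φ) {c : ℂ} (hc : ‖c‖ = 1) (z : κ → Fin 3 → ℂ) :
    Φ (CP3.proj baseVec) (fun i => baseTangent ![c ^ 2 * z i 0, c * z i 1, c * z i 2]) =
    Φ (CP3.proj baseVec) (fun i => baseTangent (z i)) := by
  have h := isotropy_apply hΦ (⟨conj c, mem_sphere_zero_iff_norm.2 (by simp [hc])⟩, 1) z
  simpa using h

lemma isotropy_swap (hΦ : IsActInvariant Φ) (z : κ → Fin 3 → ℂ) :
    Φ (CP3.proj baseVec) (fun i => baseTangent ![z i 0, -z i 2, z i 1]) =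
    Φ (CP3.proj baseVec) (fun i => baseTangent (z i)) := by
  have h := isotropy_apply hΦ (1, ⟨!![0, -1; 1, 0], by
    rw [Matrix.mem_specialUnitaryGroup_iff, Matrix.mem_unitaryGroup_iff]
    constructor
    · ext k l
      fin_cases k <;> fin_cases l <;> simp [Matrix.mul_apply, Fin.sum_univ_two]
    · simp [Matrix.det_fin_two]⟩) z
  simpa using h

lemma isotropy_diag (hΦ : IsActInvariant Φ) (z : κ → Fin 3 → ℂ) :
    Φ (CP3.proj baseVec) (fun i => baseTangent ![-z i 0, z i 1, -z i 2]) =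
    Φ (CP3.proj baseVec) (fun i => baseTangent (z i)) := by
  have h := isotropy_apply hΦ (⟨Complex.I, mem_sphere_zero_iff_norm.2 (by simp)⟩,
    ⟨!![Complex.I, 0; 0, -Complex.I], by
    rw [Matrix.mem_specialUnitaryGroup_iff, Matrix.mem_unitaryGroup_iff]
    constructor
    · ext k l
      fin_cases k <;> fin_cases l <;> simp [Matrix.mul_apply, Fin.sum_univ_two]
    · simp [Matrix.det_fin_two]⟩) z
  simpa [← mul_assoc] using h

end Isotropy


/-! ### Invariant forms and complex structures on `ℂ ⊕ ℂ²` -/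

section Linear

/-- Invariance under `i` makes `1` and `i` orthogonal and of equal square. -/
lemma form_eq_of_mul_I {f : ℂ → ℂ → ℝ} (hs : ∀ x y, f x y = f y x)
    (hadd : ∀ x y z, f (x + y) z = f x z + f y z) (hsmul : ∀ (r : ℝ) x y, f (r • x) y = r * f x y)
    (hI : ∀ x y, f (Complex.I * x) (Complex.I * y) = f x y) (x y : ℂ) :
    f x y = f 1 1 * (conj x * y).re := by
  have hx : ∀ x : ℂ, x = x.re • (1 : ℂ) + x.im • Complex.I := fun x => by simp
  have h1 := hI 1 1
  have h2 := hI 1 Complex.I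
  have h3 := hsmul (-1) 1 Complex.I
  simp only [mul_one, Complex.I_mul_I] at h1 h2
  rw [neg_smul, one_smul] at h3
  rw [hs Complex.I, h3] at h2
  have h4 : f 1 Complex.I = 0 := by linarith
  have h5 : ∀ z, f x z = x.re * f 1 z + x.im * f Complex.I z := fun z => by
    conv_lhs => rw [hx x]
    rw [hadd, hsmul, hsmul]
  have h6 : ∀ z, f z y = y.re * f z 1 + y.im * f z Complex.I := fun z => by
    rw [hs]
    conv_lhs => rw [hx y]
    rw [hadd, hsmul, hsmul, hs 1, hs Complex.I]
  rw [h5, h6, h6, hs Complex.I 1, h4, h1]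
  simp
  ring

lemma map_eq_mul_of_mul_I {f : ℂ → ℂ} (hadd : ∀ x y, f (x + y) = f x + f y)
    (hsmul : ∀ (r : ℝ) x, f (r • x) = r • f x) (hI : f Complex.I = Complex.I * f 1) (x : ℂ) :
    f x = f 1 * x := by
  have hx : x = x.re • (1 : ℂ) + x.im • Complex.I := by simp
  conv_lhs => rw [hx]
  rw [hadd, hsmul, hsmul, hI]
  conv_rhs => rw [hx]
  simp only [Complex.real_smul]
  ring

lemma exists_sq_eq_I : ∃ c : ℂ, c ^ 2 = Complex.I ∧ ‖c‖ = 1 := by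
  obtain ⟨c, hc⟩ := IsAlgClosed.exists_pow_nat_eq Complex.I (n := 2) (by norm_num)
  have h : ‖c‖ ^ 2 = 1 := by rw [← norm_pow, hc, Complex.norm_I]
  exact ⟨c, hc, (pow_eq_one_iff_of_nonneg (norm_nonneg c) two_ne_zero).1 h⟩

lemma eq_I_or_of_mul_self {c : ℂ} (h : c * c = -1) : c = Complex.I ∨ c = -Complex.I := by
  have : (c - Complex.I) * (c + Complex.I) = 0 := by
    linear_combination h - Complex.I_mul_I
  rcases mul_eq_zero.1 this with h | h
  · exact Or.inl (sub_eq_zero.1 h)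
  · exact Or.inr (eq_neg_of_add_eq_zero_left h)

/-- The real bilinear forms on `ℂ³` invariant under the isotropy representation. -/
lemma isotropy_form_eq {G : (Fin 3 → ℂ) → (Fin 3 → ℂ) → ℝ} (hs : ∀ x y, G x y = G y x)
    (hadd : ∀ x y z, G (x + y) z = G x z + G y z) (hsmul : ∀ (r : ℝ) x y, G (r • x) y = r * G x y)
    (hc : ∀ c : ℂ, ‖c‖ = 1 → ∀ x y,
      G ![c ^ 2 * x 0, c * x 1, c * x 2] ![c ^ 2 * y 0, c * y 1, c * y 2] = G x y)
    (hd : ∀ x y, G ![-x 0, x 1, -x 2] ![-y 0, y 1, -y 2] = G x y)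
    (hw : ∀ x y, G ![x 0, -x 2, x 1] ![y 0, -y 2, y 1] = G x y) (x y : Fin 3 → ℂ) :
    G x y = G ![1, 0, 0] ![1, 0, 0] * (conj (x 0) * y 0).re +
      G ![0, 1, 0] ![0, 1, 0] * ((conj (x 1) * y 1).re + (conj (x 2) * y 2).re) := by
  have hneg : ∀ x y, G x (-y) = -G x y := fun x y => by
    have h := hsmul (-1) y x
    rw [neg_smul, one_smul] at h
    rw [hs, h, hs]
    ring
  have hadd' : ∀ x y z, G x (y + z) = G x y + G x z := fun x y z => by
    rw [hs, hadd, hs, hs z]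
  -- The circle element `-1` acts trivially on the line of weight 2 and by `-1` on the plane of
  -- weight 1.
  have h1 : ∀ a b c, G ![a, 0, 0] ![0, b, c] = 0 := fun a b c => by
    have h := hc (-1) (by simp) ![a, 0, 0] ![0, b, c]
    have h' := hneg ![a, 0, 0] ![0, b, c]
    simp at h h'
    linarith
  -- The diagonal element fixes the first line of `ℂ²` and reverses the second.
  have h2 : ∀ b c, G ![0, b, 0] ![0, 0, c] = 0 := fun b c => by
    have h := hd ![0, b, 0] ![0, 0, c]
    have h' := hneg ![0, b, 0] ![0, 0, c]
    simp at h h'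
    linarith
  have e1 : ∀ a b, G ![a, 0, 0] ![b, 0, 0] = G ![1, 0, 0] ![1, 0, 0] * (conj a * b).re := by
    -- On the line of weight 2, multiplication by `i` comes from a square root of `i` in the circle.
    obtain ⟨c, hc2, hc1⟩ := exists_sq_eq_I
    refine form_eq_of_mul_I (f := fun a b => G ![a, 0, 0] ![b, 0, 0]) (fun a b => hs _ _)
      (fun a b c => ?_) (fun r a b => ?_) (fun a b => ?_)
    · rw [← hadd]; simp
    · rw [← hsmul]; simp
    · simpa [hc2] using hc c hc1 ![a, 0, 0] ![b, 0, 0]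
  have e2 : ∀ a b, G ![0, a, 0] ![0, b, 0] = G ![0, 1, 0] ![0, 1, 0] * (conj a * b).re := by
    refine form_eq_of_mul_I (f := fun a b => G ![0, a, 0] ![0, b, 0]) (fun a b => hs _ _)
      (fun a b c => ?_) (fun r a b => ?_) (fun a b => ?_)
    · rw [← hadd]; simp
    · rw [← hsmul]; simp
    · simpa using hc Complex.I (by simp) ![0, a, 0] ![0, b, 0]
  have e3 : ∀ a b, G ![0, 0, a] ![0, 0, b] = G ![0, a, 0] ![0, b, 0] := fun a b => by
    simpa using hw ![0, a, 0] ![0, b, 0]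
  have hx : ∀ x : Fin 3 → ℂ, x = ![x 0, 0, 0] + (![0, x 1, 0] + ![0, 0, x 2]) := fun x => by
    ext k
    fin_cases k <;> simp
  have h3 : ∀ a b c d, G ![0, b, 0] (![0, c, 0] + ![0, 0, d] + ![a, 0, 0]) =
      G ![0, b, 0] ![0, c, 0] := fun a b c d => by
    rw [hadd', hadd', h2, hs _ ![a, 0, 0], h1]
    ring
  have h4 : ∀ a b c d, G ![0, 0, b] (![0, c, 0] + ![0, 0, d] + ![a, 0, 0]) =
      G ![0, b, 0] ![0, d, 0] := fun a b c d => by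
    rw [hadd', hadd', hs _ ![0, c, 0], h2, hs _ ![a, 0, 0], h1, e3]
    ring
  have h5 : ∀ a b c d, G ![b, 0, 0] (![0, c, 0] + ![0, 0, d] + ![a, 0, 0]) =
      G ![b, 0, 0] ![a, 0, 0] := fun a b c d => by
    rw [hadd', hadd', h1, h1]
    ring
  conv_lhs => rw [hx x, hx y, hadd, hadd, add_comm ![y 0, 0, 0], h3, h4, h5, e1,
    e2 (x 1), e2 (x 2)]
  ring

/-- The complex structures on `ℂ³` commuting with the isotropy representation. -/
lemma isotropy_complex_structure_eq {K : (Fin 3 → ℂ) → (Fin 3 → ℂ)}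
    (hadd : ∀ x y, K (x + y) = K x + K y) (hsmul : ∀ (r : ℝ) x, K (r • x) = r • K x)
    (hK : ∀ x, K (K x) = -x)
    (hc : ∀ c : ℂ, ‖c‖ = 1 → ∀ x, K ![c ^ 2 * x 0, c * x 1, c * x 2] =
      ![c ^ 2 * K x 0, c * K x 1, c * K x 2])
    (hd : ∀ x, K ![-x 0, x 1, -x 2] = ![-K x 0, K x 1, -K x 2])
    (hw : ∀ x, K ![x 0, -x 2, x 1] = ![K x 0, -K x 2, K x 1]) :
    ∃ a b : ℂ, a * a = -1 ∧ b * b = -1 ∧ ∀ x, K x = ![a * x 0, b * x 1, b * x 2] := by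
  have hz : ∀ z : ℂ, z = -z → z = 0 := fun z h => by linear_combination h / 2
  have hneg : ∀ x, K (-x) = -K x := fun x => by
    have h := hsmul (-1) x
    rwa [neg_smul, one_smul, neg_smul, one_smul] at h
  -- The same elements separate the three coordinate lines, so `K` preserves each of them.
  have h1 : ∀ x, K ![x, 0, 0] = ![K ![x, 0, 0] 0, 0, 0] := fun x => by
    have h := hc (-1) (by simp) ![x, 0, 0]
    simp at h
    have h1 := congrFun h 1
    have h2 := congrFun h 2
    simp at h1 h2
    ext k
    fin_cases k
    · rfl
    · exact hz _ h1
    · exact hz _ h2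
  have h2 : ∀ x, K ![0, x, 0] = ![0, K ![0, x, 0] 1, 0] := fun x => by
    have h := hd ![0, x, 0]
    simp at h
    have h1 := congrFun h 0
    have h2 := congrFun h 2
    simp at h1 h2
    ext k
    fin_cases k
    · exact hz _ h1
    · rfl
    · exact hz _ h2
  have e1 : ∀ x, K ![x, 0, 0] 0 = K ![1, 0, 0] 0 * x := by
    obtain ⟨c, hc2, hc1⟩ := exists_sq_eq_I
    refine map_eq_mul_of_mul_I (f := fun x => K ![x, 0, 0] 0) (fun a b => ?_) (fun r a => ?_) ?_
    · rw [← Pi.add_apply, ← hadd]; simp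
    · rw [← Pi.smul_apply, ← hsmul]; simp
    · have h := congrFun (hc c hc1 ![1, 0, 0]) 0
      simpa [hc2] using h
  have e2 : ∀ x, K ![0, x, 0] 1 = K ![0, 1, 0] 1 * x := by
    refine map_eq_mul_of_mul_I (f := fun x => K ![0, x, 0] 1) (fun a b => ?_) (fun r a => ?_) ?_
    · rw [← Pi.add_apply, ← hadd]; simp
    · rw [← Pi.smul_apply, ← hsmul]; simp
    · have h := congrFun (hc Complex.I (by simp) ![0, 1, 0]) 1
      simpa using h
  have h3 : ∀ x, K ![0, 0, x] = ![0, 0, K ![0, 1, 0] 1 * x] := fun x => by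
    have h := hw ![0, x, 0]
    rw [h2, e2] at h
    generalize K ![0, 1, 0] 1 = b at h ⊢
    simpa using h
  refine ⟨K ![1, 0, 0] 0, K ![0, 1, 0] 1, ?_, ?_, fun x => ?_⟩
  · have h := congrFun (hK ![1, 0, 0]) 0
    rw [h1 1, e1] at h
    simpa using h
  · have h := congrFun (hK ![0, 1, 0]) 1
    rw [h2 1, e2] at h
    simpa using h
  · have hx : x = ![x 0, 0, 0] + (![0, x 1, 0] + ![0, 0, x 2]) := by
      ext k
      fin_cases k <;> simp
    conv_lhs => rw [hx, hadd, hadd, h1, h2, h3, e1, e2]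
    simp

end Linear


/-! ### Uniqueness of the nearly Kähler structure -/

section Uniqueness

variable {S : AlmostHermitian (Fin 3 → ℂ) CP3}

lemma AlmostHermitian.IsInvariant.inner_dAct (hS : S.IsInvariant Sp2) (a : Sp2) (p : CP3)
    (u v : TangentSpace 𝓘(ℝ, Fin 3 → ℂ) p) :
    S.g.inner (a • p) (dAct a p u) (dAct a p v) = S.g.inner p u v := (hS a p u v).1

lemma AlmostHermitian.IsInvariant.J_dAct (hS : S.IsInvariant Sp2) (a : Sp2) (p : CP3)
    (u : TangentSpace 𝓘(ℝ, Fin 3 → ℂ) p) :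
    S.J (a • p) (dAct a p u) = dAct a p (S.J p u) := (hS a p u u).2.symm

lemma AlmostHermitian.IsInvariant.dAct_injective (hS : S.IsInvariant Sp2) (a : Sp2) (p : CP3) :
    Function.Injective (dAct a p) := fun u v h => ext_inner S.g fun w => by
  rw [← hS.inner_dAct a, h, hS.inner_dAct]

lemma AlmostHermitian.IsInvariant.isActInvariant_inner (hS : S.IsInvariant Sp2) :
    IsActInvariant (κ := Bool) (fun p u => S.g.inner p (u true) (u false)) :=
  fun a p _ => hS.inner_dAct a p _ _

/-- Stating equivariance as the invariance of the relation `J u = v` brings it under the isotropy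
lemmas, which concern functions of tangent vectors at varying points. -/
lemma AlmostHermitian.IsInvariant.isActInvariant_J (hS : S.IsInvariant Sp2) :
    IsActInvariant (κ := Bool) (fun p u => S.J p (u true) = u false) := fun a p u => by
  change (S.J (a • p) (dAct a p (u true)) = dAct a p (u false)) = (S.J p (u true) = u false)
  rw [hS.J_dAct, (hS.dAct_injective a p).eq_iff]

lemma AlmostHermitian.IsInvariant.exists_twistorForm (hS : S.IsInvariant Sp2) :
    ∃ α β : ℝ, 0 < β ∧ ∀ p u v, S.g.inner p u v = twistorForm α β p u v := by
  have h := hS.isActInvariant_inner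
  have key := isotropy_form_eq (G := fun x y =>
    S.g.inner (CP3.proj baseVec) (baseTangent x) (baseTangent y)) (fun x y => S.g.symm _ _ _)
    (fun x y z => by rw [baseTangent_add, metric_add_left])
    (fun r x y => by rw [baseTangent_smul, metric_smul_left])
    (fun c hc x y => isotropy_circle h hc (fun i => cond i x y))
    (fun x y => isotropy_diag h (fun i => cond i x y))
    (fun x y => isotropy_swap h (fun i => cond i x y))
  set a := S.g.inner (CP3.proj baseVec) (baseTangent ![1, 0, 0]) (baseTangent ![1, 0, 0]) with ha
  set b := S.g.inner (CP3.proj baseVec) (baseTangent ![0, 1, 0]) (baseTangent ![0, 1, 0])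
  have hpos : 0 < a := S.g.pos _ _ fun h0 => by
    have h1 : baseTangent ![1, 0, 0] = baseTangent 0 := by
      rw [h0]
      have := baseTangent_smul 0 0
      simpa using this.symm
    simpa using congrFun (baseTangent_injective h1) 0
  -- The solution of `16 β = a` and `4 α + 8 β = b`; here `α` may be negative.
  refine ⟨(b - a / 2) / 4, a / 16, by positivity, fun p u v => ?_⟩
  refine tangent_induction_two (P := fun p u v => S.g.inner p u v =
    twistorForm ((b - a / 2) / 4) (a / 16) p u v) ?_ ?_ p u v
  · intro w w' hw hw'
    rw [twistorForm_baseVec _ _ hw hw', dproj_baseVec hw, dproj_baseVec hw', key]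
    simp only [Matrix.cons_val]
    ring
  · intro a p u v h
    rw [hS.inner_dAct, twistorForm_dAct, h]

lemma AlmostHermitian.IsInvariant.exists_isTwist (hS : S.IsInvariant Sp2) :
    ∃ ε σ : ℝ, (ε = 1 ∨ ε = -1) ∧ (σ = 1 ∨ σ = -1) ∧
      ∀ p u, IsTwist ε p u (σ • S.J p u) := by
  have h := hS.isActInvariant_J
  choose K hK using fun z => exists_baseTangent (S.J (CP3.proj baseVec) (baseTangent z))
  have hKc : ∀ z z', S.J (CP3.proj baseVec) (baseTangent z) = baseTangent z' → K z = z' :=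
    fun z z' h => baseTangent_injective ((hK z).trans h)
  obtain ⟨a, b, ha, hb, hab⟩ := isotropy_complex_structure_eq (K := K)
    (fun x y => hKc _ _ (by rw [baseTangent_add, baseTangent_add, map_add, hK, hK]))
    (fun r x => hKc _ _ (by rw [baseTangent_smul, baseTangent_smul, map_smul, hK]))
    (fun x => hKc _ _ (by
      have h := baseTangent_smul (-1) x
      rw [neg_smul, neg_smul, one_smul, one_smul] at h
      rw [hK, S.J_sq, h]))
    (fun c hc x => hKc _ _ ((isotropy_circle h hc (fun i => cond i x (K x))).mpr (hK x).symm))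
    (fun x => hKc _ _ ((isotropy_diag h (fun i => cond i x (K x))).mpr (hK x).symm))
    (fun x => hKc _ _ ((isotropy_swap h (fun i => cond i x (K x))).mpr (hK x).symm))
  -- The sign `σ` normalizes the structure to `i` on the horizontal plane; `ε` is then the sign left
  -- on the fibre.
  obtain ⟨ε, σ, hε, hσ, h1, h2⟩ : ∃ ε σ : ℝ, (ε = 1 ∨ ε = -1) ∧ (σ = 1 ∨ σ = -1) ∧
      (σ : ℂ) * a = ε * Complex.I ∧ (σ : ℂ) * b = Complex.I := by
    rcases eq_I_or_of_mul_self ha with rfl | rfl <;> rcases eq_I_or_of_mul_self hb with rfl | rfl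
    · exact ⟨1, 1, by simp⟩
    · exact ⟨-1, -1, by simp⟩
    · exact ⟨-1, 1, by simp⟩
    · exact ⟨1, -1, by simp⟩
  refine ⟨ε, σ, hε, hσ, fun p u => ?_⟩
  refine tangent_induction_one (P := fun p u => IsTwist ε p u (σ • S.J p u)) ?_ ?_ p u
  · intro w hw
    have h3 := isTwist_baseVec hε hw
    have h4 : σ • S.J (CP3.proj baseVec) (CP3.dproj baseVec w) =
        CP3.dproj baseVec ![0, ε * Complex.I * w 1, Complex.I * w 2, Complex.I * w 3] := by
      rw [dproj_baseVec hw, ← hK, hab, ← baseTangent_smul, dproj_baseVec rfl]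
      congr 1
      ext k
      fin_cases k <;> simp [← mul_assoc, h1, h2]
    rwa [h4]
  · intro a p u h
    have h3 : σ • S.J (a • p) (dAct a p u) = dAct a p (σ • S.J p u) := by
      rw [hS.J_dAct]
      exact (map_smul (mfderiv 𝓘(ℝ, Fin 3 → ℂ) 𝓘(ℝ, Fin 3 → ℂ) (fun y : CP3 => a • y) p) σ
        (S.J p u)).symm
    rw [h3]
    exact h.dAct a

theorem eq_twistorStructure (hS : S.IsInvariant Sp2) (hNK : S.IsStrictlyNearlyKahler) :
    ∃ c ε : ℝ, 0 < c ∧ (ε = 1 ∨ ε = -1) ∧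
      ∀ (p : CP3) (u v : TangentSpace 𝓘(ℝ, Fin 3 → ℂ) p),
        S.g.inner p u v = c * twistorStructure.g.inner p u v ∧
          S.J p u = ε • twistorStructure.J p u := by
  obtain ⟨α, β, hβ, hg⟩ := hS.exists_twistorForm
  obtain ⟨ε, σ, hε, hσ, hJ⟩ := hS.exists_isTwist
  obtain ⟨D, hD, h0, Y, x, u, hY, hne⟩ := hNK
  have hσ2 : σ * σ = 1 := by rcases hσ with rfl | rfl <;> norm_num
  have hαβ : α = 2 * (2 - ε) * β := by
    -- A sum of a vertical and a horizontal vector is needed for `baseTriple X X` not to vanish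
    -- identically; with the test vector chosen next, its value is `8`.
    obtain ⟨X, hX, hX0⟩ := exists_diffFieldAt_eq (CP3.proj baseVec)
      (CP3.dproj baseVec ![0, 1, 1, 0])
    have h1 := inner_covDerivJ hσ2 S hg hJ hD hX (X (CP3.proj baseVec))
      (CP3.dproj baseVec ![0, 0, 0, Complex.I])
    rw [h0 X _ hX, hX0, nkTensor_baseVec_self _ _ _ rfl rfl] at h1
    have h2 : σ ≠ 0 := left_ne_zero_of_mul_eq_one hσ2
    simp [baseTriple, baseVert, baseDHopf, dotProduct, Matrix.mulVec, Fin.sum_univ_five, h2] at h1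
    linarith
  rcases hε with rfl | rfl
  -- For `ε = 1` the condition is `α = 2 β`, and then `D J = 0`, against strictness.
  · refine absurd (ext_inner S.g fun w => ?_) hne
    obtain rfl : α = 2 * β := by linarith
    rw [inner_covDerivJ hσ2 S hg hJ hD hY, nkTensor_eq_zero]
    simp
  -- Here `(α, β) = (6 β, β) = 8 β (3/4, 1/8)`.
  · refine ⟨8 * β, σ, by positivity, hσ, fun p u v => ⟨?_, ?_⟩⟩
    · refine (hg p u v).trans (Eq.trans ?_ (congrArg (8 * β * ·) (twistorMetric_inner p u v).symm))
      simp only [twistorForm, hαβ]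
      ring
    · have h1 : twistorStructure.J p u = σ • S.J p u := (hJ p u).jMinus_eq
      rw [h1, smul_smul, hσ2, one_smul]

end Uniqueness

/-- `ℂP³ = Sp(2) / U(1) Sp(1)` carries, up to homothety and sign, a unique invariant (strictly)
nearly Kähler structure: the structure `(g_1, J_-)` of the twistor space of `S⁴`. -/
theorem mainTheorem5 :
    (MulAction.IsPretransitive Sp2 CP3 ∧
      sp2Matrix '' (MulAction.stabilizer Sp2 CP3.basePoint : Set Sp2) =
        Set.range isotropyMatrix) ∧
    ∃ (j : CP3 → Matrix (Fin 5) (Fin 5) ℝ) (S₁ : AlmostHermitian (Fin 3 → ℂ) CP3),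
      IsTwistorIdentification j ∧ IsTwistorMetric j 1 S₁.g ∧ IsTwistorJMinus j S₁.J ∧
      S₁.IsInvariant Sp2 ∧ S₁.IsStrictlyNearlyKahler ∧
      ∀ S : AlmostHermitian (Fin 3 → ℂ) CP3, S.IsInvariant Sp2 → S.IsStrictlyNearlyKahler →
        ∃ c ε : ℝ, 0 < c ∧ (ε = 1 ∨ ε = -1) ∧
          ∀ (p : CP3) (u v : TangentSpace 𝓘(ℝ, Fin 3 → ℂ) p),
            S.g.inner p u v = c * S₁.g.inner p u v ∧ S.J p u = ε • S₁.J p u := by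
  refine ⟨⟨inferInstance, stabilizer_basePoint⟩, twistorJ, twistorStructure,
    isTwistorIdentification_twistorJ, isTwistorMetric_twistorStructure,
    isTwistorJMinus_twistorStructure, isInvariant_twistorStructure,
    isStrictlyNearlyKahler_twistorStructure, fun S hS hNK => eq_twistorStructure hS hNK⟩

end
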